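/- Let $V$ be a real vector space of finite dimension $n$, $\Gamma\subset V$ a lattice of rank $n$, $\Gamma^*\subset V^*$ the dual lattice, and $V_{\mathbb C}=V\otimes_{\mathbb R}\mathbb C$. Let $\Phi=[\beta_1,\dots,\beta_N]$ be a sequence of not necessarily distinct elements of $\Gamma^*$ that spans $V^*$ and lies in an open half-space (there is $v\in V$ with $\langle\beta_i,v\rangle>0$ for all $i$). For $\lambda\in V^*$ let $\Pi_\Phi(\lambda)=\{x\in\mathbb R_{\ge0}^N : \sum_i x_i\beta_i=\lambda\}$, and put $\mathrm{Box}(\Phi)=\sum_{i=1}^N[0,1]\beta_i$. A vector of $V^*$ is regular if it does not lie in any closed cone generated by fewer than $n$ elements of $\Phi$; a big chamber is a connected component of the set of regular vectors. Let $\mathcal B(\Phi)$ be the set of linearly independent $n$-tuples $\sigma$ of members of the sequence $\Phi$ (so that equal forms at different positions, which may carry different $y_j$, are distinguished), $C(\sigma)$ the closed convex cone generated by $\sigma$, and $f_\sigma=1/\prod_{\alpha\in\sigma}\alpha$. Let $R$ be the ring of rational functions on $V_{\mathbb C}$ with poles along the hyperplanes $\beta_i=0$, and let $S\subset R$ be the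 span of the $f_\sigma$, $\sigma\in\mathcal B(\Phi)$; one has $R=\big(\sum_{v\in V_{\mathbb C}}\partial_vR\big)\oplus S$. For a function $f=P/\prod_{i=1}^{r}\alpha_i$ with $P$ holomorphic near $0$ and $\alpha_i\in\Phi$, the total residue $\mathrm{Tres}(f)\in S$ is the projection to $S$, along $\sum_v\partial_vR$, of the component $P_{[r-n]}/\prod_i\alpha_i$ of $f$ that is homogeneous of degree $-n$ (where $P_{[d]}$ is the homogeneous part of degree $d$ of the Taylor series of $P$ at $0$). Let $\mathrm{vol}_{\Gamma^*}$ be the measure on $V^*$ that gives volume $1$ to the parallelepiped of a $\mathbb Z$-basis of $\Gamma^*$, and $\mathrm{vol}_{\Gamma^*}(\sigma)$ the volume of $\sum_{\alpha\in\sigma}[0,1]\alpha$. For a big chamber $\mathfrak c$ the Jeffrey–Kirwan residue $g\mapsto\langle\!\langle\mathfrak c,g\rangle\!\rangle$ is the linear functional on $S$ with $\langle\!\langle\mathfrak c,f_\sigma\rangle\!\rangle=\mathrm{vol}_{\Gamma^*}(\sigma)^{-1}$ if $\mathfrak c\subset C(\sigma)$ and $0$ otherwise. Let $\mathfrak c$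 be a big chamber and $y\in\mathbb C^N$. For $\sigma\in\mathcal B(\Phi)$ let $G(\sigma,y,\Gamma)$ be the set of $p\in V_{\mathbb C}$ with $e^{\langle\beta_j,p\rangle}=e^{-y_j}$ for all $\beta_j\in\sigma$, and let $G(\Phi,y,\mathfrak c,\Gamma)$ be the union of the sets $G(\sigma,y,\Gamma)$ over all $\sigma\in\mathcal B(\Phi)$ with $\mathfrak c\subset C(\sigma)$. This set is invariant under translation by $2\pi i\Gamma$ and consists of finitely many classes; let $RG(\Phi,y,\mathfrak c,\Gamma)$ be any finite subset of it containing exactly one point of each class modulo $2\pi i\Gamma$. **Theorem.** Such a finite set $RG(\Phi,y,\mathfrak c,\Gamma)$ exists, and for every choice of it the function $$\iota[\mathfrak c,y,\Phi](\lambda)=\sum_{p\in RG(\Phi,y,\mathfrak c,\Gamma)}e^{-\langle\lambda,p\rangle}\Big\langle\!\!\Big\langle\mathfrak c,\ \mathrm{Tres}\Big(\frac{e^{\langle\lambda,z\rangle}}{\prod_{i=1}^N\big(1-e^{\langle\beta_i,p\rangle}e^{y_i}e^{-\langle\beta_i,z\rangle}\big)}\Big)\Big\rangle\!\!\Big\rangle$$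 on $\Gamma^*$ is exponential-polynomial, i.e. belongs to the $\mathbb C$-algebra of functions on $\Gamma^*$ generated by the additive characters $\Gamma^*\to\mathbb C$ and the multiplicative characters $\Gamma^*\to\mathbb C^*$. For every $\lambda\in(\mathfrak c-\mathrm{Box}(\Phi))\cap\Gamma^*$ the set $\Pi_\Phi(\lambda)\cap\mathbb Z^N$ is finite and $$\sum_{\xi\in\Pi_\Phi(\lambda)\cap\mathbb Z^N}e^{\langle y,\xi\rangle}=\iota[\mathfrak c,y,\Phi](\lambda).$$ -/

import Mathlib

open scoped TensorProduct Topology Pointwise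

noncomputable section

namespace ExpSum

/-- The dual lattice of `Γ`: the linear forms on `V` taking integer values on `Γ`. -/
def dualLattice {V : Type*} [NormedAddCommGroup V] [NormedSpace ℝ V] (Γ : Submodule ℤ V) :
    AddSubgroup (StrongDual ℝ V) where
  carrier := {l | ∀ γ ∈ Γ, ∃ k : ℤ, l γ = k}
  zero_mem' := fun _ _ => ⟨0, by simp⟩
  add_mem' := by
    intro a b ha hb γ hγ
    obtain ⟨k, hk⟩ := ha γ hγ
    obtain ⟨m, hm⟩ := hb γ hγ
    exact ⟨k + m, by simp [hk, hm]⟩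
  neg_mem' := by
    intro a ha γ hγ
    obtain ⟨k, hk⟩ := ha γ hγ
    exact ⟨-k, by simp [hk]⟩

/-- The complexification `V_ℂ = ℂ ⊗ V`. -/
abbrev VC (V : Type*) [AddCommGroup V] [Module ℝ V] : Type _ := ℂ ⊗[ℝ] V

/-- The complex-linear extension to `V_ℂ` of a real linear form on `V`; this is the pairing
`z ↦ ⟨l, z⟩`, with `⟨l, c ⊗ v⟩ = c * l v`. -/
def pair {V : Type*} [NormedAddCommGroup V] [NormedSpace ℝ V] (l : StrongDual ℝ V) :
    VC V →ₗ[ℂ] ℂ :=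
  LinearMap.liftBaseChange ℂ (Complex.ofRealLI.toLinearMap ∘ₗ (l : V →ₗ[ℝ] ℝ))

/-! ### Exponential-polynomial functions -/

/-- Exponential-polynomial functions on an abelian group `W`: the algebra of complex functions
generated by the additive characters `W → ℂ` and the multiplicative characters `W → ℂˣ`. -/
def expPoly (W : Type*) [AddCommGroup W] : Subalgebra ℂ (W → ℂ) :=
  Algebra.adjoin ℂ ({f | ∃ a : W →+ ℂ, f = fun w => a w} ∪ {f | ∃ χ : AddChar W ℂ, f = fun w => χ w})

/-! ### Cones, chambers, polytopes -/

/-- The closed convex cone generated by a finite family of vectors. -/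
def coneOf {W κ : Type*} [AddCommGroup W] [Module ℝ W] [Fintype κ] (v : κ → W) : Set W :=
  {a | ∃ x : κ → ℝ, (∀ k, 0 ≤ x k) ∧ a = ∑ k, x k • v k}

section System

variable {V : Type*} [NormedAddCommGroup V] [NormedSpace ℝ V] {N : ℕ}

/-- Regular vectors: those in no cone generated by fewer than `dim V` elements of the system. -/
def regular (β : Fin N → StrongDual ℝ V) : Set (StrongDual ℝ V) :=
  {a | ∀ ν : Finset (Fin N), ν.card < Module.finrank ℝ V → a ∉ coneOf (fun i : ν => β i)}

/-- Big chambers: the connected components of the set of regular vectors. -/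
def IsBigChamber (β : Fin N → StrongDual ℝ V) (c : Set (StrongDual ℝ V)) : Prop :=
  ∃ a ∈ regular β, c = connectedComponentIn (regular β) a

/-- The partition polytope `Π_Φ(a)`. -/
def partitionPolytope (β : Fin N → StrongDual ℝ V) (a : StrongDual ℝ V) : Set (Fin N → ℝ) :=
  {x | (∀ i, 0 ≤ x i) ∧ ∑ i, x i • β i = a}

/-- The integral points of the partition polytope. -/
def latticePoints (β : Fin N → StrongDual ℝ V) (a : StrongDual ℝ V) : Set (Fin N → ℤ) :=
  {ξ | (fun i => (ξ i : ℝ)) ∈ partitionPolytope β a}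

/-- The sum of `e^{⟨y, ξ⟩}` over the integral points `ξ` of `Π_Φ(a)`. -/
def expSum (β : Fin N → StrongDual ℝ V) (y : Fin N → ℂ) (a : StrongDual ℝ V) : ℂ :=
  ∑ᶠ ξ ∈ latticePoints β a, Complex.exp (∑ i, y i * (ξ i : ℂ))

/-- `σ` is (the list of indices of) an element of `𝓑(Φ)`: a linearly independent `n`-tuple of
elements of the system, where `n = dim V`. -/
def IsBasisTuple (β : Fin N → StrongDual ℝ V) (σ : Fin (Module.finrank ℝ V) → Fin N) : Prop :=
  LinearIndependent ℝ (fun k => β (σ k))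

/-! ### Total residue -/

/-- The complement in `V_ℂ` of the hyperplanes `⟨β_i, z⟩ = 0`. -/
def complement (β : Fin N → StrongDual ℝ V) : Set (VC V) :=
  {z | ∀ i, pair (β i) z ≠ 0}

/-- The ring `R_𝒜` of rational functions on `V_ℂ` with poles along the hyperplanes
`⟨β_i, z⟩ = 0`, as functions on the complement of these hyperplanes. -/
def ratFun (β : Fin N → StrongDual ℝ V) : Subalgebra ℂ (complement β → ℂ) :=
  Algebra.adjoin ℂ
    ({f | ∃ l : VC V →ₗ[ℂ] ℂ, f = fun z : complement β => l (z : VC V)} ∪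
      {f | ∃ i : Fin N, f = fun z : complement β => (pair (β i) (z : VC V))⁻¹})

/-- The simple fraction `f_σ = 1 / ∏_{α ∈ σ} α`. -/
def simpleFrac (β : Fin N → StrongDual ℝ V) (σ : Fin (Module.finrank ℝ V) → Fin N) :
    complement β → ℂ :=
  fun z => (∏ k, pair (β (σ k)) z)⁻¹

/-- The space `S_𝒜` of simple elements: the span of the `f_σ`, `σ ∈ 𝓑(Φ)`. -/
def simpleElts (β : Fin N → StrongDual ℝ V) : Submodule ℂ (complement β → ℂ) :=
  Submodule.span ℂ {f | ∃ σ, IsBasisTuple β σ ∧ f = simpleFrac β σ}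

/-- The directional derivative `∂_v f` of a function on the complement of the hyperplanes. -/
def dirDeriv (β : Fin N → StrongDual ℝ V) (v : VC V) (f : complement β → ℂ) :
    complement β → ℂ :=
  fun z => lineDeriv ℂ (Function.extend Subtype.val f 0) (z : VC V) v

/-- The space `∑_v ∂_v R_𝒜`. -/
def derivs (β : Fin N → StrongDual ℝ V) : Submodule ℂ (complement β → ℂ) :=
  Submodule.span ℂ {g | ∃ v : VC V, ∃ f ∈ ratFun β, g = dirDeriv β v f}

open Classical in
/-- The coefficient of `t ^ m` in the Laurent expansion at `0` of a function `g` that is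
meromorphic at `0`: if `t ^ k * g t` is analytic at `0`, it is the Taylor coefficient of order
`m + k` of that function (and `0` if `m + k < 0`); it does not depend on `k`. -/
def laurentCoeff (g : ℂ → ℂ) (m : ℤ) : ℂ :=
  if h : ∃ k : ℕ, AnalyticAt ℂ (fun t => t ^ k * g t) 0 then
    if 0 ≤ m + h.choose then
      iteratedDeriv (m + h.choose).toNat (fun t => t ^ h.choose * g t) 0 /
        ((m + h.choose).toNat.factorial : ℂ)
    else 0
  else 0

/-- The homogeneous component of degree `m` of a function `f` on `V_ℂ` that is meromorphic near `0`
with poles along the hyperplanes. If `f = P / ∏_{i=1}^R α_i` near `0`, with `P` holomorphic and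
each `α_i` one of the forms `β_j`, then `f (t z) = t ^ (-R) P (t z) / ∏ α_i(z)`, so that this is the
function `P_{[R + m]} / ∏ α_i`, where `P_{[d]}` is the homogeneous component of degree `d` of the
Taylor series of `P` (zero if `d < 0`). -/
def homComponent (β : Fin N → StrongDual ℝ V) (f : VC V → ℂ) (m : ℤ) : complement β → ℂ :=
  fun z => laurentCoeff (fun t => f (t • (z : VC V))) m

open Classical in
/-- The total residue `Tres f` of a function `f` on `V_ℂ` that is meromorphic near `0` with poles
along the hyperplanes: the projection to `S_𝒜`, along `∑_v ∂_v R_𝒜`, of the homogeneous component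
of `f` of degree `-n`. (`R_𝒜` is the direct sum of `∑_v ∂_v R_𝒜` and `S_𝒜`, and the projection
vanishes on homogeneous elements of any degree other than `-n`.) -/
def Tres (β : Fin N → StrongDual ℝ V) (f : VC V → ℂ) : simpleElts β :=
  if h : ∃ s : simpleElts β,
      homComponent β f (-(Module.finrank ℝ V : ℤ)) - (s : complement β → ℂ) ∈ derivs β then
    h.choose
  else 0

/-! ### Jeffrey–Kirwan residue -/

open Classical in
/-- The measure on `V*` that gives volume `1` to a minimal parallelepiped spanned by elements of
`Γ*`, that is, to the parallelepiped of a `ℤ`-basis of `Γ*` (any of them gives the same measure). -/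
def volDual [FiniteDimensional ℝ V] (Γ : Submodule ℤ V) :
    MeasureTheory.Measure (StrongDual ℝ V) :=
  if h : ∃ e : Module.Basis (Fin (Module.finrank ℝ V)) ℝ (StrongDual ℝ V),
      AddSubgroup.closure (Set.range e) = dualLattice Γ then
    h.choose.addHaar
  else 0

open Classical in
/-- The defining property of the Jeffrey–Kirwan residue: `f_σ ↦ vol(σ)⁻¹` if `c ⊆ C(σ)` and
`f_σ ↦ 0` otherwise, where `vol(σ)` is the volume of the parallelepiped `∑_{α ∈ σ} [0,1] α`.
(If a big chamber `c` is not contained in `C(σ)`, then it is disjoint from `C(σ)`.) -/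
def IsJK [FiniteDimensional ℝ V] (Γ : Submodule ℤ V) (β : Fin N → StrongDual ℝ V)
    (c : Set (StrongDual ℝ V)) (J : simpleElts β →ₗ[ℂ] ℂ) : Prop :=
  ∀ (σ : Fin (Module.finrank ℝ V) → Fin N) (hσ : IsBasisTuple β σ),
    J ⟨simpleFrac β σ, Submodule.subset_span ⟨σ, hσ, rfl⟩⟩ =
      if c ⊆ coneOf (fun k => β (σ k)) then
        ((((volDual Γ) (parallelepiped (fun k => β (σ k)))).toReal)⁻¹ : ℂ)
      else 0

open Classical in
/-- The Jeffrey–Kirwan residue `f ↦ ⟪c, f vol_{Γ*}⟫` on `S_𝒜`. It is the unique linear functional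
with the property `IsJK`. -/
def JK [FiniteDimensional ℝ V] (Γ : Submodule ℤ V) (β : Fin N → StrongDual ℝ V)
    (c : Set (StrongDual ℝ V)) : simpleElts β →ₗ[ℂ] ℂ :=
  if h : ∃ J : simpleElts β →ₗ[ℂ] ℂ, IsJK Γ β c J then h.choose else 0

/-! ### The function `ι[c, y, Φ]` -/

/-- The set `G(Φ, y, c, Γ)`: the union over the bases `σ ∈ 𝓑(Φ)` with `c ⊆ C(σ)` of the sets
`G(σ, y, Γ)` of all `p ∈ V_ℂ` with `e^{⟨β_j, p⟩} = e^{-y_j}` for all `β_j ∈ σ`. -/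
def poleSet (β : Fin N → StrongDual ℝ V) (y : Fin N → ℂ) (c : Set (StrongDual ℝ V)) :
    Set (VC V) :=
  {p | ∃ σ : Fin (Module.finrank ℝ V) → Fin N, IsBasisTuple β σ ∧
    c ⊆ coneOf (fun k => β (σ k)) ∧
    ∀ k, Complex.exp (pair (β (σ k)) p) = Complex.exp (-y (σ k))}

/-- Equivalence of points of `V_ℂ` modulo `2πiΓ`. -/
def EquivMod (Γ : Submodule ℤ V) (p q : VC V) : Prop :=
  ∃ γ ∈ Γ, p - q = (2 * Real.pi * Complex.I : ℂ) ⊗ₜ[ℝ] γ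

/-- `RG` is a reduced set `RG(Φ, y, c, Γ)`: a finite subset of `G(Φ, y, c, Γ)` that contains
exactly one point of each class modulo `2πiΓ`. -/
def IsReducedPoleSet (Γ : Submodule ℤ V) (β : Fin N → StrongDual ℝ V) (y : Fin N → ℂ)
    (c : Set (StrongDual ℝ V)) (RG : Finset (VC V)) : Prop :=
  (∀ p ∈ RG, p ∈ poleSet β y c) ∧ ∀ p ∈ poleSet β y c, ∃! q, q ∈ RG ∧ EquivMod Γ p q

/-- The function `ι[c, y, Φ]` on `Γ*`, computed with the reduced set `RG`. -/
def iota [FiniteDimensional ℝ V] (Γ : Submodule ℤ V) (β : Fin N → StrongDual ℝ V)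
    (y : Fin N → ℂ) (c : Set (StrongDual ℝ V)) (RG : Finset (VC V)) (l : dualLattice Γ) : ℂ :=
  ∑ p ∈ RG, Complex.exp (-pair (l : StrongDual ℝ V) p) *
    JK Γ β c (Tres β (fun z => Complex.exp (pair (l : StrongDual ℝ V) z) /
      ∏ i, (1 - Complex.exp (pair (β i) p) * Complex.exp (y i) * Complex.exp (-pair (β i) z))))

end System

end ExpSum

end

set_option linter.unusedSectionVars false

noncomputable section

namespace ExpSum

/-! ### The pairing -/

section Pairing

variable {V : Type*} [NormedAddCommGroup V] [NormedSpace ℝ V]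

/-! Both sides of the formula belong to families indexed by multisets `Φ` of weights, a weight being
an element of `Γ*` with a nonzero multiplier, and both families obey the recurrence
`IsDifferenceSystem`: passing from `b ::ₘ Φ` to `Φ` multiplies the generating function by the
denominator belonging to `b`. For the partition function this inverts a geometric series, for the
sum of residues it cancels a factor. So the difference `X` of the two families obeys the recurrence,
and the claim is that it vanishes on `a - Box(Φ)`, where `a` is a point of the chamber lying in no
proper rational subspace (`IsGeneric`).

Three identities reduce an arbitrary system to linearly independent weights with multiplicities:
1/((1-x)(1-y)) = 1/((1-xy)(1-y)) + x/((1-xy)(1-x)), 1/(1-x) = (1+...+x^(m-1))/(1-x^m), and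
(v-u)/((1-ux)(1-vx)) = v/(1-vx) - u/(1-ux). The shifts of the argument in them are matched by the
change of the zonotope, so vanishing on `a - Box` is transported (`VanishesOn.of_add`,
`VanishesOn.of_nsmul`, `VanishesOn.of_parallel`); `VanishesOn.of_independent` organises the
induction.

For `n` independent weights everything is explicit (`partitionFun_eq_residueSum_of_basis`). The
polar characters form a coset of the dual of a finite group of order |det|; their sum cancels the
factor 1/|det| of the residue and detects the sublattice generated by the weights. There remains a
product over coordinates of the coefficients [X^(m-1)] e^(lX) (X/(1-e^(-X)))^m, which count
multisets when l ≥ 0 and vanish when -m < l < 0; the box condition excludes smaller l. With fewer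
than `n` independent weights both sides vanish because `a` is generic.

The reduction creates forms that are not in the original system, so a residue is needed that is
defined simultaneously on Laurent monomials in all rational forms positive on the tube Re⟨β_i, z⟩ >
0. This is `exists_residue_functional`. Monomials with all exponents negative are Laplace transforms
of densities on cones; those with a nonnegative exponent are killed by iterated finite differences,
which multiply a density by a factor nonzero on the ray through `a`. By Fourier inversion, a linear
relation between monomials makes the total density vanish along this ray, and at the limit point 0
only the exponents -1 survive.

This functional kills derivatives and has the Jeffrey–Kirwan values on the `f_σ`, hence it computes
the Jeffrey–Kirwan residue of `Tres` (`JK_Tres_eq`). Points of `V_ℂ` modulo `2πiΓ` are the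
characters of `Γ*`, and only characters from the pole set have a nonzero residue, so `iota` is the
residue sum (`iota_eq_residueSum`). The residue at a character is the character times a polynomial
in `l`, which makes `iota` exponential-polynomial. -/

theorem pair_tmul (l : StrongDual ℝ V) (c : ℂ) (v : V) : pair l (c ⊗ₜ[ℝ] v) = c * (l v : ℂ) := by
  simp [pair]

theorem pair_ext {f g : VC V →ₗ[ℂ] ℂ} (h : ∀ v : V, f (1 ⊗ₜ v) = g (1 ⊗ₜ v)) : f = g := by
  ext v
  simpa using h v

variable (V) in
/-- The pairing as a real-linear map. -/
def pairLin : StrongDual ℝ V →ₗ[ℝ] (VC V →ₗ[ℂ] ℂ) where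
  toFun := pair
  map_add' a b := pair_ext fun v => by simp [pair_tmul]
  map_smul' r a := pair_ext fun v => by simp [pair_tmul]

theorem pairLin_apply (l : StrongDual ℝ V) : pairLin V l = pair l := rfl

theorem pair_add (a b : StrongDual ℝ V) (z : VC V) : pair (a + b) z = pair a z + pair b z := by
  simp [← pairLin_apply]

theorem pair_sub (a b : StrongDual ℝ V) (z : VC V) : pair (a - b) z = pair a z - pair b z := by
  simp [← pairLin_apply]

theorem pair_neg (a : StrongDual ℝ V) (z : VC V) : pair (-a) z = -pair a z := by
  simp [← pairLin_apply]

theorem pair_zero (z : VC V) : pair (0 : StrongDual ℝ V) z = 0 := by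
  simp [← pairLin_apply]

theorem pair_smul (r : ℝ) (a : StrongDual ℝ V) (z : VC V) : pair (r • a) z = r * pair a z := by
  simp [← pairLin_apply]

theorem pair_nsmul (r : ℕ) (a : StrongDual ℝ V) (z : VC V) : pair (r • a) z = r * pair a z := by
  simp [← pairLin_apply]

theorem pair_sum {ι : Type*} (s : Finset ι) (a : ι → StrongDual ℝ V) (z : VC V) :
    pair (∑ i ∈ s, a i) z = ∑ i ∈ s, pair (a i) z := by
  simp [← pairLin_apply]

theorem eq_sum_apply_smul {ι : Type*} [Fintype ι] [DecidableEq ι]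
    {e : Module.Basis ι ℝ (StrongDual ℝ V)} {γ : Module.Basis ι ℝ V}
    (h : ∀ i j, e i (γ j) = if i = j then 1 else 0) (x : V) : x = ∑ j, e j x • γ j := by
  conv_lhs => rw [← γ.sum_repr x]
  refine Finset.sum_congr rfl fun j _ => ?_
  congr 1
  have : e j x = e j (∑ i, γ.repr x i • γ i) := by rw [γ.sum_repr x]
  rw [this, map_sum]
  simp only [map_smul, h, smul_eq_mul, mul_ite, mul_one, mul_zero, Finset.sum_ite_eq,
    Finset.mem_univ, if_true]

theorem repr_apply_eq {ι : Type*} [Fintype ι] [DecidableEq ι]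
    {e : Module.Basis ι ℝ (StrongDual ℝ V)} {γ : Module.Basis ι ℝ V}
    (h : ∀ i j, e i (γ j) = if i = j then 1 else 0) (l : StrongDual ℝ V) (j : ι) :
    e.repr l j = l (γ j) := by
  have : l (γ j) = (∑ i, e.repr l i • e i) (γ j) := by rw [e.sum_repr l]
  rw [this, sum_apply]
  simp only [smul_apply, h, smul_eq_mul, mul_ite, mul_one, mul_zero,
    Finset.sum_ite_eq', Finset.mem_univ, if_true]

theorem form_eq_sum_apply_smul {ι : Type*} [Fintype ι] [DecidableEq ι]
    {e : Module.Basis ι ℝ (StrongDual ℝ V)} {γ : Module.Basis ι ℝ V}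
    (h : ∀ i j, e i (γ j) = if i = j then 1 else 0) (l : StrongDual ℝ V) :
    l = ∑ j, l (γ j) • e j := by
  conv_lhs => rw [← e.sum_repr l]
  exact Finset.sum_congr rfl fun j _ => by rw [repr_apply_eq h]

theorem eq_sum_pair_tmul {ι : Type*} [Fintype ι] [DecidableEq ι]
    {e : Module.Basis ι ℝ (StrongDual ℝ V)} {γ : Module.Basis ι ℝ V}
    (h : ∀ i j, e i (γ j) = if i = j then 1 else 0) (z : VC V) :
    z = ∑ j, pair (e j) z ⊗ₜ[ℝ] γ j := by
  induction z using TensorProduct.induction_on with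
  | zero => simp
  | add x y hx hy =>
    conv_lhs => rw [hx, hy]
    simp [TensorProduct.add_tmul, Finset.sum_add_distrib]
  | tmul c x =>
    conv_lhs => rw [eq_sum_apply_smul h x]
    rw [TensorProduct.tmul_sum]
    refine Finset.sum_congr rfl fun j _ => ?_
    rw [pair_tmul, ← TensorProduct.smul_tmul, Complex.real_smul, mul_comm]

theorem pair_sum_tmul {ι : Type*} [Fintype ι] [DecidableEq ι]
    {e : Module.Basis ι ℝ (StrongDual ℝ V)} {γ : Module.Basis ι ℝ V}
    (h : ∀ i j, e i (γ j) = if i = j then 1 else 0) (ζ : ι → ℂ) (i : ι) :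
    pair (e i) (∑ j, ζ j ⊗ₜ[ℝ] γ j) = ζ i := by
  rw [map_sum, Finset.sum_eq_single i (fun j _ hj => by simp [pair_tmul, h, hj.symm]) (by simp)]
  simp [pair_tmul, h]

theorem linearMap_eq_sum_pair {ι : Type*} [Fintype ι] [DecidableEq ι]
    {e : Module.Basis ι ℝ (StrongDual ℝ V)} {γ : Module.Basis ι ℝ V}
    (h : ∀ i j, e i (γ j) = if i = j then 1 else 0) (l : VC V →ₗ[ℂ] ℂ) (z : VC V) :
    l z = ∑ j, l (1 ⊗ₜ γ j) * pair (e j) z := by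
  conv_lhs => rw [eq_sum_pair_tmul h z]
  rw [map_sum]
  refine Finset.sum_congr rfl fun j _ => ?_
  rw [mul_comm, ← smul_eq_mul, ← map_smul, TensorProduct.smul_tmul', smul_eq_mul, mul_one]

variable [FiniteDimensional ℝ V]

theorem finrank_strongDual : Module.finrank ℝ (StrongDual ℝ V) = Module.finrank ℝ V := by
  rw [← LinearEquiv.finrank_eq (LinearMap.toContinuousLinearMap (𝕜 := ℝ) (E := V) (F' := ℝ))]
  exact Subspace.dual_finrank_eq

/-- The basis given by a linearly independent family of `dim V` linear forms. -/
def tupleBasis (σ : Fin (Module.finrank ℝ V) → StrongDual ℝ V) (h : LinearIndependent ℝ σ) :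
    Module.Basis (Fin (Module.finrank ℝ V)) ℝ (StrongDual ℝ V) :=
  basisOfLinearIndependentOfCardEqFinrank' σ h (by rw [Fintype.card_fin, finrank_strongDual])

@[simp] theorem coe_tupleBasis (σ : Fin (Module.finrank ℝ V) → StrongDual ℝ V)
    (h : LinearIndependent ℝ σ) : ⇑(tupleBasis σ h) = σ := by
  simp [tupleBasis]

theorem exists_dual_basis {ι : Type*} [Fintype ι] [DecidableEq ι]
    (e : Module.Basis ι ℝ (StrongDual ℝ V)) :
    ∃ γ : Module.Basis ι ℝ V, ∀ i j, e i (γ j) = if i = j then 1 else 0 := by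
  let Φ : StrongDual ℝ V ≃ₗ[ℝ] Module.Dual ℝ V :=
    (LinearMap.toContinuousLinearMap (𝕜 := ℝ) (E := V) (F' := ℝ)).symm
  let e' : Module.Basis ι ℝ (Module.Dual ℝ V) := e.map Φ
  refine ⟨e'.dualBasis.map (Module.evalEquiv ℝ V).symm, fun i j => ?_⟩
  have h1 : e i (e'.dualBasis.map (Module.evalEquiv ℝ V).symm j) =
      e' i ((Module.evalEquiv ℝ V).symm (e'.dualBasis j)) := rfl
  rw [h1, Module.apply_evalEquiv_symm_apply, Module.Basis.dualBasis_apply_self]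

theorem eq_of_pair_eq {ι : Type*} [Fintype ι]
    (e : Module.Basis ι ℝ (StrongDual ℝ V)) {z w : VC V} (h : ∀ i, pair (e i) z = pair (e i) w) :
    z = w := by
  classical
  obtain ⟨γ, hγ⟩ := exists_dual_basis e
  rw [eq_sum_pair_tmul hγ z, eq_sum_pair_tmul hγ w]
  simp [h]

end Pairing

/-! ### Partial fractions -/

section PartialFractions

variable {V : Type*} [NormedAddCommGroup V] [NormedSpace ℝ V]

/-- Laurent monomials in a family of linear forms. -/
def laurentMono {κ : Type*} [Fintype κ] (σ : κ → StrongDual ℝ V) (m : κ → ℤ) (z : VC V) : ℂ :=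
  ∏ k, pair (σ k) z ^ m k

/-- The span, as functions on `X`, of the Laurent monomials in `dim V` independent forms of `B` in
which only forms of `A` have negative exponents. -/
def monoSpan (X : Set (VC V)) (B A : Set (StrongDual ℝ V)) : Submodule ℂ (X → ℂ) :=
  Submodule.span ℂ {f | ∃ σ : Fin (Module.finrank ℝ V) → StrongDual ℝ V,
    LinearIndependent ℝ σ ∧ (∀ k, σ k ∈ B) ∧ ∃ m : Fin (Module.finrank ℝ V) → ℤ,
      (∀ k, m k < 0 → σ k ∈ A) ∧ f = fun z : X => laurentMono σ m z}

variable {X : Set (VC V)} {B A : Set (StrongDual ℝ V)}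

theorem laurentMono_update_mul {κ : Type*} [Fintype κ] [DecidableEq κ] (σ : κ → StrongDual ℝ V)
    (m : κ → ℤ) (k : κ) (z : VC V) (h : m k < 0 → pair (σ k) z ≠ 0) :
    laurentMono σ (Function.update m k (m k + 1)) z = pair (σ k) z * laurentMono σ m z := by
  unfold laurentMono
  rw [← Finset.mul_prod_erase _ _ (Finset.mem_univ k),
    ← Finset.mul_prod_erase _ (fun k => pair (σ k) z ^ m k) (Finset.mem_univ k), ← mul_assoc]
  congr 1
  · rw [Function.update_self]
    rcases lt_or_ge (m k) 0 with h0 | h0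
    · rw [zpow_add_one₀ (h h0), mul_comm]
    · obtain ⟨j, hj⟩ := Int.eq_ofNat_of_zero_le h0
      rw [hj]
      exact_mod_cast pow_succ' (pair (σ k) z) j
  · refine Finset.prod_congr rfl fun j hj => ?_
    rw [Function.update_of_ne (Finset.ne_of_mem_erase hj)]

variable [FiniteDimensional ℝ V]

/-- Expanding `l` in the basis `σ` raises one exponent at a time, and this creates no new negative
exponent. -/
theorem pair_mul_mem_monoSpan (hX : ∀ γ ∈ A, ∀ z ∈ X, pair γ z ≠ 0) (l : StrongDual ℝ V)
    {f : X → ℂ} (hf : f ∈ monoSpan X B A) : (fun z : X => pair l (z : VC V)) * f ∈ monoSpan X B A := by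
  induction hf using Submodule.span_induction with
  | zero => simp
  | add x y _ _ hx hy => rw [mul_add]; exact add_mem hx hy
  | smul c x _ hx => rw [mul_smul_comm]; exact Submodule.smul_mem _ _ hx
  | mem f hf =>
    obtain ⟨σ, hσ, hB, m, hm, rfl⟩ := hf
    have hl : (fun z : X => pair l (z : VC V)) * (fun z : X => laurentMono σ m z) =
        ∑ k, ((tupleBasis σ hσ).repr l k : ℂ) •
          fun z : X => laurentMono σ (Function.update m k (m k + 1)) z := by
      ext z
      simp only [Pi.mul_apply, Finset.sum_apply, Pi.smul_apply, smul_eq_mul]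
      conv_lhs => rw [← (tupleBasis σ hσ).sum_repr l]
      rw [pair_sum, Finset.sum_mul]
      refine Finset.sum_congr rfl fun k _ => ?_
      rw [laurentMono_update_mul _ _ _ _ fun h => hX _ (hm k h) _ z.2, pair_smul, coe_tupleBasis,
        mul_assoc]
    rw [hl]
    refine Submodule.sum_mem _ fun k _ => Submodule.smul_mem _ _ (Submodule.subset_span
      ⟨σ, hσ, hB, _, fun j hj => ?_, rfl⟩)
    by_cases hjk : j = k
    · subst hjk
      rw [Function.update_self] at hj
      exact hm j (by linarith)
    · rw [Function.update_of_ne hjk] at hj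
      exact hm j hj

theorem pair_pow_mul_mem_monoSpan (hX : ∀ γ ∈ A, ∀ z ∈ X, pair γ z ≠ 0) (l : StrongDual ℝ V) (r : ℕ)
    {f : X → ℂ} (hf : f ∈ monoSpan X B A) :
    (fun z : X => pair l (z : VC V) ^ r) * f ∈ monoSpan X B A := by
  induction r with
  | zero =>
    have : (fun z : X => pair l (z : VC V) ^ 0) * f = f := by ext; simp
    rwa [this]
  | succ r ih =>
    have : (fun z : X => pair l (z : VC V) ^ (r + 1)) * f =
        (fun z : X => pair l (z : VC V)) * ((fun z : X => pair l (z : VC V) ^ r) * f) := by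
      ext; simp [pow_succ']; ring
    rw [this]
    exact pair_mul_mem_monoSpan hX l ih

/-- Partial fractions, by induction on the total pole order of the monomial. The power `r` is
arbitrary because the reduction step increases it. -/
theorem inv_pow_mul_laurentMono_mem (hX : ∀ γ ∈ A, ∀ z ∈ X, pair γ z ≠ 0) (hAB : A ⊆ B)
    {γ : StrongDual ℝ V} (hγ : γ ∈ A) (N : ℕ) :
    ∀ (σ : Fin (Module.finrank ℝ V) → StrongDual ℝ V) (m : Fin (Module.finrank ℝ V) → ℤ) (r : ℕ),
      LinearIndependent ℝ σ → (∀ k, σ k ∈ B) → (∀ k, m k < 0 → σ k ∈ A) →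
      ∑ k, (-m k).toNat = N →
      (fun z : X => (pair γ (z : VC V) ^ r)⁻¹ * laurentMono σ m z) ∈ monoSpan X B A := by
  induction N using Nat.strong_induction_on with
  | _ N ih =>
  intro σ m r hσ hB hm hN
  set c := (tupleBasis σ hσ).repr γ with hc
  have hγc : γ = ∑ k, c k • σ k := by
    conv_lhs => rw [← (tupleBasis σ hσ).sum_repr γ, coe_tupleBasis]
  -- Exchange: if `γ` involves some `σ k` that has no pole, then `γ` replaces `σ k` in the tuple,
  -- and the power of `σ k` is multiplied back as a polynomial.
  by_cases hk : ∃ k, c k ≠ 0 ∧ 0 ≤ m k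
  · obtain ⟨k, hck, hmk⟩ := hk
    obtain ⟨j, hj⟩ := Int.eq_ofNat_of_zero_le hmk
    have hind : LinearIndependent ℝ (Function.update σ k γ) := by
      refine hσ.update k γ ⟨1, one_mem _, c, mem_nonZeroDivisors_of_ne_zero hck, ?_⟩
      have := (tupleBasis σ hσ).linearCombination_repr γ
      rw [coe_tupleBasis] at this
      rw [one_smul, hc, this]
    have key : (fun z : X => (pair γ (z : VC V) ^ r)⁻¹ * laurentMono σ m z) =
        (fun z : X => pair (σ k) (z : VC V) ^ j) *
          (fun z : X => laurentMono (Function.update σ k γ) (Function.update m k (-r)) z) := by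
      ext z
      simp only [Pi.mul_apply]
      unfold laurentMono
      rw [← Finset.mul_prod_erase _ _ (Finset.mem_univ k),
        ← Finset.mul_prod_erase _ (fun i => pair (Function.update σ k γ i) (z : VC V) ^
          (Function.update m k (-r : ℤ) i)) (Finset.mem_univ k)]
      rw [Function.update_self, Function.update_self, hj, zpow_neg, zpow_natCast]
      have : ∏ x ∈ Finset.univ.erase k, pair (Function.update σ k γ x) (z : VC V) ^
          (Function.update m k (-r : ℤ) x) = ∏ x ∈ Finset.univ.erase k, pair (σ x) (z : VC V) ^ m x :=
        Finset.prod_congr rfl fun i hi => by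
          rw [Function.update_of_ne (Finset.ne_of_mem_erase hi),
            Function.update_of_ne (Finset.ne_of_mem_erase hi)]
      rw [this]
      simp only [zpow_natCast]
      ring
    rw [key]
    refine pair_pow_mul_mem_monoSpan hX _ _ (Submodule.subset_span ⟨_, hind, fun i => ?_, _,
      fun i hi => ?_, rfl⟩)
    · by_cases hik : i = k
      · subst hik; rw [Function.update_self]; exact hAB hγ
      · rw [Function.update_of_ne hik]; exact hB i
    · by_cases hik : i = k
      · subst hik; rw [Function.update_self]; exact hγ
      · rw [Function.update_of_ne hik] at hi ⊢; exact hm i hi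
  -- Otherwise every form occurring in `γ` has a negative exponent. Writing 1 as the sum of the `c k
  -- * σ k / γ`, each term has a smaller pole order in `σ`, at the cost of one more factor `γ`
  -- below.
  · push Not at hk
    have key : (fun z : X => (pair γ (z : VC V) ^ r)⁻¹ * laurentMono σ m z) =
        ∑ k, (c k : ℂ) • fun z : X => (pair γ (z : VC V) ^ (r + 1))⁻¹ *
          laurentMono σ (Function.update m k (m k + 1)) z := by
      ext z
      simp only [Finset.sum_apply, Pi.smul_apply, smul_eq_mul]
      have h0 := hX γ hγ z z.2
      have h1 : ∀ k, (c k : ℂ) * ((pair γ (z : VC V) ^ (r + 1))⁻¹ *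
          laurentMono σ (Function.update m k (m k + 1)) z) =
          (pair γ (z : VC V) ^ (r + 1))⁻¹ * laurentMono σ m z * pair (c k • σ k) z := by
        intro k
        rw [laurentMono_update_mul _ _ _ _ fun h => hX _ (hm k h) _ z.2, pair_smul]
        ring
      rw [Finset.sum_congr rfl fun k _ => h1 k, ← Finset.mul_sum, ← pair_sum, ← hγc]
      rw [pow_succ]
      field_simp
    rw [key]
    refine Submodule.sum_mem _ fun k _ => ?_
    by_cases hck : c k = 0
    · simp [hck]
    refine Submodule.smul_mem _ _ ?_
    have hmk := hk k hck
    refine ih _ ?_ σ _ (r + 1) hσ hB (fun i hi => ?_) rfl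
    · rw [← hN]
      refine Finset.sum_lt_sum (fun i _ => ?_) ⟨k, Finset.mem_univ k, ?_⟩
      · by_cases hik : i = k
        · subst hik; rw [Function.update_self]; omega
        · rw [Function.update_of_ne hik]
      · rw [Function.update_self]; omega
    · by_cases hik : i = k
      · subst hik; exact hm i hmk
      · rw [Function.update_of_ne hik] at hi; exact hm i hi

theorem inv_mul_mem_monoSpan (hX : ∀ γ ∈ A, ∀ z ∈ X, pair γ z ≠ 0) (hAB : A ⊆ B)
    {γ : StrongDual ℝ V} (hγ : γ ∈ A)
    {f : X → ℂ} (hf : f ∈ monoSpan X B A) :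
    (fun z : X => (pair γ (z : VC V))⁻¹) * f ∈ monoSpan X B A := by
  induction hf using Submodule.span_induction with
  | zero => simp
  | add x y _ _ hx hy => rw [mul_add]; exact add_mem hx hy
  | smul c x _ hx => rw [mul_smul_comm]; exact Submodule.smul_mem _ _ hx
  | mem f hf =>
    obtain ⟨σ, hσ, hB, m, hm, rfl⟩ := hf
    have := inv_pow_mul_laurentMono_mem hX hAB hγ _ σ m 1 hσ hB hm rfl
    simpa [Pi.mul_def] using this

theorem one_mem_monoSpan (hB : Submodule.span ℝ B = ⊤) : (1 : X → ℂ) ∈ monoSpan X B A := by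
  obtain ⟨b, hb, hspan, hli⟩ := exists_linearIndependent ℝ B
  rw [hB] at hspan
  let bb : Module.Basis b ℝ (StrongDual ℝ V) := Module.Basis.mk hli (by simp [hspan])
  have : Finite b := Module.Finite.finite_basis bb
  have : Fintype b := Fintype.ofFinite b
  have hcard : Fintype.card b = Module.finrank ℝ V := by
    rw [← Module.finrank_eq_card_basis bb, finrank_strongDual]
  let E : Fin (Module.finrank ℝ V) ≃ b := (Fintype.equivFinOfCardEq hcard).symm
  refine Submodule.subset_span ⟨fun k => (E k : StrongDual ℝ V), hli.comp _ E.injective,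
    fun k => hb (E k).2, 0, by simp, ?_⟩
  ext z
  simp [laurentMono]

/-- The functions which preserve `monoSpan` by multiplication. -/
def monoMultiplier (X : Set (VC V)) (B A : Set (StrongDual ℝ V)) : Subalgebra ℂ (X → ℂ) where
  carrier := {g | ∀ f ∈ monoSpan X B A, g * f ∈ monoSpan X B A}
  mul_mem' := by
    intro a b ha hb f hf
    rw [mul_assoc]
    exact ha _ (hb _ hf)
  add_mem' := by
    intro a b ha hb f hf
    rw [add_mul]
    exact add_mem (ha _ hf) (hb _ hf)
  algebraMap_mem' := by
    intro r f hf
    rw [← Algebra.smul_def]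
    exact Submodule.smul_mem _ _ hf

/-- The span is not visibly closed under products, but its multipliers form an algebra, and they lie
in the span because 1 does. Membership then needs checking only on algebra generators. -/
theorem mem_monoSpan_of_mem_monoMultiplier (hB : Submodule.span ℝ B = ⊤) {f : X → ℂ}
    (hf : f ∈ monoMultiplier X B A) : f ∈ monoSpan X B A := by
  simpa using hf 1 (one_mem_monoSpan hB)

theorem pair_mem_monoMultiplier (hX : ∀ γ ∈ A, ∀ z ∈ X, pair γ z ≠ 0) (l : StrongDual ℝ V) :
    (fun z : X => pair l (z : VC V)) ∈ monoMultiplier X B A :=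
  fun _ hf => pair_mul_mem_monoSpan hX l hf

theorem inv_mem_monoMultiplier (hX : ∀ γ ∈ A, ∀ z ∈ X, pair γ z ≠ 0) (hAB : A ⊆ B)
    {γ : StrongDual ℝ V} (hγ : γ ∈ A) :
    (fun z : X => (pair γ (z : VC V))⁻¹) ∈ monoMultiplier X B A :=
  fun _ hf => inv_mul_mem_monoSpan hX hAB hγ hf

theorem ratFun_le_monoMultiplier {N : ℕ} (β : Fin N → StrongDual ℝ V) :
    ratFun β ≤ monoMultiplier (complement β) (Set.range β) (Set.range β) := by
  have hX : ∀ γ ∈ Set.range β, ∀ z ∈ complement β, pair γ z ≠ 0 := by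
    rintro _ ⟨i, rfl⟩ z hz
    exact hz i
  refine Algebra.adjoin_le ?_
  rintro f (⟨l, rfl⟩ | ⟨i, rfl⟩)
  · obtain ⟨γ, hγ⟩ := exists_dual_basis
      (Module.finBasis ℝ (StrongDual ℝ V))
    have : (fun z : complement β => l (z : VC V)) =
        ∑ j, l (1 ⊗ₜ γ j) • fun z : complement β =>
          pair (Module.finBasis ℝ (StrongDual ℝ V) j) (z : VC V) := by
      ext z
      simp only [Finset.sum_apply, Pi.smul_apply, smul_eq_mul]
      exact linearMap_eq_sum_pair hγ l z
    rw [this]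
    exact Subalgebra.sum_mem _ fun j _ => Subalgebra.smul_mem _ (pair_mem_monoMultiplier hX _) _
  · refine inv_mem_monoMultiplier hX le_rfl ⟨i, rfl⟩

end PartialFractions

/-! ### Laplace transforms of powers -/

section Laplace

open MeasureTheory Set

theorem integrableOn_pow_mul_cexp {c : ℂ} (hc : 0 < c.re) (n : ℕ) :
    IntegrableOn (fun t : ℝ => (t : ℂ) ^ n * Complex.exp (-(c * t))) (Ioi 0) := by
  have h := integrableOn_rpow_mul_exp_neg_mul_rpow (p := 1) (s := n) (b := c.re)
    (by have : (0 : ℝ) ≤ n := n.cast_nonneg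
        linarith) one_pos hc
  refine Integrable.mono h (by fun_prop) ?_
  refine (ae_restrict_iff' measurableSet_Ioi).2 (Filter.Eventually.of_forall fun t ht => ?_)
  simp only [norm_mul, norm_pow, Complex.norm_real, Complex.norm_exp, Complex.neg_re,
    Complex.re_mul_ofReal, Real.norm_eq_abs, Real.abs_exp, Real.rpow_natCast, Real.rpow_one,
    neg_mul, le_refl]

/-- The Gamma integral for complex `c`, by integrating the derivative of t^(n+1) e^(-ct) over the
half-line. -/
theorem integral_pow_mul_cexp {c : ℂ} (hc : 0 < c.re) (n : ℕ) :
    ∫ t in Ioi (0 : ℝ), (t : ℂ) ^ n * Complex.exp (-(c * t)) = n.factorial / c ^ (n + 1) := by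
  have hc0 : c ≠ 0 := by
    rintro rfl
    simp at hc
  have hder : ∀ (n : ℕ) (t : ℝ), HasDerivAt (fun t : ℝ => (t : ℂ) ^ (n + 1) * Complex.exp (-(c * t)))
      ((n + 1) * ((t : ℂ) ^ n * Complex.exp (-(c * t))) -
        c * ((t : ℂ) ^ (n + 1) * Complex.exp (-(c * t)))) t := by
    intro n t
    have h1 : HasDerivAt (fun z : ℂ => z ^ (n + 1) * Complex.exp (-(c * z)))
        (((n + 1 : ℕ) * (t : ℂ) ^ n) * Complex.exp (-(c * t)) +
          (t : ℂ) ^ (n + 1) * (Complex.exp (-(c * t)) * -(c * 1))) t :=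
      (show HasDerivAt (fun z : ℂ => z ^ (n + 1)) ((n + 1 : ℕ) * (t : ℂ) ^ n) t by
        simpa using hasDerivAt_pow (n + 1) (t : ℂ)).mul (((hasDerivAt_id (t : ℂ)).const_mul c).neg.cexp)
    convert h1.comp_ofReal using 1
    push_cast
    ring
  have hlim : ∀ n : ℕ, Filter.Tendsto (fun t : ℝ => (t : ℂ) ^ n * Complex.exp (-(c * t)))
      Filter.atTop (𝓝 0) := by
    intro n
    rw [tendsto_zero_iff_norm_tendsto_zero]
    have h := tendsto_rpow_mul_exp_neg_mul_atTop_nhds_zero (n : ℝ) c.re hc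
    refine h.congr' ?_
    filter_upwards [Filter.eventually_ge_atTop 0] with t ht
    simp [Complex.norm_exp, abs_of_nonneg ht]
  induction n with
  | zero =>
    have h0 : ∀ t : ℝ, HasDerivAt (fun t : ℝ => (-c⁻¹) * Complex.exp (-(c * t)))
        (Complex.exp (-(c * t))) t := by
      intro t
      have h1 : HasDerivAt (fun z : ℂ => (-c⁻¹) * Complex.exp (-(c * z)))
          ((-c⁻¹) * (Complex.exp (-(c * t)) * -(c * 1))) t :=
        (((hasDerivAt_id (t : ℂ)).const_mul c).neg.cexp).const_mul _
      convert h1.comp_ofReal using 1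
      field_simp
    have h1 := integral_Ioi_of_hasDerivAt_of_tendsto' (a := (0 : ℝ)) (fun t _ => h0 t)
      (by simpa using integrableOn_pow_mul_cexp hc 0)
      (by simpa using (hlim 0).const_mul (-c⁻¹))
    simpa using h1
  | succ n ih =>
    have hi0 := integrableOn_pow_mul_cexp hc n
    have hi1 := integrableOn_pow_mul_cexp hc (n + 1)
    have h1 := integral_Ioi_of_hasDerivAt_of_tendsto' (a := (0 : ℝ)) (fun t _ => hder n t)
      ((hi0.const_mul _).sub (hi1.const_mul _)) (hlim (n + 1))
    rw [integral_sub (hi0.const_mul _) (hi1.const_mul _), integral_const_mul,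
      integral_const_mul, ih] at h1
    have h2 : c * ∫ t in Ioi (0 : ℝ), (t : ℂ) ^ (n + 1) * Complex.exp (-(c * t)) =
        (n + 1) * (n.factorial / c ^ (n + 1)) := by
      simp at h1
      linear_combination -h1
    rw [Nat.factorial_succ, eq_div_iff (pow_ne_zero _ hc0), pow_succ c (n + 1)]
    push_cast
    have h3 : c ^ (n + 1) ≠ 0 := pow_ne_zero _ hc0
    calc _ = c ^ (n + 1) * (c * ∫ t in Ioi (0 : ℝ), (t : ℂ) ^ (n + 1) * Complex.exp (-(c * t))) := by
          ring
      _ = _ := by rw [h2]; field_simp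

/-- The function `x ^ (r - 1) / (r - 1)!` on the positive half-line, whose Laplace transform
is `c ^ (-r)`. -/
def halfPow (r : ℕ) (x : ℝ) : ℂ :=
  (Ioi 0).indicator (fun t : ℝ => (t : ℂ) ^ (r - 1) / (r - 1).factorial) x

theorem integrable_halfPow {c : ℂ} (hc : 0 < c.re) (r : ℕ) :
    Integrable (fun x : ℝ => halfPow r x * Complex.exp (-(c * x))) := by
  have : (fun x : ℝ => halfPow r x * Complex.exp (-(c * x))) = (Ioi 0).indicator
      (fun t : ℝ => ((r - 1).factorial : ℂ)⁻¹ * ((t : ℂ) ^ (r - 1) * Complex.exp (-(c * t)))) := by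
    ext x
    unfold halfPow
    by_cases hx : x ∈ Ioi (0 : ℝ)
    · simp only [indicator_of_mem hx]; ring
    · simp only [indicator_of_notMem hx]; ring
  rw [this, integrable_indicator_iff measurableSet_Ioi]
  exact (integrableOn_pow_mul_cexp hc _).const_mul _

theorem integral_halfPow {c : ℂ} (hc : 0 < c.re) {r : ℕ} (hr : r ≠ 0) :
    ∫ x : ℝ, halfPow r x * Complex.exp (-(c * x)) = (c ^ r)⁻¹ := by
  have : (fun x : ℝ => halfPow r x * Complex.exp (-(c * x))) = (Ioi 0).indicator
      (fun t : ℝ => ((r - 1).factorial : ℂ)⁻¹ * ((t : ℂ) ^ (r - 1) * Complex.exp (-(c * t)))) := by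
    ext x
    unfold halfPow
    by_cases hx : x ∈ Ioi (0 : ℝ)
    · simp only [indicator_of_mem hx]; ring
    · simp only [indicator_of_notMem hx]; ring
  rw [this, integral_indicator measurableSet_Ioi, integral_const_mul, integral_pow_mul_cexp hc,
    Nat.sub_add_cancel (Nat.one_le_iff_ne_zero.2 hr)]
  have : ((r - 1).factorial : ℂ) ≠ 0 := by exact_mod_cast Nat.factorial_ne_zero _
  field_simp

/-- For `r = 1` there is a jump at 0; this is why the base point is required to have nonzero
coordinates in every tuple. -/
theorem continuousAt_halfPow (r : ℕ) {x : ℝ} (hx : x ≠ 0) : ContinuousAt (halfPow r) x := by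
  rcases lt_or_gt_of_ne hx with h | h
  · refine (continuousAt_const (y := (0 : ℂ))).congr ?_
    filter_upwards [eventually_lt_nhds h] with y hy
    rw [halfPow, indicator_of_notMem (show y ∉ Ioi (0 : ℝ) from not_lt.2 hy.le)]
  · have hc : ContinuousAt (fun t : ℝ => (t : ℂ) ^ (r - 1) / ((r - 1).factorial : ℂ)) x := by
      fun_prop
    refine hc.congr ?_
    filter_upwards [eventually_gt_nhds h] with y hy
    rw [halfPow, indicator_of_mem (show y ∈ Ioi (0 : ℝ) from hy)]

end Laplace

/-! ### The tube domain and the forms positive on it -/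

section Tube

variable {V : Type*} [NormedAddCommGroup V] [NormedSpace ℝ V] {N : ℕ}

/-- The tube of the points of `V_ℂ` on which the forms of the system have positive real part. -/
def tube (β : Fin N → StrongDual ℝ V) : Set (VC V) :=
  {z | ∀ i, 0 < (pair (β i) z).re}

/-- The forms with positive real part on the tube. -/
def PosForm (β : Fin N → StrongDual ℝ V) (γ : StrongDual ℝ V) : Prop :=
  ∀ z ∈ tube β, 0 < (pair γ z).re

theorem posForm_apply (β : Fin N → StrongDual ℝ V) (i : Fin N) : PosForm β (β i) :=
  fun _ hz => hz i

theorem PosForm.add {β : Fin N → StrongDual ℝ V} {γ δ : StrongDual ℝ V} (hγ : PosForm β γ)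
    (hδ : PosForm β δ) : PosForm β (γ + δ) := fun z hz => by
  rw [pair_add, Complex.add_re]
  exact add_pos (hγ z hz) (hδ z hz)

theorem PosForm.nsmul {β : Fin N → StrongDual ℝ V} {γ : StrongDual ℝ V} (hγ : PosForm β γ)
    {m : ℕ} (hm : m ≠ 0) : PosForm β (m • γ) := fun z hz => by
  rw [pair_nsmul, ← Complex.ofReal_natCast, Complex.re_ofReal_mul]
  exact mul_pos (by exact_mod_cast Nat.pos_of_ne_zero hm) (hγ z hz)

theorem PosForm.pair_ne_zero {β : Fin N → StrongDual ℝ V} {γ : StrongDual ℝ V} (hγ : PosForm β γ)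
    {z : VC V} (hz : z ∈ tube β) : pair γ z ≠ 0 := fun h => by
  have := hγ z hz
  simp [h] at this

theorem one_tmul_mem_tube {β : Fin N → StrongDual ℝ V} {v : V} (hv : ∀ i, 0 < β i v) :
    (1 : ℂ) ⊗ₜ[ℝ] v ∈ tube β := fun i => by
  rw [pair_tmul]
  simpa using hv i

theorem PosForm.apply_pos {β : Fin N → StrongDual ℝ V} {γ : StrongDual ℝ V} (hγ : PosForm β γ)
    {v : V} (hv : ∀ i, 0 < β i v) : 0 < γ v := by
  have := hγ _ (one_tmul_mem_tube hv)
  rw [pair_tmul] at this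
  simpa using this

theorem tube_subset_complement (β : Fin N → StrongDual ℝ V) : tube β ⊆ complement β :=
  fun _ hz i => (posForm_apply β i).pair_ne_zero hz

/-- The filter of the points at which all forms of the system have large real part. -/
def tubeAtTop (β : Fin N → StrongDual ℝ V) : Filter (VC V) :=
  Filter.comap (fun z i => (pair (β i) z).re) Filter.atTop

theorem eventually_tubeAtTop {β : Fin N → StrongDual ℝ V} {p : VC V → Prop} :
    (∀ᶠ z in tubeAtTop β, p z) ↔ ∃ R : ℝ, ∀ z, (∀ i, R ≤ (pair (β i) z).re) → p z := by
  rw [tubeAtTop, Filter.eventually_comap, Filter.eventually_atTop]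
  constructor
  · rintro ⟨r, hr⟩
    refine ⟨∑ i, |r i|, fun z hz => hr _ (fun i => ?_) z rfl⟩
    exact (le_abs_self _).trans ((Finset.single_le_sum (fun i _ => abs_nonneg (r i))
      (Finset.mem_univ i)).trans (hz i))
  · rintro ⟨R, hR⟩
    refine ⟨fun _ => R, fun b hb z hz => hR z fun i => ?_⟩
    have := hb i
    rwa [← hz] at this

theorem eventually_mem_tube (β : Fin N → StrongDual ℝ V) : ∀ᶠ z in tubeAtTop β, z ∈ tube β :=
  eventually_tubeAtTop.2 ⟨1, fun _ hz i => one_pos.trans_le (hz i)⟩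

/-- Finite differences compare a function at `z` and `z + w`, so they act on germs far out in the
tube. -/
theorem tendsto_add_tubeAtTop (β : Fin N → StrongDual ℝ V) (w : VC V) :
    Filter.Tendsto (fun z => z + w) (tubeAtTop β) (tubeAtTop β) := by
  refine Filter.tendsto_comap_iff.2 ?_
  have : ((fun (z : VC V) i => (pair (β i) z).re) ∘ fun z => z + w) =
      fun z => (fun x => x + fun i => (pair (β i) w).re) (fun i => (pair (β i) z).re) := by
    ext z i
    simp
  rw [this]
  exact (Filter.tendsto_atTop_add_const_right _ _ Filter.tendsto_id).comp Filter.tendsto_comap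

end Tube

/-! ### Laplace transforms on the tube and their injectivity at continuity points -/

section LaplaceTransform

open MeasureTheory Set Filter

variable {V : Type*} [NormedAddCommGroup V] [NormedSpace ℝ V] {N : ℕ}
  {κ : Type*} [Fintype κ]

/-- The function `g` is, far away in the tube, the Laplace transform of `H`, where the dual space is
identified with `ℝ ^ κ` by the basis `e`. -/
def IsLaplace (β : Fin N → StrongDual ℝ V) (e : Module.Basis κ ℝ (StrongDual ℝ V))
    (g : VC V → ℂ) (H : (κ → ℝ) → ℂ) : Prop :=
  ∀ᶠ z in tubeAtTop β,
    Integrable (fun b => H b * Complex.exp (-pair (e.equivFun.symm b) z)) ∧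
    g z = ∫ b, H b * Complex.exp (-pair (e.equivFun.symm b) z)

variable {β : Fin N → StrongDual ℝ V} {e : Module.Basis κ ℝ (StrongDual ℝ V)}

theorem IsLaplace.add {g₁ g₂ : VC V → ℂ} {H₁ H₂ : (κ → ℝ) → ℂ} (h₁ : IsLaplace β e g₁ H₁)
    (h₂ : IsLaplace β e g₂ H₂) : IsLaplace β e (g₁ + g₂) (H₁ + H₂) := by
  filter_upwards [h₁, h₂] with z hz₁ hz₂
  have h : (fun b => (H₁ + H₂) b * Complex.exp (-pair (e.equivFun.symm b) z)) =
      (fun b => H₁ b * Complex.exp (-pair (e.equivFun.symm b) z)) +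
        fun b => H₂ b * Complex.exp (-pair (e.equivFun.symm b) z) := by
    ext b; simp [add_mul]
  rw [h]
  refine ⟨hz₁.1.add hz₂.1, ?_⟩
  rw [integral_add' hz₁.1 hz₂.1, Pi.add_apply, hz₁.2, hz₂.2]

theorem IsLaplace.const_smul {g : VC V → ℂ} {H : (κ → ℝ) → ℂ} (h : IsLaplace β e g H) (c : ℂ) :
    IsLaplace β e (c • g) (c • H) := by
  filter_upwards [h] with z hz
  have h : (fun b => (c • H) b * Complex.exp (-pair (e.equivFun.symm b) z)) =
      fun b => c • (H b * Complex.exp (-pair (e.equivFun.symm b) z)) := by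
    ext b; simp [mul_assoc]
  rw [h]
  refine ⟨hz.1.smul c, ?_⟩
  rw [integral_smul, Pi.smul_apply, hz.2]

theorem IsLaplace.zero : IsLaplace β e 0 0 := by
  refine Eventually.of_forall fun z => ?_
  simp

theorem IsLaplace.sum {ι : Type*} (s : Finset ι) {g : ι → VC V → ℂ} {H : ι → (κ → ℝ) → ℂ}
    (h : ∀ i ∈ s, IsLaplace β e (g i) (H i)) : IsLaplace β e (∑ i ∈ s, g i) (∑ i ∈ s, H i) := by
  classical
  induction s using Finset.induction_on with
  | empty => simpa using IsLaplace.zero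
  | insert i s hi ih =>
    rw [Finset.sum_insert hi, Finset.sum_insert hi]
    exact (h i (Finset.mem_insert_self _ _)).add
      (ih fun j hj => h j (Finset.mem_insert_of_mem hj))

/-- Translating `z` by `w` multiplies the density by the exponential e^(-⟨b, w⟩). -/
theorem IsLaplace.fwdDiff {g : VC V → ℂ} {H : (κ → ℝ) → ℂ} (h : IsLaplace β e g H) (w : VC V) :
    IsLaplace β e (fwdDiff w g)
      (fun b => H b * (Complex.exp (-pair (e.equivFun.symm b) w) - 1)) := by
  filter_upwards [h, (tendsto_add_tubeAtTop β w).eventually h] with z hz hzw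
  have h : (fun b => H b * (Complex.exp (-pair (e.equivFun.symm b) w) - 1) *
      Complex.exp (-pair (e.equivFun.symm b) z)) =
      (fun b => H b * Complex.exp (-pair (e.equivFun.symm b) (z + w))) -
        fun b => H b * Complex.exp (-pair (e.equivFun.symm b) z) := by
    ext b
    simp only [map_add, neg_add, Complex.exp_add, Pi.sub_apply]
    ring
  rw [h]
  refine ⟨hzw.1.sub hz.1, ?_⟩
  rw [integral_sub' hzw.1 hz.1, ← hz.2, ← hzw.2]
  rfl

theorem IsLaplace.fwdDiff_iter {g : VC V → ℂ} {H : (κ → ℝ) → ℂ} (h : IsLaplace β e g H)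
    (w : VC V) (M : ℕ) : IsLaplace β e ((_root_.fwdDiff w)^[M] g)
      (fun b => H b * (Complex.exp (-pair (e.equivFun.symm b) w) - 1) ^ M) := by
  induction M with
  | zero => simpa using h
  | succ M ih =>
    rw [Function.iterate_succ_apply']
    convert ih.fwdDiff w using 2
    ring

theorem continuous_pair_equivFun_symm (e : Module.Basis κ ℝ (StrongDual ℝ V)) (w : VC V) :
    Continuous fun b : κ → ℝ => pair (e.equivFun.symm b) w := by
  have : (fun b : κ → ℝ => pair (e.equivFun.symm b) w) =
      fun b : κ → ℝ => ∑ j, (b j : ℂ) * pair (e j) w := by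
    ext b
    simp only [Module.Basis.equivFun_symm_apply, pair_sum, pair_smul]
  rw [this]
  exact continuous_finsetSum _ fun j _ => by fun_prop

variable [DecidableEq κ]

/-- On the imaginary directions above a real point deep in the tube, the Laplace transform of `H` is
the Fourier transform of `H` times a real exponential. It vanishes there, so Fourier inversion at a
continuity point gives the value 0. -/
theorem IsLaplace.eq_zero {g : VC V → ℂ} {H : (κ → ℝ) → ℂ} (h : IsLaplace β e g H)
    {γ : Module.Basis κ ℝ V} (hγ : ∀ i j, e i (γ j) = if i = j then 1 else 0)
    (hpos : ∃ v : V, ∀ i, 0 < β i v)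
    (hg : ∀ᶠ z in tubeAtTop β, g z = 0) {b₀ : κ → ℝ} (hc : ContinuousAt H b₀) : H b₀ = 0 := by
  obtain ⟨v, hv⟩ := hpos
  obtain ⟨R, hR⟩ := eventually_tubeAtTop.1 (h.and hg)
  obtain ⟨s, hs⟩ : ∃ s : ℝ, ∀ i, R ≤ s * β i v := by
    have : ∀ i, ∀ᶠ s : ℝ in atTop, R ≤ s * β i v := fun i =>
      (tendsto_id.atTop_mul_const (hv i)).eventually_ge_atTop R
    exact (eventually_all.2 this).exists
  let F : EuclideanSpace ℝ κ → ℂ := fun b => H b * Complex.exp (-pair (e.equivFun.symm b) (1 ⊗ₜ (s • v)))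
  -- The factor `2πi` matches the normalisation of the Fourier transform.
  let z : EuclideanSpace ℝ κ → VC V := fun w =>
    1 ⊗ₜ (s • v) + ∑ j, (2 * Real.pi * Complex.I * w j : ℂ) ⊗ₜ γ j
  have hz : ∀ w i, R ≤ (pair (β i) (z w)).re := by
    intro w i
    have : (pair (β i) (z w)).re = s * β i v := by
      simp [z, pair_tmul]
    rw [this]
    exact hs i
  have hzF : ∀ (w b : EuclideanSpace ℝ κ), H b * Complex.exp (-pair (e.equivFun.symm b) (z w)) =
      Complex.exp (↑(-2 * Real.pi * inner ℝ b w) * Complex.I) • F b := by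
    intro w b
    have h1 : pair (e.equivFun.symm b) (z w) = pair (e.equivFun.symm b) (1 ⊗ₜ (s • v)) +
        2 * Real.pi * Complex.I * (inner ℝ b w : ℝ) := by
      simp only [z, map_add]
      congr 1
      rw [Module.Basis.equivFun_symm_apply, pair_sum]
      have : ∀ i, pair (b i • e i) (∑ j, (2 * Real.pi * Complex.I * w j : ℂ) ⊗ₜ[ℝ] γ j) =
          2 * Real.pi * Complex.I * (b i * w i : ℝ) := by
        intro i
        rw [pair_smul, pair_sum_tmul hγ]
        push_cast
        ring
      rw [Finset.sum_congr rfl fun i _ => this i, ← Finset.mul_sum, ← Complex.ofReal_sum]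
      congr 2
      simp [PiLp.inner_apply, mul_comm]
    simp only [F, smul_eq_mul, h1, neg_add, Complex.exp_add]
    push_cast
    ring_nf
  have hint : Integrable F := by
    have h1 := (hR (z 0) (hz 0)).1.1
    have h2 : (fun b : EuclideanSpace ℝ κ => H b * Complex.exp (-pair (e.equivFun.symm b) (z 0))) = F := by
      ext b
      rw [hzF]
      simp
    rw [← h2]
    exact (PiLp.volume_preserving_ofLp κ).integrable_comp_of_integrable h1
  have hft : FourierTransform.fourier F = 0 := by
    ext w
    rw [Real.fourier_eq']
    simp_rw [← hzF]
    have h1 := (hR (z w) (hz w)).1.2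
    rw [(hR (z w) (hz w)).2] at h1
    have h2 := (PiLp.volume_preserving_ofLp κ).integral_comp
      (MeasurableEquiv.toLp 2 (κ → ℝ)).symm.measurableEmbedding
      (fun b => H b * Complex.exp (-pair (e.equivFun.symm b) (z w)))
    rw [← h1] at h2
    exact h2
  have hcF : ContinuousAt F (WithLp.toLp 2 b₀) := by
    have h1 : ContinuousAt (fun b : EuclideanSpace ℝ κ => H b) (WithLp.toLp 2 b₀) := by
      refine ContinuousAt.comp (f := fun b : EuclideanSpace ℝ κ => (b : κ → ℝ)) (g := H) hc ?_
      fun_prop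
    refine h1.mul ?_
    exact (((continuous_pair_equivFun_symm e _).comp (PiLp.continuous_ofLp 2 _)).neg.cexp).continuousAt
  have hinv := hint.fourierInv_fourier_eq (by rw [hft]; exact integrable_zero _ _ _) hcF
  rw [hft] at hinv
  have h0 : F (WithLp.toLp 2 b₀) = 0 := by
    rw [← hinv, Real.fourierInv_eq']
    simp
  simpa [F] using h0

/-- The finite differences in a direction kill a function up to order `M`. -/
theorem IsLaplace.eq_zero_of_kill {γ : Module.Basis κ ℝ V}
    (hγ : ∀ i j, e i (γ j) = if i = j then 1 else 0) (hpos : ∃ v : V, ∀ i, 0 < β i v)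
    {b₀ : κ → ℝ} {ι : Type*} (s : Finset ι) (w : ι → VC V) (M : ι → ℕ)
    (hw : ∀ i ∈ s, Complex.exp (-pair (e.equivFun.symm b₀) (w i)) ≠ 1) :
    ∀ (g : VC V → ℂ) (H : (κ → ℝ) → ℂ) (p : ι → VC V → ℂ), IsLaplace β e g H →
      (∀ i ∈ s, ∀ᶠ z in tubeAtTop β, (_root_.fwdDiff (w i))^[M i] (p i) z = 0) →
      (∀ᶠ z in tubeAtTop β, g z = ∑ i ∈ s, p i z) → ContinuousAt H b₀ → H b₀ = 0 := by
  classical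
  have hcomm : ∀ (a b : VC V) (m k : ℕ) (f : VC V → ℂ),
      (_root_.fwdDiff a)^[m] ((_root_.fwdDiff b)^[k] f) =
        (_root_.fwdDiff b)^[k] ((_root_.fwdDiff a)^[m] f) := by
    intro a b m k f
    refine Function.Commute.iterate_iterate (fun f => ?_) m k f
    ext z
    simp only [_root_.fwdDiff, add_right_comm z a b]
    ring
  have hshift : ∀ (a : VC V) (m : ℕ) (f g : VC V → ℂ), (∀ᶠ z in tubeAtTop β, f z = g z) →
      ∀ᶠ z in tubeAtTop β, (_root_.fwdDiff a)^[m] f z = (_root_.fwdDiff a)^[m] g z := by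
    intro a m
    induction m with
    | zero => intro f g h; simpa using h
    | succ m ih =>
      intro f g h
      rw [Function.iterate_succ, Function.comp_apply, Function.comp_apply]
      refine ih _ _ ?_
      filter_upwards [h, (tendsto_add_tubeAtTop β a).eventually h] with z h1 h2
      simp only [_root_.fwdDiff, h1, h2]
  -- Applying the difference operator of one index removes its term from `g`, leaves the other terms
  -- killed since differences commute, and multiplies the density at `b₀` by a nonzero number.
  induction s using Finset.induction_on with
  | empty =>
    intro g H p hL _ hg hc
    exact hL.eq_zero hγ hpos (by simpa using hg) hc
  | insert i s hi ih =>
    intro g H p hL hp hg hc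
    have hL' := hL.fwdDiff_iter (w i) (M i)
    have hc' : ContinuousAt (fun b => H b * (Complex.exp (-pair (e.equivFun.symm b) (w i)) - 1) ^ M i)
        b₀ := by
      refine hc.mul ?_
      exact (((continuous_pair_equivFun_symm e _).neg.cexp.sub continuous_const).pow _).continuousAt
    have := ih (fun j hj => hw j (Finset.mem_insert_of_mem hj)) _ _
      (fun j => (_root_.fwdDiff (w i))^[M i] (p j)) hL' ?_ ?_ hc'
    · rcases mul_eq_zero.1 this with h | h
      · exact h
      · exact absurd (sub_eq_zero.1 (eq_zero_of_pow_eq_zero h)) (hw i (Finset.mem_insert_self _ _))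
    · intro j hj
      rw [hcomm]
      have h1 := hshift (w i) (M i) _ 0 (by simpa using hp j (Finset.mem_insert_of_mem hj))
      filter_upwards [h1] with z hz
      rw [hz]
      have : (_root_.fwdDiff (w i))^[M i] (0 : VC V → ℂ) = 0 := by
        simpa using fwdDiff_iter_const_smul (w i) (0 : ℂ) (0 : VC V → ℂ) (M i)
      rw [this]
      rfl
    · have h1 := hshift (w i) (M i) g (∑ j ∈ insert i s, p j) (by simpa using hg)
      filter_upwards [h1, hp i (Finset.mem_insert_self _ _)] with z hz hz0
      rw [hz, fwdDiff_iter_finsetSum, Finset.sum_insert hi, Pi.add_apply, hz0, zero_add,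
        Finset.sum_apply]

end LaplaceTransform

/-! ### The residue functional on Laurent monomials -/

section ResidueFunctional

open MeasureTheory Set Filter

variable {V : Type*} [NormedAddCommGroup V] [NormedSpace ℝ V] [FiniteDimensional ℝ V] {N : ℕ}
  {β : Fin N → StrongDual ℝ V}

local notation "κ" => Fin (Module.finrank ℝ V)

/-- The coordinates with respect to a tuple, as a linear automorphism of `ℝ ^ n`. -/
def coordChange (e : Module.Basis κ ℝ (StrongDual ℝ V)) {σ : κ → StrongDual ℝ V}
    (hσ : LinearIndependent ℝ σ) : (κ → ℝ) ≃ₗ[ℝ] (κ → ℝ) :=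
  e.equivFun.symm.trans (tupleBasis σ hσ).equivFun

theorem det_coordChange (e : Module.Basis κ ℝ (StrongDual ℝ V)) {σ : κ → StrongDual ℝ V}
    (hσ : LinearIndependent ℝ σ) :
    LinearMap.det (coordChange e hσ : (κ → ℝ) →ₗ[ℝ] (κ → ℝ)) * e.det σ = 1 := by
  have h1 : LinearMap.toMatrix' (coordChange e hσ : (κ → ℝ) →ₗ[ℝ] (κ → ℝ)) =
      (tupleBasis σ hσ).toMatrix e := by
    ext i j
    simp [coordChange, LinearMap.toMatrix'_apply, Module.Basis.toMatrix_apply,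
      Module.Basis.equivFun_symm_apply, Pi.single_apply]
  have h2 := Module.Basis.toMatrix_mul_toMatrix_flip (tupleBasis σ hσ) e
  rw [coe_tupleBasis] at h2
  rw [← LinearMap.det_toMatrix', h1, Module.Basis.det_apply, ← Matrix.det_mul, h2, Matrix.det_one]

/-- In the coordinates of `σ` the integral is a product of one-dimensional Laplace transforms; the
constant 1/|det| is the Jacobian. -/
theorem isLaplace_laurentMono (e : Module.Basis κ ℝ (StrongDual ℝ V)) {σ : κ → StrongDual ℝ V}
    (hσ : LinearIndependent ℝ σ) (hpos : ∀ k, PosForm β (σ k)) {m : κ → ℤ} (hm : ∀ k, m k < 0) :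
    IsLaplace β e (laurentMono σ m) (fun b => ((|e.det σ|⁻¹ : ℝ) : ℂ) *
      ∏ k, halfPow (-m k).toNat ((tupleBasis σ hσ).repr (e.equivFun.symm b) k)) := by
  filter_upwards [eventually_mem_tube β] with z hz
  let A := coordChange e hσ
  let G : (κ → ℝ) → ℂ := fun x =>
    ∏ k, (halfPow (-m k).toNat (x k) * Complex.exp (-(pair (σ k) z * (x k : ℂ))))
  have hdet := det_coordChange e hσ
  have hdet0 : LinearMap.det (A : (κ → ℝ) →ₗ[ℝ] (κ → ℝ)) ≠ 0 := left_ne_zero_of_mul_eq_one hdet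
  have hGint : Integrable G := Integrable.fintype_prod
    (f := fun k (x : ℝ) => halfPow (-m k).toNat x * Complex.exp (-(pair (σ k) z * (x : ℂ))))
    fun k => integrable_halfPow (hpos k z hz) _
  have hGval : ∫ x, G x = laurentMono σ m z := by
    rw [integral_fintype_prod_volume_eq_prod
      (f := fun k (x : ℝ) => halfPow (-m k).toNat x * Complex.exp (-(pair (σ k) z * (x : ℂ))))]
    refine Finset.prod_congr rfl fun k _ => ?_
    rw [integral_halfPow (hpos k z hz) (by have := hm k; omega), ← zpow_natCast, ← zpow_neg,
      Int.toNat_of_nonneg (by have := hm k; omega), neg_neg]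
  have hfun : (fun b => ((|e.det σ|⁻¹ : ℝ) : ℂ) *
      (∏ k, halfPow (-m k).toNat ((tupleBasis σ hσ).repr (e.equivFun.symm b) k)) *
      Complex.exp (-pair (e.equivFun.symm b) z)) =
      fun b => ((|e.det σ|⁻¹ : ℝ) : ℂ) * G (A b) := by
    ext b
    have h1 : e.equivFun.symm b = ∑ k, A b k • σ k := by
      have := (tupleBasis σ hσ).sum_equivFun (e.equivFun.symm b)
      rw [coe_tupleBasis] at this
      exact this.symm
    have h2 : Complex.exp (-pair (e.equivFun.symm b) z) =
        ∏ k, Complex.exp (-(pair (σ k) z * (A b k : ℂ))) := by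
      rw [← Complex.exp_sum, h1, pair_sum, Finset.sum_neg_distrib]
      congr 2
      refine Finset.sum_congr rfl fun k _ => ?_
      rw [pair_smul, mul_comm]
    rw [h2, mul_assoc, ← Finset.prod_mul_distrib]
    rfl
  have hemb : MeasurableEmbedding A :=
    A.toContinuousLinearEquiv.toHomeomorph.measurableEmbedding
  have hmap : Measure.map A volume =
      ENNReal.ofReal |(LinearMap.det (A : (κ → ℝ) →ₗ[ℝ] (κ → ℝ)))⁻¹| • volume :=
    Real.map_linearMap_volume_pi_eq_smul_volume_pi hdet0
  have hcomp : Integrable (fun b => G (A b)) := by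
    have := MeasurableEmbedding.integrable_map_iff hemb (μ := volume) (g := G)
    rw [hmap] at this
    exact this.1 (hGint.smul_measure (by simp))
  simp only [hfun]
  refine ⟨hcomp.const_mul _, ?_⟩
  rw [integral_const_mul, ← hemb.integral_map (μ := volume) G, hmap, integral_smul_measure, hGval,
    ENNReal.toReal_ofReal (abs_nonneg _)]
  have h3 : (LinearMap.det (A : (κ → ℝ) →ₗ[ℝ] (κ → ℝ)))⁻¹ = e.det σ :=
    inv_eq_of_mul_eq_one_right hdet
  rw [h3, Complex.real_smul, ← mul_assoc, ← Complex.ofReal_mul, inv_mul_cancel₀, Complex.ofReal_one,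
    one_mul]
  rw [abs_ne_zero]
  exact right_ne_zero_of_mul_eq_one hdet

/-- Along the vector dual to `σ k` the monomial is a polynomial of degree `m k`, so one more
difference than the degree annihilates it. -/
theorem fwdDiff_iter_laurentMono {σ : κ → StrongDual ℝ V} {m : κ → ℤ} {k : κ} (hk : 0 ≤ m k)
    {u : V} (hu : ∀ i, σ i u = if i = k then 1 else 0) (z : VC V) :
    (fwdDiff ((1 : ℂ) ⊗ₜ[ℝ] u))^[(m k).toNat + 1] (laurentMono σ m) z = 0 := by
  rw [fwdDiff_iter_eq_sum_shift]
  have h1 : ∀ j : ℕ, laurentMono σ m (z + j • ((1 : ℂ) ⊗ₜ[ℝ] u)) =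
      (pair (σ k) z + j • (1 : ℂ)) ^ (m k).toNat * ∏ i ∈ Finset.univ.erase k, pair (σ i) z ^ m i := by
    intro j
    unfold laurentMono
    rw [← Finset.mul_prod_erase _ _ (Finset.mem_univ k)]
    congr 1
    · rw [map_add, map_nsmul, pair_tmul, hu]
      conv_lhs => rw [← Int.toNat_of_nonneg hk, zpow_natCast]
      simp
    · refine Finset.prod_congr rfl fun i hi => ?_
      rw [map_add, map_nsmul, pair_tmul, hu, if_neg (Finset.ne_of_mem_erase hi)]
      simp
  simp only [h1]
  simp only [← smul_mul_assoc]
  rw [← Finset.sum_mul, ← fwdDiff_iter_eq_sum_shift (1 : ℂ) (fun r : ℂ => r ^ (m k).toNat),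
    fwdDiff_iter_pow_eq_zero_of_lt (Nat.lt_succ_self _)]
  simp

/-- Prescribed values on a family extend to a functional once they satisfy all its relations: the
values factor through the range, and a functional on a subspace extends. -/
theorem exists_linearMap_apply_eq {ι W : Type*} [AddCommGroup W] [Module ℂ W] (E : ι → W) (j : ι → ℂ)
    (h : ∀ c : ι →₀ ℂ, Finsupp.linearCombination ℂ E c = 0 → Finsupp.linearCombination ℂ j c = 0) :
    ∃ J : W →ₗ[ℂ] ℂ, ∀ i, J (E i) = j i := by
  have hker : LinearMap.ker (Finsupp.linearCombination ℂ E) ≤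
      LinearMap.ker (Finsupp.linearCombination ℂ j) := fun c hc => h c hc
  let q := (LinearMap.ker (Finsupp.linearCombination ℂ E)).liftQ (Finsupp.linearCombination ℂ j) hker
  let J₀ : LinearMap.range (Finsupp.linearCombination ℂ E) →ₗ[ℂ] ℂ :=
    q ∘ₗ ((Finsupp.linearCombination ℂ E).quotKerEquivRange.symm : _ →ₗ[ℂ] _)
  obtain ⟨J, hJ⟩ := J₀.exists_extend
  refine ⟨J, fun i => ?_⟩
  have h1 : E i = Finsupp.linearCombination ℂ E (Finsupp.single i 1) := by simp
  have h2 : J (E i) = J₀ ⟨E i, by rw [h1]; exact LinearMap.mem_range_self _ _⟩ := by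
    rw [← hJ]; rfl
  have h3 : (⟨E i, by rw [h1]; exact LinearMap.mem_range_self _ _⟩ :
      LinearMap.range (Finsupp.linearCombination ℂ E)) =
      (Finsupp.linearCombination ℂ E).quotKerEquivRange (Submodule.Quotient.mk (Finsupp.single i 1)) := by
    ext
    rw [LinearMap.quotKerEquivRange_apply_mk]
    exact h1
  rw [h2, h3]
  simp [J₀, q]

/-- A linearly independent tuple of forms which are positive on the tube, such that the vector `a`
has nonzero coordinates with respect to it. -/
structure GenTuple (β : Fin N → StrongDual ℝ V) (a : StrongDual ℝ V) where
  tuple : κ → StrongDual ℝ V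
  linInd : LinearIndependent ℝ tuple
  pos : ∀ k, PosForm β (tuple k)
  repr_ne : ∀ k, (tupleBasis tuple linInd).repr a k ≠ 0

theorem mem_coneOf_iff {σ : κ → StrongDual ℝ V} (hσ : LinearIndependent ℝ σ) (a : StrongDual ℝ V) :
    a ∈ coneOf σ ↔ ∀ k, 0 ≤ (tupleBasis σ hσ).repr a k := by
  constructor
  · rintro ⟨x, hx, rfl⟩ k
    have : ∑ k, x k • σ k = ∑ k, x k • tupleBasis σ hσ k := by rw [coe_tupleBasis]
    rw [this, Module.Basis.repr_sum_self]
    exact hx k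
  · intro h
    refine ⟨_, h, ?_⟩
    have := (tupleBasis σ hσ).sum_repr a
    rw [coe_tupleBasis] at this
    exact this.symm

open Classical in
/-- The values of the residue functional on Laurent monomials. -/
def jkValue (e : Module.Basis κ ℝ (StrongDual ℝ V)) (a : StrongDual ℝ V) (σ : κ → StrongDual ℝ V)
    (m : κ → ℤ) : ℂ :=
  if (∀ k, m k = -1) ∧ a ∈ coneOf σ then ((|e.det σ|⁻¹ : ℝ) : ℂ) else 0

/-- The density t^(r-1)/(r-1)! tends to 0 at the origin unless `r - 1 = 0`. Truncated subtraction
puts `r = 0` with `r = 1`; only `r ≥ 1` occurs for negative exponents. -/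
theorem tendsto_halfPow_mul (r : ℕ) (x : ℝ) :
    Tendsto (fun ε : ℝ => halfPow r (ε * x)) (𝓝[>] 0)
      (𝓝 (if r ≤ 1 ∧ 0 < x then 1 else 0)) := by
  rcases le_or_gt x 0 with hx | hx
  · rw [if_neg (fun h => absurd h.2 (not_lt.2 hx))]
    refine tendsto_const_nhds.congr' ?_
    filter_upwards [self_mem_nhdsWithin] with ε hε
    rw [halfPow, indicator_of_notMem]
    simp only [mem_Ioi, not_lt] at hε ⊢
    exact mul_nonpos_of_nonneg_of_nonpos hε.le hx
  · have h0 : Tendsto (fun ε : ℝ => ((ε * x : ℝ) : ℂ) ^ (r - 1) / (r - 1).factorial) (𝓝[>] 0)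
        (𝓝 (((0 * x : ℝ) : ℂ) ^ (r - 1) / (r - 1).factorial)) := by
      refine Tendsto.mono_left ?_ nhdsWithin_le_nhds
      exact Continuous.tendsto (by fun_prop) 0
    have h1 : ((0 * x : ℝ) : ℂ) ^ (r - 1) / ((r - 1).factorial : ℂ) = if r ≤ 1 ∧ 0 < x then 1 else 0 := by
      by_cases hr : r ≤ 1
      · rw [if_pos ⟨hr, hx⟩, Nat.sub_eq_zero_of_le hr]
        simp
      · rw [if_neg (fun h => hr h.1)]
        have : r - 1 ≠ 0 := by omega
        simp [this]
    rw [h1] at h0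
    refine h0.congr' ?_
    filter_upwards [self_mem_nhdsWithin] with ε hε
    rw [halfPow, indicator_of_mem (show ε * x ∈ Ioi (0 : ℝ) from mul_pos hε hx)]

/-- The Laurent monomials in different tuples are far from independent, so the point is that every
linear relation between them is respected by the values. It is tested on the density, along the ray
through `a`, near the apex of the cones. -/
theorem exists_residue_functional (e : Module.Basis κ ℝ (StrongDual ℝ V))
    (hpos : ∃ v : V, ∀ i, 0 < β i v) (a : StrongDual ℝ V) :
    ∃ J : (tube β → ℂ) →ₗ[ℂ] ℂ, ∀ (σ : GenTuple β a) (m : κ → ℤ),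
      J (fun z => laurentMono σ.tuple m z) = jkValue e a σ.tuple m := by
  classical
  suffices h : ∀ c : GenTuple β a × (κ → ℤ) →₀ ℂ, Finsupp.linearCombination ℂ
      (fun i : GenTuple β a × (κ → ℤ) => fun z : tube β => laurentMono i.1.tuple i.2 z) c = 0 →
      Finsupp.linearCombination ℂ (fun i : GenTuple β a × (κ → ℤ) => jkValue e a i.1.tuple i.2) c = 0 by
    obtain ⟨J, hJ⟩ := exists_linearMap_apply_eq _ _ h
    exact ⟨J, fun σ m => hJ (σ, m)⟩
  intro c hc
  obtain ⟨γ, hγ⟩ := exists_dual_basis e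
  rw [Finsupp.linearCombination_apply, Finsupp.sum] at hc ⊢
  set S := c.support
  set S1 := S.filter fun i => ∀ k, i.2 k < 0 with hS1
  set S2 := S.filter fun i => ¬ ∀ k, i.2 k < 0 with hS2
  -- For a monomial with `m k ≥ 0` the direction is the vector dual to `σ k`. The multiplier of the
  -- density at `ε a` involves e^(-ε a_k), which differs from 1 because the coordinate `a_k` is real
  -- and nonzero.
  have hex : ∀ i : GenTuple β a × (κ → ℤ), ∃ (w : VC V) (M : ℕ), (¬ ∀ k, i.2 k < 0) →
      (∀ z, (fwdDiff w)^[M] (laurentMono i.1.tuple i.2) z = 0) ∧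
      ∀ ε : ℝ, 0 < ε → Complex.exp (-pair (ε • a) w) ≠ 1 := by
    rintro ⟨σ, m⟩
    by_cases h : ∀ k, m k < 0
    · exact ⟨0, 0, fun h' => absurd h h'⟩
    push Not at h
    obtain ⟨k, hk⟩ := h
    obtain ⟨u, hu⟩ := exists_dual_basis (tupleBasis σ.tuple σ.linInd)
    refine ⟨1 ⊗ₜ u k, (m k).toNat + 1, fun _ => ⟨fwdDiff_iter_laurentMono hk fun i => ?_,
      fun ε hε => ?_⟩⟩
    · have := hu i k
      rwa [coe_tupleBasis] at this
    · rw [pair_tmul, smul_apply, ← repr_apply_eq hu a k]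
      have h1 : ε * (tupleBasis σ.tuple σ.linInd).repr a k ≠ 0 := mul_ne_zero hε.ne' (σ.repr_ne k)
      rw [one_mul, smul_eq_mul, ← Complex.ofReal_neg, ← Complex.ofReal_exp]
      norm_cast
      rw [Real.exp_eq_one_iff]
      simpa using h1
  choose w M hwM using hex
  let Hi : GenTuple β a × (κ → ℤ) → (κ → ℝ) → ℂ := fun i b => ((|e.det i.1.tuple|⁻¹ : ℝ) : ℂ) *
    ∏ k, halfPow (-i.2 k).toNat ((tupleBasis i.1.tuple i.1.linInd).repr (e.equivFun.symm b) k)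
  let H : (κ → ℝ) → ℂ := ∑ i ∈ S1, c i • Hi i
  have hL : IsLaplace β e (∑ i ∈ S1, c i • laurentMono i.1.tuple i.2) H := by
    refine IsLaplace.sum _ fun i hi => IsLaplace.const_smul ?_ _
    exact isLaplace_laurentMono e i.1.linInd i.1.pos (Finset.mem_filter.1 hi).2
  -- The relation expresses the Laplace transform of `H` as minus the combination of the monomials
  -- with some nonnegative exponent, all of them killed by differences.
  have hzero : ∀ ε : ℝ, 0 < ε → H (ε • e.equivFun a) = 0 := by
    intro ε hε
    have hb : e.equivFun.symm (ε • e.equivFun a) = ε • a := by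
      rw [map_smul, LinearEquiv.symm_apply_apply]
    refine IsLaplace.eq_zero_of_kill hγ hpos S2 w M (fun i hi => ?_) _ _
      (fun i => -c i • laurentMono i.1.tuple i.2) hL (fun i hi => ?_) ?_ ?_
    · rw [hb]
      exact (hwM i (Finset.mem_filter.1 hi).2).2 ε hε
    · refine Eventually.of_forall fun z => ?_
      rw [fwdDiff_iter_const_smul, Pi.smul_apply, (hwM i (Finset.mem_filter.1 hi).2).1, smul_zero]
    · filter_upwards [eventually_mem_tube β] with z hz
      have h1 := congr_fun hc ⟨z, hz⟩
      rw [← Finset.sum_filter_add_sum_filter_not S (fun i => ∀ k, i.2 k < 0)] at h1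
      simp only [Pi.add_apply, Finset.sum_apply, Pi.smul_apply, Pi.zero_apply] at h1 ⊢
      simp only [neg_smul, Finset.sum_neg_distrib]
      exact eq_neg_of_add_eq_zero_left h1
    · have h1 : ∀ i : GenTuple β a × (κ → ℤ), ContinuousAt (Hi i) (ε • e.equivFun a) := by
        intro i
        refine continuousAt_const.mul (tendsto_finsetProd _ fun k _ => ?_)
        have hne : (tupleBasis i.1.tuple i.1.linInd).repr (e.equivFun.symm (ε • e.equivFun a)) k ≠ 0 := by
          rw [hb, map_smul, Finsupp.smul_apply, smul_eq_mul]
          exact mul_ne_zero hε.ne' (i.1.repr_ne k)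
        have hlin : Continuous fun b : κ → ℝ =>
            (tupleBasis i.1.tuple i.1.linInd).repr (e.equivFun.symm b) k :=
          LinearMap.continuous_of_finiteDimensional
            ((tupleBasis i.1.tuple i.1.linInd).coord k ∘ₗ (e.equivFun.symm : (κ → ℝ) →ₗ[ℝ] _))
        exact ContinuousAt.comp (g := halfPow _) (continuousAt_halfPow _ hne) hlin.continuousAt
      have : H = fun b => ∑ i ∈ S1, c i • Hi i b := by
        ext b
        simp [H, Finset.sum_apply]
      rw [this]
      exact tendsto_finsetSum _ fun i _ => (h1 i).const_smul (c i)
  -- As `ε` tends to 0 the density of each monomial tends to its prescribed value.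
  have hlim : Tendsto (fun ε : ℝ => H (ε • e.equivFun a)) (𝓝[>] 0)
      (𝓝 (∑ i ∈ S1, c i • jkValue e a i.1.tuple i.2)) := by
    have : (fun ε : ℝ => H (ε • e.equivFun a)) =
        fun ε : ℝ => ∑ i ∈ S1, c i • Hi i (ε • e.equivFun a) := by
      ext b
      simp [H, Finset.sum_apply]
    rw [this]
    refine tendsto_finsetSum _ fun i hi => Tendsto.const_smul ?_ _
    have h1 : Tendsto (fun ε : ℝ => Hi i (ε • e.equivFun a)) (𝓝[>] 0) (𝓝 (((|e.det i.1.tuple|⁻¹ : ℝ) : ℂ) *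
        ∏ k, if (-i.2 k).toNat ≤ 1 ∧ 0 < (tupleBasis i.1.tuple i.1.linInd).repr a k then (1 : ℂ) else 0)) := by
      refine tendsto_const_nhds.mul (tendsto_finsetProd _ fun k _ => ?_)
      refine (tendsto_halfPow_mul _ _).congr fun ε => ?_
      rw [map_smul, LinearEquiv.symm_apply_apply, map_smul, Finsupp.smul_apply, smul_eq_mul]
    convert h1 using 2
    unfold jkValue
    rw [mem_coneOf_iff i.1.linInd]
    have hneg := (Finset.mem_filter.1 hi).2
    by_cases hc : (∀ k, i.2 k = -1) ∧ ∀ k, 0 ≤ (tupleBasis i.1.tuple i.1.linInd).repr a k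
    · rw [if_pos hc, Finset.prod_eq_one fun k _ => if_pos ⟨by simp [hc.1 k],
        lt_of_le_of_ne (hc.2 k) (i.1.repr_ne k).symm⟩, mul_one]
    · rw [if_neg hc]
      have : ∃ k, ¬ ((-i.2 k).toNat ≤ 1 ∧ 0 < (tupleBasis i.1.tuple i.1.linInd).repr a k) := by
        by_contra! hcon
        refine hc ⟨fun k => ?_, fun k => (hcon k).2.le⟩
        have h1 := hneg k
        have h2 := (hcon k).1
        omega
      obtain ⟨k, hk⟩ := this
      rw [Finset.prod_eq_zero (Finset.mem_univ k) (if_neg hk), mul_zero]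
  have hS1 : ∑ i ∈ S1, c i • jkValue e a i.1.tuple i.2 = 0 := by
    refine tendsto_nhds_unique hlim ?_
    refine tendsto_const_nhds.congr' ?_
    filter_upwards [self_mem_nhdsWithin] with ε hε
    exact (hzero ε hε).symm
  rw [← Finset.sum_filter_add_sum_filter_not S (fun i => ∀ k, i.2 k < 0), hS1, zero_add]
  refine Finset.sum_eq_zero fun i hi => ?_
  rw [jkValue, if_neg, smul_zero]
  exact fun h => (Finset.mem_filter.1 hi).2 fun k => by simp [h.1 k]

end ResidueFunctional

/-! ### Reduction of difference systems to independent weights -/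

section Reduction

variable {Λ W : Type*} [AddCommGroup Λ] [AddCommGroup W] [Module ℝ W]

/-- A weight together with a nonzero multiplier; sums multiply the multipliers. -/
abbrev Weight (Λ : Type*) := Λ × Additive ℂˣ

/-- The multiplier of a weight. -/
def mult (b : Weight Λ) : ℂ := ((Additive.toMul b.2 : ℂˣ) : ℂ)

theorem mult_add (b b' : Weight Λ) : mult (b + b') = mult b * mult b' := by simp [mult]

theorem mult_nsmul (k : ℕ) (b : Weight Λ) : mult (k • b) = mult b ^ k := by simp [mult]

theorem mult_ne_zero (b : Weight Λ) : mult b ≠ 0 := Units.ne_zero _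

/-- The zonotope of a system of weights. -/
def box (ρ : Λ →+ W) (Φ : Multiset (Weight Λ)) : Set W :=
  (Φ.map fun b => segment ℝ 0 (ρ b.1)).sum

theorem box_zero (ρ : Λ →+ W) : box ρ 0 = {0} := by
  simp [box, Set.singleton_zero]

theorem mem_box_cons {ρ : Λ →+ W} {Φ : Multiset (Weight Λ)} {b : Weight Λ} {d : W} :
    d ∈ box ρ (b ::ₘ Φ) ↔ ∃ t : ℝ, 0 ≤ t ∧ t ≤ 1 ∧ ∃ d' ∈ box ρ Φ, d = t • ρ b.1 + d' := by
  rw [box, Multiset.map_cons, Multiset.sum_cons, Set.mem_add, segment_eq_image]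
  constructor
  · rintro ⟨_, ⟨t, ht, rfl⟩, d', hd', rfl⟩
    exact ⟨t, ht.1, ht.2, d', hd', by simp⟩
  · rintro ⟨t, h0, h1, d', hd', rfl⟩
    exact ⟨_, ⟨t, ⟨h0, h1⟩, rfl⟩, d', hd', by simp⟩

/-- The compatibility of a family of functions, indexed by systems of weights, with the addition
of a weight to the system. -/
def IsDifferenceSystem (Pos : Λ → Prop) (X : Multiset (Weight Λ) → Λ → ℂ) : Prop :=
  ∀ (Φ : Multiset (Weight Λ)) (b : Weight Λ), Pos b.1 → (∀ b ∈ Φ, Pos b.1) →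
    ∀ l, X Φ l = X (b ::ₘ Φ) l - mult b * X (b ::ₘ Φ) (l - b.1)

/-- The function `X Φ` vanishes on `a - box Φ`. -/
def VanishesOn (ρ : Λ →+ W) (a : W) (X : Multiset (Weight Λ) → Λ → ℂ) (Φ : Multiset (Weight Λ)) :
    Prop := ∀ l, a - ρ l ∈ box ρ Φ → X Φ l = 0

variable {ρ : Λ →+ W} {a : W} {Pos : Λ → Prop} {X : Multiset (Weight Λ) → Λ → ℂ}
  {Φ Ψ : Multiset (Weight Λ)} {b b₁ b₂ : Weight Λ}

/-- With x, y the exponentials of `b₁`, `b₂`, this is 1/((1-x)(1-y)) = 1/((1-xy)(1-y)) +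
x/((1-xy)(1-x)). -/
theorem VanishesOn.of_add (hX : IsDifferenceSystem Pos X) (hadd : ∀ a b, Pos a → Pos b → Pos (a + b))
    (h1 : Pos b₁.1) (h2 : Pos b₂.1) (hΦ : ∀ b ∈ Φ, Pos b.1)
    (hg1 : VanishesOn ρ a X ((b₁ + b₂) ::ₘ b₁ ::ₘ Φ))
    (hg2 : VanishesOn ρ a X ((b₁ + b₂) ::ₘ b₂ ::ₘ Φ)) : VanishesOn ρ a X (b₁ ::ₘ b₂ ::ₘ Φ) := by
  have key : ∀ (b₁ b₂ : Weight Λ), Pos b₁.1 → Pos b₂.1 →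
      ∀ l, X (b₁ ::ₘ b₂ ::ₘ Φ) l = X ((b₁ + b₂) ::ₘ b₂ ::ₘ Φ) l +
        mult b₁ * X ((b₁ + b₂) ::ₘ b₁ ::ₘ Φ) (l - b₁.1) := by
    intro b₁ b₂ h1 h2 l
    have h12 : Pos (b₁ + b₂).1 := hadd _ _ h1 h2
    have e12 := hX (b₁ ::ₘ b₂ ::ₘ Φ) (b₁ + b₂) h12
      (Multiset.forall_mem_cons.2 ⟨h1, Multiset.forall_mem_cons.2 ⟨h2, hΦ⟩⟩)
    have e1 := hX ((b₁ + b₂) ::ₘ b₂ ::ₘ Φ) b₁ h1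
      (Multiset.forall_mem_cons.2 ⟨h12, Multiset.forall_mem_cons.2 ⟨h2, hΦ⟩⟩)
    have e2 := hX ((b₁ + b₂) ::ₘ b₁ ::ₘ Φ) b₂ h2
      (Multiset.forall_mem_cons.2 ⟨h12, Multiset.forall_mem_cons.2 ⟨h1, hΦ⟩⟩)
    have s1 : b₁ ::ₘ (b₁ + b₂) ::ₘ b₂ ::ₘ Φ = (b₁ + b₂) ::ₘ b₁ ::ₘ b₂ ::ₘ Φ :=
      Multiset.cons_swap _ _ _
    have s2 : b₂ ::ₘ (b₁ + b₂) ::ₘ b₁ ::ₘ Φ = (b₁ + b₂) ::ₘ b₁ ::ₘ b₂ ::ₘ Φ := by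
      rw [Multiset.cons_swap b₂, Multiset.cons_swap b₂]
    rw [s1] at e1
    rw [s2] at e2
    rw [e12, e1, e2, mult_add, show l - (b₁ + b₂).1 = l - b₁.1 - b₂.1 by
      rw [Prod.fst_add, sub_sub]]
    ring
  intro l hl
  obtain ⟨t₁, h10, h11, d₁, hd₁, hd⟩ := mem_box_cons.1 hl
  obtain ⟨t₂, h20, h21, d', hd', rfl⟩ := mem_box_cons.1 hd₁
  -- For `t₁ ≤ t₂`, t₁b₁ + t₂b₂ = t₁(b₁+b₂) + (t₂-t₁)b₂ serves the unshifted term. The term at `l -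
  -- b₁` needs (t₁+1)b₁ + t₂b₂ = t₂(b₁+b₂) + (1-(t₂-t₁))b₁. All coefficients stay in [0,1]. The
  -- other order is handled by exchanging the two weights.
  have step : ∀ (b₁ b₂ : Weight Λ) (t₁ t₂ : ℝ), 0 ≤ t₁ → t₂ ≤ 1 → t₁ ≤ t₂ → Pos b₁.1 → Pos b₂.1 →
      VanishesOn ρ a X ((b₁ + b₂) ::ₘ b₁ ::ₘ Φ) → VanishesOn ρ a X ((b₁ + b₂) ::ₘ b₂ ::ₘ Φ) →
      a - ρ l = t₁ • ρ b₁.1 + (t₂ • ρ b₂.1 + d') → X (b₁ ::ₘ b₂ ::ₘ Φ) l = 0 := by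
    intro b₁ b₂ t₁ t₂ ht1 ht2 ht h1 h2 hg1 hg2 hd
    rw [key b₁ b₂ h1 h2, hg2, hg1, mul_zero, add_zero]
    · refine mem_box_cons.2 ⟨t₂, by linarith, ht2, _, mem_box_cons.2
        ⟨1 - (t₂ - t₁), by linarith, by linarith, d', hd', rfl⟩, ?_⟩
      rw [map_sub, sub_sub_eq_add_sub, add_sub_right_comm, hd, Prod.fst_add, map_add]
      module
    · refine mem_box_cons.2 ⟨t₁, ht1, by linarith, _, mem_box_cons.2
        ⟨t₂ - t₁, by linarith, by linarith, d', hd', rfl⟩, ?_⟩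
      rw [hd, Prod.fst_add, map_add]
      module
  rcases le_total t₁ t₂ with ht | ht
  · exact step b₁ b₂ t₁ t₂ h10 h21 ht h1 h2 hg1 hg2 hd
  · rw [Multiset.cons_swap]
    rw [add_comm b₁] at hg1 hg2
    exact step b₂ b₁ t₂ t₁ h20 h11 ht h2 h1 hg2 hg1 (by rw [hd]; abel)

/-- This is 1/(1-x) = (1+...+x^(m-1))/(1-x^m). A shift by `k • b` with `k < m` turns the coefficient
`t` of `b` into the coefficient `(t+k)/m ≤ 1` of `m • b`. -/
theorem VanishesOn.of_nsmul (hX : IsDifferenceSystem Pos X)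
    (hsmul : ∀ (m : ℕ) a, m ≠ 0 → Pos a → Pos (m • a)) (hb : Pos b.1) (hΦ : ∀ b ∈ Φ, Pos b.1)
    {m : ℕ} (hm : m ≠ 0) (hg : VanishesOn ρ a X (m • b ::ₘ Φ)) : VanishesOn ρ a X (b ::ₘ Φ) := by
  have key : ∀ l, X (b ::ₘ Φ) l =
      ∑ k ∈ Finset.range m, mult b ^ k * X (m • b ::ₘ Φ) (l - k • b.1) := by
    intro l
    have e1 := hX (b ::ₘ Φ) (m • b) (hsmul _ _ hm hb) (Multiset.forall_mem_cons.2 ⟨hb, hΦ⟩) l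
    have e2 := fun l => hX (m • b ::ₘ Φ) b hb
      (Multiset.forall_mem_cons.2 ⟨hsmul _ _ hm hb, hΦ⟩) l
    rw [Finset.sum_congr rfl fun k _ => by rw [e2 (l - k • b.1), Multiset.cons_swap]]
    rw [e1, mult_nsmul, Prod.smul_fst]
    have h : ∀ k : ℕ, mult b ^ k * (X (m • b ::ₘ b ::ₘ Φ) (l - k • b.1) -
        mult b * X (m • b ::ₘ b ::ₘ Φ) (l - k • b.1 - b.1)) =
        mult b ^ k * X (m • b ::ₘ b ::ₘ Φ) (l - k • b.1) -
        mult b ^ (k + 1) * X (m • b ::ₘ b ::ₘ Φ) (l - (k + 1) • b.1) := by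
      intro k
      rw [succ_nsmul, ← sub_sub]
      ring
    rw [Finset.sum_congr rfl fun k _ => h k, Finset.sum_range_sub'
      (fun k => mult b ^ k * X (m • b ::ₘ b ::ₘ Φ) (l - k • b.1))]
    simp
  intro l hl
  obtain ⟨t, h0, h1, d, hd, he⟩ := mem_box_cons.1 hl
  rw [key]
  refine Finset.sum_eq_zero fun k hk => ?_
  rw [hg, mul_zero]
  have hmpos : (0 : ℝ) < m := by exact_mod_cast Nat.pos_of_ne_zero hm
  have hk1 : (k : ℝ) + 1 ≤ m := by exact_mod_cast Finset.mem_range.1 hk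
  refine mem_box_cons.2 ⟨(t + k) / m, by positivity, ?_, d, hd, ?_⟩
  · rw [div_le_one hmpos]
    linarith
  · rw [map_sub, sub_sub_eq_add_sub, add_sub_right_comm, he, Prod.smul_fst, map_nsmul, map_nsmul,
      ← Nat.cast_smul_eq_nsmul ℝ, ← Nat.cast_smul_eq_nsmul ℝ, smul_smul, div_mul_cancel₀ _ hmpos.ne']
    module

/-- Weights on the same form with distinct multipliers u, v are separated by partial fractions in
one variable, available in two versions that differ by a shift: numerators v and u at `l`, or 1 and
1 at `l + b₁.1`. -/
theorem VanishesOn.of_parallel (hX : IsDifferenceSystem Pos X) (h1 : Pos b₁.1)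
    (h12 : b₁.1 = b₂.1) (hne : b₁ ≠ b₂) (hΦ : ∀ b ∈ Φ, Pos b.1)
    (hg1 : VanishesOn ρ a X (b₁ ::ₘ Φ)) (hg2 : VanishesOn ρ a X (b₂ ::ₘ Φ)) :
    VanishesOn ρ a X (b₁ ::ₘ b₂ ::ₘ Φ) := by
  have hx : mult b₂ - mult b₁ ≠ 0 := by
    intro h
    apply hne
    refine Prod.ext h12 ?_
    exact (Units.ext (sub_eq_zero.1 h)).symm
  have e1 := fun l => hX (b₂ ::ₘ Φ) b₁ h1 (Multiset.forall_mem_cons.2 ⟨h12 ▸ h1, hΦ⟩) l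
  have e2 := fun l => hX (b₁ ::ₘ Φ) b₂ (h12 ▸ h1) (Multiset.forall_mem_cons.2 ⟨h1, hΦ⟩) l
  simp only [Multiset.cons_swap b₂ b₁, ← h12] at e2
  have k1 : ∀ l, (mult b₂ - mult b₁) * X (b₁ ::ₘ b₂ ::ₘ Φ) l =
      mult b₂ * X (b₂ ::ₘ Φ) l - mult b₁ * X (b₁ ::ₘ Φ) l := by
    intro l
    rw [e1, e2]
    ring
  have k2 : ∀ l, (mult b₂ - mult b₁) * X (b₁ ::ₘ b₂ ::ₘ Φ) l =
      X (b₂ ::ₘ Φ) (l + b₁.1) - X (b₁ ::ₘ Φ) (l + b₁.1) := by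
    intro l
    rw [e1, e2, add_sub_cancel_right]
    ring
  intro l hl
  obtain ⟨t₁, h10, h11, d₁, hd₁, hd⟩ := mem_box_cons.1 hl
  obtain ⟨t₂, h20, h21, d', hd', rfl⟩ := mem_box_cons.1 hd₁
  refine (mul_eq_zero.1 (?_ : (mult b₂ - mult b₁) * X (b₁ ::ₘ b₂ ::ₘ Φ) l = 0)).resolve_left hx
  -- A single copy of the form absorbs `t₁ + t₂` if this is at most 1; otherwise the shifted version
  -- leaves `t₁ + t₂ - 1`.
  rcases le_total (t₁ + t₂) 1 with ht | ht
  · rw [k1, hg1, hg2, mul_zero, mul_zero, sub_zero]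
    · exact mem_box_cons.2 ⟨t₁ + t₂, by linarith, ht, d', hd', by rw [hd, h12]; module⟩
    · exact mem_box_cons.2 ⟨t₁ + t₂, by linarith, ht, d', hd', by rw [hd, h12]; module⟩
  · rw [k2, hg1, hg2, sub_zero]
    · refine mem_box_cons.2 ⟨t₁ + t₂ - 1, by linarith, by linarith, d', hd', ?_⟩
      rw [map_add, ← sub_sub, hd, h12]
      module
    · refine mem_box_cons.2 ⟨t₁ + t₂ - 1, by linarith, by linarith, d', hd', ?_⟩
      rw [map_add, ← sub_sub, hd, h12]
      module

theorem pos_nsmul_singleton_add (h1 : Pos b.1) (hΨ : ∀ b ∈ Ψ, Pos b.1) (m : ℕ) :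
    ∀ c ∈ m • ({b} : Multiset (Weight Λ)) + Ψ, Pos c.1 := by
  intro c hc
  rcases Multiset.mem_add.1 hc with h | h
  · rw [Multiset.mem_singleton.1 (Multiset.mem_of_mem_nsmul h)]
    exact h1
  · exact hΨ c h

/-- Every use of `VanishesOn.of_add` trades one copy of `b₁` or `b₂` for a copy of the sum, so `m₁ +
m₂` decreases until one of the two weights has disappeared. -/
theorem VanishesOn.of_add_multi (hX : IsDifferenceSystem Pos X)
    (hadd : ∀ a b, Pos a → Pos b → Pos (a + b))
    (h1 : Pos b₁.1) (h2 : Pos b₂.1) (hΨ : ∀ b ∈ Ψ, Pos b.1)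
    (hg1 : ∀ p q : ℕ, VanishesOn ρ a X (p • {b₁ + b₂} + (q • {b₁} + Ψ)))
    (hg2 : ∀ p q : ℕ, VanishesOn ρ a X (p • {b₁ + b₂} + (q • {b₂} + Ψ))) (m : ℕ) :
    ∀ m₁ m₂ p : ℕ, m₁ + m₂ = m →
      VanishesOn ρ a X (p • {b₁ + b₂} + (m₁ • {b₁} + (m₂ • {b₂} + Ψ))) := by
  induction m with
  | zero =>
    intro m₁ m₂ p hm
    obtain ⟨rfl, rfl⟩ : m₁ = 0 ∧ m₂ = 0 := by omega
    simpa using hg1 p 0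
  | succ m ih =>
    intro m₁ m₂ p hm
    rcases m₁ with _ | m₁
    · simpa using hg2 p m₂
    rcases m₂ with _ | m₂
    · simpa using hg1 p (m₁ + 1)
    have e : p • {b₁ + b₂} + ((m₁ + 1) • {b₁} + ((m₂ + 1) • {b₂} + Ψ)) =
        b₁ ::ₘ b₂ ::ₘ (p • {b₁ + b₂} + (m₁ • {b₁} + (m₂ • {b₂} + Ψ))) := by
      simp only [succ_nsmul, ← Multiset.singleton_add]
      abel
    rw [e]
    refine VanishesOn.of_add hX hadd h1 h2 ?_ ?_ ?_
    · exact pos_nsmul_singleton_add (hadd _ _ h1 h2) (pos_nsmul_singleton_add h1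
        (pos_nsmul_singleton_add h2 hΨ _) _) _
    · have := ih (m₁ + 1) m₂ (p + 1) (by omega)
      convert this using 1
      simp only [succ_nsmul, ← Multiset.singleton_add]
      abel
    · have := ih m₁ (m₂ + 1) (p + 1) (by omega)
      convert this using 1
      simp only [succ_nsmul, ← Multiset.singleton_add]
      abel

theorem VanishesOn.of_parallel_multi (hX : IsDifferenceSystem Pos X)
    (h1 : Pos b₁.1) (h12 : b₁.1 = b₂.1) (hne : b₁ ≠ b₂) (hΨ : ∀ b ∈ Ψ, Pos b.1)
    (hg1 : ∀ q : ℕ, VanishesOn ρ a X (q • {b₁} + Ψ))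
    (hg2 : ∀ q : ℕ, VanishesOn ρ a X (q • {b₂} + Ψ)) (m : ℕ) :
    ∀ m₁ m₂ : ℕ, m₁ + m₂ = m → VanishesOn ρ a X (m₁ • {b₁} + (m₂ • {b₂} + Ψ)) := by
  induction m with
  | zero =>
    intro m₁ m₂ hm
    obtain ⟨rfl, rfl⟩ : m₁ = 0 ∧ m₂ = 0 := by omega
    simpa using hg1 0
  | succ m ih =>
    intro m₁ m₂ hm
    rcases m₁ with _ | m₁
    · simpa using hg2 m₂
    rcases m₂ with _ | m₂
    · simpa using hg1 (m₁ + 1)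
    have e : (m₁ + 1) • {b₁} + ((m₂ + 1) • {b₂} + Ψ) =
        b₁ ::ₘ b₂ ::ₘ (m₁ • {b₁} + (m₂ • {b₂} + Ψ)) := by
      simp only [succ_nsmul, ← Multiset.singleton_add]
      abel
    rw [e]
    refine VanishesOn.of_parallel hX h1 h12 hne ?_ ?_ ?_
    · exact pos_nsmul_singleton_add h1 (pos_nsmul_singleton_add (h12 ▸ h1) hΨ _) _
    · have := ih (m₁ + 1) m₂ (by omega)
      convert this using 1
      simp only [succ_nsmul, ← Multiset.singleton_add]
      abel
    · have := ih m₁ (m₂ + 1) (by omega)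
      convert this using 1
      simp only [succ_nsmul, ← Multiset.singleton_add]
      abel

theorem VanishesOn.of_nsmul_multi (hX : IsDifferenceSystem Pos X)
    (hsmul : ∀ (m : ℕ) a, m ≠ 0 → Pos a → Pos (m • a)) (hb : Pos b.1)
    {m : ℕ} (hm : m ≠ 0) (q : ℕ) : ∀ Ψ : Multiset (Weight Λ), (∀ b ∈ Ψ, Pos b.1) →
      VanishesOn ρ a X (q • {m • b} + Ψ) → VanishesOn ρ a X (q • {b} + Ψ) := by
  induction q with
  | zero => intro Ψ _ h; simpa using h
  | succ q ih =>
    intro Ψ hΨ h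
    have e1 : (q + 1) • {m • b} + Ψ = q • {m • b} + (m • b ::ₘ Ψ) := by
      simp only [succ_nsmul, ← Multiset.singleton_add]
      abel
    have e2 : q • {b} + (m • b ::ₘ Ψ) = m • b ::ₘ (q • {b} + Ψ) := by
      simp only [← Multiset.singleton_add]
      abel
    have e3 : (q + 1) • {b} + Ψ = b ::ₘ (q • {b} + Ψ) := by
      simp only [succ_nsmul, ← Multiset.singleton_add]
      abel
    rw [e1] at h
    have h' := ih _ (Multiset.forall_mem_cons.2 ⟨hsmul _ _ hm hb, hΨ⟩) h
    rw [e2] at h'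
    rw [e3]
    exact VanishesOn.of_nsmul hX hsmul hb (pos_nsmul_singleton_add hb hΨ _) hm h'

variable {ι : Type*} [DecidableEq ι]

theorem pos_sum_nsmul {s : Finset ι} {b : ι → Weight Λ} (m : ι → ℕ) (hb : ∀ k ∈ s, Pos (b k).1) :
    ∀ c ∈ ∑ k ∈ s, m k • ({b k} : Multiset (Weight Λ)), Pos c.1 := by
  intro c hc
  obtain ⟨k, hk, h⟩ := Multiset.mem_sum.1 hc
  rw [Multiset.mem_singleton.1 (Multiset.mem_of_mem_nsmul h)]
  exact hb k hk

theorem VanishesOn.of_nsmul_sum (hX : IsDifferenceSystem Pos X)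
    (hsmul : ∀ (m : ℕ) a, m ≠ 0 → Pos a → Pos (m • a)) {t : ι → ℕ} (ht : ∀ k, t k ≠ 0)
    (b : ι → Weight Λ) (m : ι → ℕ) (s : Finset ι) : (∀ k ∈ s, Pos (b k).1) →
    ∀ Ψ : Multiset (Weight Λ), (∀ b ∈ Ψ, Pos b.1) →
      VanishesOn ρ a X (∑ k ∈ s, m k • {t k • b k} + Ψ) →
      VanishesOn ρ a X (∑ k ∈ s, m k • {b k} + Ψ) := by
  induction s using Finset.induction_on with
  | empty => intro _ Ψ _ h; simpa using h
  | insert k s hk ih =>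
    intro hb Ψ hΨ h
    rw [Finset.sum_insert hk] at h ⊢
    rw [add_assoc] at h ⊢
    have hb' : ∀ k ∈ s, Pos (b k).1 := fun j hj => hb j (Finset.mem_insert_of_mem hj)
    have hbk := hb k (Finset.mem_insert_self _ _)
    refine VanishesOn.of_nsmul_multi hX hsmul hbk (ht k) _ _ ?_ ?_
    · intro c hc
      rcases Multiset.mem_add.1 hc with h | h
      · exact pos_sum_nsmul m hb' c h
      · exact hΨ c h
    · rw [add_left_comm] at h ⊢
      exact ih hb' _ (pos_nsmul_singleton_add (hsmul _ _ (ht k) hbk) hΨ _) h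

theorem sum_nsmul_split {s : Finset ι} {k l : ι} (hk : k ∈ s) (hl : l ∈ s) (hkl : l ≠ k)
    (b : ι → Weight Λ) (m : ι → ℕ) : ∑ j ∈ s, m j • ({b j} : Multiset (Weight Λ)) =
      m k • {b k} + (m l • {b l} + ∑ j ∈ (s.erase k).erase l, m j • {b j}) := by
  rw [Finset.add_sum_erase _ (fun j => m j • ({b j} : Multiset (Weight Λ)))
    (Finset.mem_erase.2 ⟨hkl, hl⟩), Finset.add_sum_erase _
    (fun j => m j • ({b j} : Multiset (Weight Λ))) hk]

/-- A relation with coefficients 0, 1, -1 is shortened by induction on its number `r` of nonzero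
coefficients until it says that two weights lie on the same form. Then the number of distinct
weights can be lowered and `ih` applies. -/
theorem VanishesOn.of_relation (hX : IsDifferenceSystem Pos X)
    (hadd : ∀ a b, Pos a → Pos b → Pos (a + b)) (h : Λ →+ ℝ) (hh : ∀ a, Pos a → 0 < h a)
    {s : Finset ι}
    (ih : ∀ k ∈ s, ∀ (b : ι → Weight Λ) (m : ι → ℕ), (∀ k ∈ s, Pos (b k).1) →
      VanishesOn ρ a X (∑ j ∈ s.erase k, m j • {b j})) (r : ℕ) :
    ∀ (b : ι → Weight Λ) (m : ι → ℕ) (c : ι → ℤ), (∀ k ∈ s, Pos (b k).1) →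
      (∀ k ∈ s, c k = 0 ∨ c k = 1 ∨ c k = -1) → ∑ k ∈ s, c k • (b k).1 = 0 →
      (∃ k ∈ s, c k ≠ 0) → (s.filter fun k => c k ≠ 0).card = r →
      VanishesOn ρ a X (∑ j ∈ s, m j • {b j}) := by
  induction r using Nat.strong_induction_on with
  | _ r ihr =>
  intro b m c hb hc hrel hne hr
  -- Two coefficients of equal sign: `b k` and `b l` are split into their sum together with one of
  -- them.
  by_cases hA : ∃ k ∈ s, ∃ l ∈ s, l ≠ k ∧ c k = c l ∧ c k ≠ 0
  · obtain ⟨k, hk, l, hl, hlk, hckl, hck⟩ := hA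
    rw [sum_nsmul_split hk hl hlk]
    have hrest : ∀ d ∈ ∑ j ∈ (s.erase k).erase l, m j • ({b j} : Multiset (Weight Λ)), Pos d.1 :=
      pos_sum_nsmul m fun j hj => hb j (Finset.mem_of_mem_erase (Finset.mem_of_mem_erase hj))
    have step : ∀ (d : Weight Λ), Pos d.1 → ∀ p q : ℕ, VanishesOn ρ a X (p • {b k + b l} +
        (q • {d} + ∑ j ∈ (s.erase k).erase l, m j • {b j})) := by
      intro d hd p q
      -- The sum takes the place of `b k` and keeps the coefficient `c k`; the surviving weight `d`
      -- takes the place of `b l` with coefficient 0. The relation persists with one nonzero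
      -- coefficient fewer.
      let b' := Function.update (Function.update b k (b k + b l)) l d
      let m' := Function.update (Function.update m k p) l q
      let c' := Function.update c l 0
      have hb'k : b' k = b k + b l := by simp [b', hlk.symm]
      have hb'l : b' l = d := by simp [b']
      have hb'j : ∀ j, j ≠ k → j ≠ l → b' j = b j := fun j h1 h2 => by simp [b', h1, h2]
      have hres := ihr (s.filter fun k => c' k ≠ 0).card ?_ b' m' c' ?_ ?_ ?_ ?_ rfl
      · rw [sum_nsmul_split hk hl hlk, hb'k, hb'l] at hres
        have e1 : m' k = p := by simp [m', hlk.symm]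
        have e2 : m' l = q := by simp [m']
        rw [e1, e2] at hres
        convert hres using 3
        refine Finset.sum_congr rfl fun j hj => ?_
        have h2 := Finset.ne_of_mem_erase hj
        have h1 := Finset.ne_of_mem_erase (Finset.mem_of_mem_erase hj)
        rw [hb'j j h1 h2]
        simp [m', h1, h2]
      · rw [← hr]
        refine Finset.card_lt_card (Finset.ssubset_iff_subset_ne.2 ⟨fun j hj => ?_, fun heq => ?_⟩)
        · rw [Finset.mem_filter] at hj ⊢
          refine ⟨hj.1, fun h0 => hj.2 ?_⟩
          by_cases hjl : j = l
          · subst hjl; simp [c']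
          · simp [c', hjl, h0]
        · have : l ∈ s.filter fun k => c' k ≠ 0 := by
            rw [heq, Finset.mem_filter]
            exact ⟨hl, hckl ▸ hck⟩
          simp [c'] at this
      · intro j hj
        by_cases h2 : j = l
        · subst h2; rw [hb'l]; exact hd
        by_cases h1 : j = k
        · subst h1; rw [hb'k]; exact hadd _ _ (hb j hk) (hb l hl)
        rw [hb'j j h1 h2]; exact hb j hj
      · intro j hj
        by_cases h2 : j = l
        · subst h2; simp [c']
        · simpa [c', h2] using hc j hj
      · rw [← Finset.add_sum_erase _ _ hk, ← Finset.add_sum_erase _ _ (Finset.mem_erase.2 ⟨hlk, hl⟩)]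
          at hrel ⊢
        have e1 : c' k = c k := by simp [c', hlk.symm]
        have e2 : c' l = 0 := by simp [c']
        rw [e1, e2, hb'k, zero_smul, zero_add, Prod.fst_add, smul_add, ← hrel, hckl, add_assoc]
        congr 2
        refine Finset.sum_congr rfl fun j hj => ?_
        have h2 := Finset.ne_of_mem_erase hj
        have h1 := Finset.ne_of_mem_erase (Finset.mem_of_mem_erase hj)
        rw [hb'j j h1 h2]
        simp [c', h2]
      · exact ⟨k, hk, by simpa [c', hlk.symm] using hck⟩
    have := VanishesOn.of_add_multi hX hadd (hb k hk) (hb l hl) hrest (step _ (hb k hk))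
      (step _ (hb l hl)) _ (m k) (m l) 0 rfl
    simpa using this
  · push Not at hA
    have hsum : ∑ k ∈ s, (c k : ℝ) * h (b k).1 = 0 := by
      have := congrArg h hrel
      simpa [map_sum, map_zsmul] using this
    -- Positivity of `h` on the weights rules out a relation with coefficients of only one sign. So
    -- exactly one 1 and one -1 remain.
    obtain ⟨k, hk, hck⟩ : ∃ k ∈ s, c k = 1 := by
      by_contra! hcon
      obtain ⟨k, hk, hck⟩ := hne
      have : ∑ k ∈ s, (c k : ℝ) * h (b k).1 < 0 := by
        refine Finset.sum_neg' (fun j hj => ?_) ⟨k, hk, ?_⟩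
        · rcases hc j hj with h0 | h0 | h0
          · simp [h0]
          · exact absurd h0 (hcon j hj)
          · simp [h0, (hh _ (hb j hj)).le]
        · rcases hc k hk with h0 | h0 | h0
          · exact absurd h0 hck
          · exact absurd h0 (hcon k hk)
          · simp [h0, hh _ (hb k hk)]
      exact this.ne hsum
    obtain ⟨l, hl, hcl⟩ : ∃ l ∈ s, c l = -1 := by
      by_contra! hcon
      have : 0 < ∑ k ∈ s, (c k : ℝ) * h (b k).1 := by
        refine Finset.sum_pos' (fun j hj => ?_) ⟨k, hk, ?_⟩
        · rcases hc j hj with h0 | h0 | h0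
          · simp [h0]
          · simp [h0, (hh _ (hb j hj)).le]
          · exact absurd h0 (hcon j hj)
        · simp [hck, hh _ (hb k hk)]
      exact this.ne' hsum
    have hlk : l ≠ k := by
      rintro rfl
      omega
    have hz : ∀ j ∈ (s.erase k).erase l, c j = 0 := by
      intro j hj
      have h2 := Finset.ne_of_mem_erase hj
      have h1 := Finset.ne_of_mem_erase (Finset.mem_of_mem_erase hj)
      have hjs := Finset.mem_of_mem_erase (Finset.mem_of_mem_erase hj)
      rcases hc j hjs with h0 | h0 | h0
      · exact h0
      · exact absurd (hA k hk j hjs h1 (by rw [hck, h0])) (by omega)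
      · exact absurd (hA l hl j hjs h2 (by rw [hcl, h0])) (by omega)
    have hbkl : (b k).1 = (b l).1 := by
      rw [← Finset.add_sum_erase _ _ hk, ← Finset.add_sum_erase _ _ (Finset.mem_erase.2 ⟨hlk, hl⟩),
        Finset.sum_eq_zero fun j hj => by rw [hz j hj, zero_smul], hck, hcl] at hrel
      simpa [← sub_eq_add_neg, sub_eq_zero] using hrel
    have hupd : ∀ (i j : ι), i ∈ s → j ∈ s → i ≠ j → ∀ q : ℕ,
        VanishesOn ρ a X (q • {b i} + ∑ n ∈ (s.erase i).erase j, m n • {b n}) := by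
      intro i j hi hj hij q
      have := ih j hj b (Function.update m i q) hb
      rw [← Finset.add_sum_erase _ _ (Finset.mem_erase.2 ⟨hij, hi⟩), Function.update_self,
        Finset.erase_right_comm] at this
      have e : ∑ n ∈ (s.erase i).erase j, Function.update m i q n • ({b n} : Multiset (Weight Λ)) =
          ∑ n ∈ (s.erase i).erase j, m n • {b n} := by
        refine Finset.sum_congr rfl fun n hn => ?_
        rw [Function.update_of_ne (Finset.ne_of_mem_erase (Finset.mem_of_mem_erase hn))]
      rwa [e] at this
    rw [sum_nsmul_split hk hl hlk]
    -- Equal multipliers: the two weights coincide and their multiplicities add. Distinct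
    -- multipliers: partial fractions leave only one of them.
    by_cases hbb : b k = b l
    · rw [← hbb, ← add_assoc, ← add_nsmul]
      exact hupd k l hk hl hlk.symm _
    · refine VanishesOn.of_parallel_multi hX (hb k hk) hbkl hbb ?_ (hupd k l hk hl hlk.symm) ?_ _
        _ _ rfl
      · exact pos_sum_nsmul m fun j hj => hb j (Finset.mem_of_mem_erase (Finset.mem_of_mem_erase hj))
      · rw [Finset.erase_right_comm]
        exact hupd l k hl hk hlk

/-- A difference system which vanishes on the zonotopes of systems with independent weights vanishes
on all zonotopes. -/
theorem VanishesOn.of_independent (hX : IsDifferenceSystem Pos X)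
    (hadd : ∀ a b, Pos a → Pos b → Pos (a + b))
    (hsmul : ∀ (m : ℕ) a, m ≠ 0 → Pos a → Pos (m • a))
    (h : Λ →+ ℝ) (hh : ∀ a, Pos a → 0 < h a)
    (hbase : ∀ (s : Finset ι) (b : ι → Weight Λ) (m : ι → ℕ), (∀ k ∈ s, Pos (b k).1) →
      (∀ k ∈ s, m k ≠ 0) → LinearIndepOn ℤ (fun k => (b k).1) (s : Set ι) →
      VanishesOn ρ a X (∑ j ∈ s, m j • {b j})) (d : ℕ) :
    ∀ (s : Finset ι) (b : ι → Weight Λ) (m : ι → ℕ), s.card = d → (∀ k ∈ s, Pos (b k).1) →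
      VanishesOn ρ a X (∑ j ∈ s, m j • {b j}) := by
  induction d using Nat.strong_induction_on with
  | _ d ih =>
  intro s b m hd hb
  by_cases hm : ∃ k ∈ s, m k = 0
  · obtain ⟨k, hk, hmk⟩ := hm
    rw [← Finset.add_sum_erase s (fun j => m j • ({b j} : Multiset (Weight Λ))) hk, hmk, zero_smul,
      zero_add]
    exact ih _ (hd ▸ Finset.card_erase_lt_of_mem hk) _ b m rfl
      fun j hj => hb j (Finset.mem_of_mem_erase hj)
  by_cases hli : LinearIndepOn ℤ (fun k => (b k).1) (s : Set ι)
  · exact hbase s b m hb (by push Not at hm; exact hm) hli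
  rw [linearIndepOn_finset_iff] at hli
  push Not at hli
  obtain ⟨c, hc, k, hk, hck⟩ := hli
  -- Replacing `b k` by `|c k| • b k` turns the integral relation into one whose coefficients are
  -- the signs; weights absent from the relation are left unscaled.
  let t : ι → ℕ := fun k => if c k = 0 then 1 else (c k).natAbs
  have ht : ∀ k, t k ≠ 0 := by
    intro k
    by_cases h0 : c k = 0
    · simp [t, h0]
    · simp [t, h0]
  have key := VanishesOn.of_nsmul_sum (ρ := ρ) (a := a) hX hsmul ht b m s hb 0 (by simp)
  simp only [add_zero] at key
  refine key ?_
  refine VanishesOn.of_relation hX hadd h hh (s := s) ?_ _ (fun k => t k • b k) m (fun k => (c k).sign)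
    (fun k hk => hsmul _ _ (ht k) (hb k hk)) ?_ ?_ ⟨k, hk, by simpa using hck⟩ rfl
  · intro k hk b' m' hb'
    exact ih _ (hd ▸ Finset.card_erase_lt_of_mem hk) _ b' m' rfl
      fun j hj => hb' j (Finset.mem_of_mem_erase hj)
  · intro k _
    rcases lt_trichotomy (c k) 0 with h0 | h0 | h0
    · simp [Int.sign_eq_neg_one_of_neg h0]
    · simp [h0]
    · simp [Int.sign_eq_one_of_pos h0]
  · rw [← hc]
    refine Finset.sum_congr rfl fun k _ => ?_
    rw [Prod.smul_fst, ← natCast_zsmul, smul_smul]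
    congr 1
    by_cases h0 : c k = 0
    · simp [h0]
    · simp [t, h0, Int.sign_mul_abs]

end Reduction

/-! ### The weighted partition function -/

section PartitionFunction

variable {Λ : Type*} [AddCommGroup Λ]

/-- The formal exponential of a weight, graded by `h`. -/
def weightSeries (h : Λ →+ ℝ) (b : Weight Λ) : HahnSeries ℝ (AddMonoidAlgebra ℂ Λ) :=
  HahnSeries.single (h b.1) (AddMonoidAlgebra.single b.1 (mult b))

/-- The weighted partition function of a system of weights on which `h` is positive: the
coefficients of the product of the geometric series of the weights. -/
def partitionFun (h : Λ →+ ℝ) (Φ : Multiset (Weight Λ)) (l : Λ) : ℂ :=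
  ((Φ.map fun b => (HahnSeries.SummableFamily.powers (weightSeries h b)).hsum).prod.coeff
    (h l)).coeff l

open Classical in
theorem partitionFun_zero (h : Λ →+ ℝ) (l : Λ) :
    partitionFun h 0 l = if l = 0 then 1 else 0 := by
  by_cases hl : l = 0
  · subst hl
    simp [partitionFun, AddMonoidAlgebra.one_def]
  · rw [if_neg hl]
    unfold partitionFun
    rw [Multiset.map_zero, Multiset.prod_zero, HahnSeries.coeff_one]
    split_ifs
    · rw [AddMonoidAlgebra.one_def, AddMonoidAlgebra.coeff_single, Finsupp.single_apply,
        if_neg (Ne.symm hl)]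
    · simp

/-- The grading by `h` gives a positive weight positive order, so its powers are summable, and
multiplying by one minus the weight removes its geometric series. -/
theorem isDifferenceSystem_partitionFun {Pos : Λ → Prop} {h : Λ →+ ℝ} (hh : ∀ a, Pos a → 0 < h a) :
    IsDifferenceSystem Pos (partitionFun h) := by
  intro Φ b hb _ l
  have hs : 0 < (weightSeries h b).orderTop := by
    refine lt_of_lt_of_le ?_ HahnSeries.orderTop_single_le
    exact_mod_cast hh _ hb
  have key := HahnSeries.SummableFamily.one_sub_self_mul_hsum_powers hs
  unfold partitionFun
  rw [Multiset.map_cons, Multiset.prod_cons]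
  set P := (Φ.map fun b => (HahnSeries.SummableFamily.powers (weightSeries h b)).hsum).prod
  set G := (HahnSeries.SummableFamily.powers (weightSeries h b)).hsum
  have hP : P = G * P - weightSeries h b * (G * P) := by
    rw [← one_sub_mul, ← mul_assoc, key, one_mul]
  conv_lhs => rw [hP]
  rw [HahnSeries.coeff_sub, weightSeries, HahnSeries.coeff_single_mul, ← map_sub,
    AddMonoidAlgebra.coeff_sub, Finsupp.sub_apply, AddMonoidAlgebra.coeff_single_mul_apply,
    neg_add_eq_sub]

theorem partitionFun_eq_zero_of_lt (h : Λ →+ ℝ) (Φ : Multiset (Weight Λ)) :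
    ∃ M : ℝ, ∀ l, h l < M → partitionFun h Φ l = 0 :=
  ⟨_, fun l hl => by rw [partitionFun, HahnSeries.coeff_eq_zero_of_lt_order hl]; rfl⟩

variable {Pos : Λ → Prop} {h : Λ →+ ℝ}

/-- Iterating the recurrence leaves a remainder at `l - K • b.1`, which vanishes once its height is
below the support. Stating it for all large `K` allows a common threshold with other bounds. -/
theorem partitionFun_cons (hh : ∀ a, Pos a → 0 < h a) {Φ : Multiset (Weight Λ)} {b : Weight Λ}
    (hb : Pos b.1) (hΦ : ∀ b ∈ Φ, Pos b.1) (l : Λ) :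
    ∃ K₀ : ℕ, ∀ K ≥ K₀, partitionFun h (b ::ₘ Φ) l =
      ∑ k ∈ Finset.range K, mult b ^ k * partitionFun h Φ (l - k • b.1) := by
  have hd := isDifferenceSystem_partitionFun hh Φ b hb hΦ
  obtain ⟨M, hM⟩ := partitionFun_eq_zero_of_lt h (b ::ₘ Φ)
  obtain ⟨K₀, hK₀⟩ := Archimedean.arch (h l - M + 1) (hh _ hb)
  refine ⟨K₀, fun K hK => ?_⟩
  have hstep : ∀ K : ℕ, partitionFun h (b ::ₘ Φ) l =
      ∑ k ∈ Finset.range K, mult b ^ k * partitionFun h Φ (l - k • b.1) +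
        mult b ^ K * partitionFun h (b ::ₘ Φ) (l - K • b.1) := by
    intro K
    induction K with
    | zero => simp
    | succ K ih =>
      rw [ih, Finset.sum_range_succ, hd (l - K • b.1), succ_nsmul, sub_sub l, pow_succ]
      ring
  rw [hstep K, hM (l - K • b.1), mul_zero, add_zero]
  have h1 : K₀ • h b.1 ≤ K • h b.1 := nsmul_le_nsmul_left (hh _ hb).le hK
  rw [map_sub, map_nsmul]
  linarith

theorem mem_closure_of_partitionFun_ne_zero (hh : ∀ a, Pos a → 0 < h a) (Φ : Multiset (Weight Λ)) :
    (∀ b ∈ Φ, Pos b.1) → ∀ l, partitionFun h Φ l ≠ 0 →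
      l ∈ AddSubmonoid.closure {c | ∃ b ∈ Φ, c = b.1} := by
  classical
  induction Φ using Multiset.induction_on with
  | empty =>
    intro _ l hl
    rw [partitionFun_zero] at hl
    have : l = 0 := by by_contra h0; exact hl (if_neg h0)
    rw [this]
    exact zero_mem _
  | cons b Φ ih =>
    intro hΦ l hl
    obtain ⟨hb, hΦ⟩ := Multiset.forall_mem_cons.1 hΦ
    obtain ⟨K, hK⟩ := partitionFun_cons hh hb hΦ l
    rw [hK K le_rfl] at hl
    obtain ⟨k, _, hk⟩ := Finset.exists_ne_zero_of_sum_ne_zero hl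
    have h1 := ih hΦ _ (right_ne_zero_of_mul hk)
    have h2 : l = (l - k • b.1) + k • b.1 := by abel
    rw [h2]
    refine add_mem (AddSubmonoid.closure_mono ?_ h1) (nsmul_mem (AddSubmonoid.subset_closure ?_) k)
    · rintro c ⟨b', hb', rfl⟩
      exact ⟨b', Multiset.mem_cons_of_mem hb', rfl⟩
    · exact ⟨b, Multiset.mem_cons_self _ _, rfl⟩

theorem exists_nsmul_of_mem_closure {ι : Type*} [DecidableEq ι] {s : Finset ι} {b : ι → Weight Λ}
    {m : ι → ℕ}
    {l : Λ} (hl : l ∈ AddSubmonoid.closure {c | ∃ b' ∈ ∑ j ∈ s, m j • ({b j} : Multiset (Weight Λ)),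
      c = b'.1}) : ∃ j : ι → ℕ, l = ∑ k ∈ s, j k • (b k).1 := by
  induction hl using AddSubmonoid.closure_induction with
  | mem x hx =>
    obtain ⟨b', hb', rfl⟩ := hx
    rw [Multiset.mem_sum] at hb'
    obtain ⟨k, hk, hb'⟩ := hb'
    rw [Multiset.mem_singleton.1 (Multiset.mem_of_mem_nsmul hb')]
    exact ⟨Pi.single k 1, by simp [Pi.single_apply, ite_smul, hk]⟩
  | zero => exact ⟨0, by simp⟩
  | add x y _ _ hx hy =>
    obtain ⟨j, rfl⟩ := hx
    obtain ⟨j', rfl⟩ := hy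
    exact ⟨j + j', by simp [add_smul, Finset.sum_add_distrib]⟩

theorem eq_of_sum_nsmul_eq {ι : Type*} {s : Finset ι} {b : ι → Λ}
    (hli : LinearIndepOn ℤ b (s : Set ι)) {c d : ι → ℤ}
    (h : ∑ k ∈ s, c k • b k = ∑ k ∈ s, d k • b k) : ∀ k ∈ s, c k = d k := by
  intro k hk
  have := linearIndepOn_finset_iff.1 hli (fun k => c k - d k)
    (by simp only [sub_smul, Finset.sum_sub_distrib, h, sub_self]) k hk
  exact sub_eq_zero.1 this

/-- For independent weights the coordinates of `l` are unique, and the recurrence for removing one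
copy of `b k` becomes Pascal's rule for `Nat.multichoose`. The induction is on all multiplicities
and coordinates together. -/
theorem partitionFun_sum_nsmul {ι : Type*} [DecidableEq ι] (hh : ∀ a, Pos a → 0 < h a)
    {s : Finset ι} {b : ι → Weight Λ} (hb : ∀ k ∈ s, Pos (b k).1)
    (hli : LinearIndepOn ℤ (fun k => (b k).1) (s : Set ι)) (d : ℕ) :
    ∀ (m j : ι → ℕ), ∑ k ∈ s, m k + ∑ k ∈ s, j k = d →
      partitionFun h (∑ k ∈ s, m k • {b k}) (∑ k ∈ s, j k • (b k).1) =
        ∏ k ∈ s, mult (b k) ^ j k * (Nat.multichoose (m k) (j k) : ℂ) := by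
  classical
  induction d using Nat.strong_induction_on with
  | _ d ih =>
  intro m j hd
  have hpos : ∀ m : ι → ℕ, ∀ c ∈ ∑ k ∈ s, m k • ({b k} : Multiset (Weight Λ)), Pos c.1 := by
    intro m c hc
    rw [Multiset.mem_sum] at hc
    obtain ⟨k, hk, hc⟩ := hc
    rw [Multiset.mem_singleton.1 (Multiset.mem_of_mem_nsmul hc)]
    exact hb k hk
  by_cases hm : ∀ k ∈ s, m k = 0
  · rw [Finset.sum_eq_zero fun k hk => by rw [hm k hk, zero_smul], partitionFun_zero]
    by_cases hj : ∀ k ∈ s, j k = 0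
    · rw [if_pos (Finset.sum_eq_zero fun k hk => by rw [hj k hk, zero_smul]),
        Finset.prod_eq_one fun k hk => by rw [hm k hk, hj k hk]; simp]
    · rw [if_neg]
      · push Not at hj
        obtain ⟨k, hk, hjk⟩ := hj
        obtain ⟨r, hr⟩ := Nat.exists_eq_succ_of_ne_zero hjk
        rw [Finset.prod_eq_zero hk]
        rw [hm k hk, hr, Nat.multichoose_zero_succ]
        simp
      · intro h0
        refine hj fun k hk => ?_
        have := eq_of_sum_nsmul_eq hli (c := fun k => (j k : ℤ)) (d := 0) (by simpa using h0) k hk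
        simpa using this
  · push Not at hm
    obtain ⟨k, hk, hmk⟩ := hm
    obtain ⟨r, hr⟩ := Nat.exists_eq_succ_of_ne_zero hmk
    have hsplit : ∑ k ∈ s, m k • ({b k} : Multiset (Weight Λ)) =
        b k ::ₘ ∑ i ∈ s, Function.update m k r i • {b i} := by
      rw [← Finset.add_sum_erase _ _ hk, ← Finset.add_sum_erase s
        (fun i => Function.update m k r i • ({b i} : Multiset (Weight Λ))) hk, Function.update_self,
        ← Multiset.singleton_add, ← add_assoc, hr, succ_nsmul']
      congr 1
      exact Finset.sum_congr rfl fun i hi => by rw [Function.update_of_ne (Finset.ne_of_mem_erase hi)]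
    have hdiff := isDifferenceSystem_partitionFun hh (∑ i ∈ s, Function.update m k r i • {b i}) (b k)
      (hb k hk) (hpos _) (∑ k ∈ s, j k • (b k).1)
    have hsum : ∀ (f : ι → ℕ) (q : ℕ), f k = q + 1 →
        ∑ i ∈ s, Function.update f k q i + 1 = ∑ i ∈ s, f i := by
      intro f q hq
      rw [Finset.sum_update_of_mem hk, ← Finset.add_sum_erase s f hk, hq, Finset.sdiff_singleton_eq_erase]
      omega
    have hms := hsum m r hr
    have e1 := ih _ (by omega) (Function.update m k r) j rfl
    rw [← Finset.mul_prod_erase _ _ hk, Function.update_self] at e1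
    have e2 : ∏ i ∈ s.erase k, mult (b i) ^ j i * (Nat.multichoose (Function.update m k r i) (j i) : ℂ) =
        ∏ i ∈ s.erase k, mult (b i) ^ j i * (Nat.multichoose (m i) (j i) : ℂ) :=
      Finset.prod_congr rfl fun i hi => by
        rw [Function.update_of_ne (Finset.ne_of_mem_erase hi)]
    rw [← hsplit, e1, e2] at hdiff
    rw [← Finset.mul_prod_erase _ _ hk, hr]
    rcases hjk : j k with _ | q
    -- With `j k = 0` the shifted argument has coordinate -1 at `k`, outside the cone generated by
    -- the weights.
    · have hz : partitionFun h (∑ k ∈ s, m k • {b k}) (∑ k ∈ s, j k • (b k).1 - (b k).1) = 0 := by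
        by_contra h0
        obtain ⟨j', hj'⟩ := exists_nsmul_of_mem_closure
          (mem_closure_of_partitionFun_ne_zero hh _ (hpos m) _ h0)
        have := eq_of_sum_nsmul_eq hli (c := fun i => (j i : ℤ) - if i = k then 1 else 0)
          (d := fun i => (j' i : ℤ))
          (by simp only [sub_smul, Finset.sum_sub_distrib, ite_smul, natCast_zsmul, one_smul,
                zero_smul, Finset.sum_ite_eq', hk, if_true]
              exact hj') k hk
        simp only [hjk, if_true] at this
        omega
      rw [hz, mul_zero, sub_zero, hjk] at hdiff
      rw [← hdiff]
      simp
    · have hj1 : ∑ k ∈ s, j k • (b k).1 - (b k).1 =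
          ∑ i ∈ s, Function.update j k q i • (b i).1 := by
        rw [← Finset.add_sum_erase s (fun i => j i • (b i).1) hk, ← Finset.add_sum_erase s
          (fun i => Function.update j k q i • (b i).1) hk, Function.update_self, hjk, succ_nsmul,
          add_sub_right_comm, add_sub_cancel_right]
        congr 1
        exact Finset.sum_congr rfl fun i hi => by
          rw [Function.update_of_ne (Finset.ne_of_mem_erase hi)]
      have hjs := hsum j q hjk
      have e3 := ih _ (by omega) m (Function.update j k q) rfl
      rw [← Finset.mul_prod_erase _ _ hk, Function.update_self, hr] at e3
      have e4 : ∏ i ∈ s.erase k, mult (b i) ^ Function.update j k q i *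
          (Nat.multichoose (m i) (Function.update j k q i) : ℂ) =
          ∏ i ∈ s.erase k, mult (b i) ^ j i * (Nat.multichoose (m i) (j i) : ℂ) :=
        Finset.prod_congr rfl fun i hi => by
          rw [Function.update_of_ne (Finset.ne_of_mem_erase hi)]
      rw [hj1, e3, e4, hjk] at hdiff
      rw [eq_comm, sub_eq_iff_eq_add] at hdiff
      rw [hdiff, Nat.multichoose_succ_succ]
      push_cast
      ring

open Classical in
/-- The weighted partition function as a sum over the solutions in natural numbers. -/
theorem partitionFun_eq_finsum (hh : ∀ a, Pos a → 0 < h a) (N : ℕ) :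
    ∀ (b : Fin N → Weight Λ), (∀ i, Pos (b i).1) → ∀ l : Λ,
      {ξ : Fin N → ℕ | ∑ i, ξ i • (b i).1 = l}.Finite ∧
      partitionFun h (Finset.univ.val.map b) l =
        ∑ᶠ ξ : Fin N → ℕ, if ∑ i, ξ i • (b i).1 = l then ∏ i, mult (b i) ^ ξ i else 0 := by
  induction N with
  | zero =>
    intro b _ l
    refine ⟨Set.toFinite _, ?_⟩
    rw [finsum_unique]
    simp [partitionFun_zero, eq_comm]
  | succ N ih =>
    intro b hb l
    have hfin : {ξ : Fin (N + 1) → ℕ | ∑ i, ξ i • (b i).1 = l}.Finite := by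
      -- Each term of a solution has nonnegative height at most `h l`, which bounds every
      -- coordinate.
      have : ∀ i, ∃ K : ℕ, h l ≤ K • h (b i).1 := fun i => Archimedean.arch _ (hh _ (hb i))
      choose K hK using this
      refine (Set.finite_Iic K).subset fun ξ hξ i => ?_
      by_contra! hlt
      have h1 : h l = ∑ i, ξ i • h (b i).1 := by
        rw [← (show ∑ i, ξ i • (b i).1 = l from hξ)]
        simp
      have h2 : ξ i • h (b i).1 ≤ ∑ i, ξ i • h (b i).1 :=
        Finset.single_le_sum (fun i _ => nsmul_nonneg (hh _ (hb i)).le _) (Finset.mem_univ i)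
      have h3 : K i • h (b i).1 < ξ i • h (b i).1 := nsmul_lt_nsmul_left (hh _ (hb i)) hlt
      linarith [hK i]
    refine ⟨hfin, ?_⟩
    have hmap : Finset.univ.val.map b = b 0 ::ₘ Finset.univ.val.map (fun i => b (Fin.succ i)) := by
      rw [Fin.univ_succ]
      simp [Function.comp_def]
    have hb' : ∀ c ∈ Finset.univ.val.map (fun i => b (Fin.succ i)), Pos c.1 := by
      intro c hc
      obtain ⟨i, _, rfl⟩ := Multiset.mem_map.1 hc
      exact hb _
    set F : (Fin (N + 1) → ℕ) → ℂ := fun ξ =>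
      if ∑ i, ξ i • (b i).1 = l then ∏ i, mult (b i) ^ ξ i else 0 with hF
    have hFs : (Function.support F).Finite := hfin.subset fun ξ hξ => by
      by_contra h0
      exact hξ (if_neg h0)
    let E := Fin.consEquiv (fun _ : Fin (N + 1) => ℕ)
    have h1 : ∑ᶠ ξ, F ξ = ∑ᶠ p, F (E p) := (finsum_comp_equiv E).symm
    have hFs' : (Function.support fun p => F (E p)).Finite := by
      have : (Function.support fun p => F (E p)) = E ⁻¹' Function.support F := rfl
      rw [this]
      exact hFs.preimage E.injective.injOn
    have h2 : ∀ k : ℕ, ∑ᶠ ξ, F (E (k, ξ)) =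
        mult (b 0) ^ k * partitionFun h (Finset.univ.val.map (fun i => b (Fin.succ i)))
          (l - k • (b 0).1) := by
      intro k
      obtain ⟨hf, he⟩ := ih (fun i => b (Fin.succ i)) (fun i => hb _) (l - k • (b 0).1)
      rw [he, mul_finsum]
      refine finsum_congr fun ξ => ?_
      simp only [hF, E, Fin.consEquiv_apply, Fin.sum_univ_succ, Fin.prod_univ_succ, Fin.cons_zero,
        Fin.cons_succ, eq_sub_iff_add_eq, add_comm, mul_ite, mul_zero]
    obtain ⟨K₀, hK₀⟩ := partitionFun_cons hh (hb 0) hb' l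
    rw [h1, finsum_curry _ hFs', finsum_congr h2, hmap]
    obtain ⟨K, hK⟩ : ∃ K : ℕ, ∀ k ≥ K, partitionFun h (Finset.univ.val.map (fun i => b (Fin.succ i)))
          (l - k • (b 0).1) = 0 := by
      obtain ⟨M, hM⟩ := partitionFun_eq_zero_of_lt h (Finset.univ.val.map (fun i => b (Fin.succ i)))
      obtain ⟨K, hK⟩ := Archimedean.arch (h l - M + 1) (hh _ (hb 0))
      refine ⟨K, fun k hk => hM _ ?_⟩
      have h1 : K • h (b 0).1 ≤ k • h (b 0).1 := nsmul_le_nsmul_left (hh _ (hb 0)).le hk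
      rw [map_sub, map_nsmul]
      linarith
    rw [hK₀ (max K₀ K) (le_max_left _ _)]
    refine (finsum_eq_sum_of_support_subset _ fun k hk => ?_).symm
    rw [Finset.coe_range, Set.mem_Iio]
    by_contra! h0
    exact hk (by simp only [hK k ((le_max_right _ _).trans h0), mul_zero])

end PartitionFunction

/-! ### Formal exponentials and residues -/

section FormalResidues

open PowerSeries

/-- The power series of `e^{cX}`. -/
def expPS (c : ℂ) : PowerSeries ℂ := rescale c (PowerSeries.exp ℂ)

theorem coeff_expPS (c : ℂ) (k : ℕ) : coeff k (expPS c) = c ^ k / k.factorial := by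
  rw [expPS, coeff_rescale, coeff_exp]
  simp [div_eq_mul_inv]

theorem constantCoeff_expPS (c : ℂ) : constantCoeff (expPS c) = 1 := by
  rw [← coeff_zero_eq_constantCoeff_apply, coeff_expPS]
  simp

theorem expPS_add (c d : ℂ) : expPS (c + d) = expPS c * expPS d :=
  (exp_mul_exp_eq_exp_add c d).symm

theorem expPS_zero : expPS 0 = 1 := by
  ext k
  rw [coeff_expPS, coeff_one]
  split_ifs with h
  · simp [h]
  · simp [h]

theorem rescale_expPS (a c : ℂ) : rescale a (expPS c) = expPS (a * c) := by
  rw [expPS, rescale_rescale, mul_comm, expPS]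

theorem derivative_expPS (c : ℂ) : d⁄dX ℂ (expPS c) = C c * expPS c := by
  ext k
  rw [coeff_derivative, coeff_C_mul, coeff_expPS, coeff_expPS, Nat.factorial_succ]
  have h1 : (k.factorial : ℂ) ≠ 0 := by exact_mod_cast k.factorial_ne_zero
  have h2 : (k + 1 : ℂ) ≠ 0 := by exact_mod_cast k.succ_ne_zero
  push_cast
  field_simp
  ring

/-- The power series `(1 - e^{-X}) / X`. -/
def expQuot : PowerSeries ℂ := mk fun k => -(-1) ^ (k + 1) / (k + 1).factorial

theorem X_mul_expQuot : X * expQuot = 1 - expPS (-1) := by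
  ext k
  rcases k with _ | k
  · simp [constantCoeff_expPS]
  · rw [coeff_succ_X_mul, expQuot, coeff_mk, map_sub, coeff_expPS, coeff_one]
    simp [neg_div]

theorem constantCoeff_expQuot : constantCoeff expQuot = 1 := by
  rw [← coeff_zero_eq_constantCoeff_apply, expQuot, coeff_mk]
  simp

theorem expQuot_mul_inv : expQuot * expQuot⁻¹ = 1 :=
  PowerSeries.mul_inv_cancel _ (by rw [constantCoeff_expQuot]; exact one_ne_zero)

/-- The power series `e^{lX} (X / (1 - e^{-X}))^m`. -/
def toddPow (l : ℂ) (m : ℕ) : PowerSeries ℂ := expPS l * (expQuot⁻¹) ^ m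

/-- With Q = (1-e^(-X))/X, differentiating XQ = 1-e^(-X) gives Q + XQ' = 1 - XQ; this is the same
equation for 1/Q. -/
theorem X_mul_derivative_expQuot_inv :
    X * d⁄dX ℂ (expQuot⁻¹) = -(expQuot⁻¹) ^ 2 + X * expQuot⁻¹ + expQuot⁻¹ := by
  have h1 : expQuot + X * d⁄dX ℂ expQuot = 1 - X * expQuot := by
    have h2 : d⁄dX ℂ (X * expQuot) = d⁄dX ℂ (1 - expPS (-1)) := by rw [X_mul_expQuot]
    rw [Derivation.leibniz, map_sub, derivative_one, derivative_expPS, derivative_X] at h2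
    simp only [smul_eq_mul, mul_one, map_neg, map_one] at h2
    rw [X_mul_expQuot]
    linear_combination h2
  rw [derivative_inv']
  linear_combination (-(expQuot⁻¹) ^ 2) * h1 + (expQuot⁻¹ * X + expQuot⁻¹) * expQuot_mul_inv

theorem X_mul_derivative_toddPow (l : ℂ) (m : ℕ) :
    X * d⁄dX ℂ (toddPow l m) =
      C (m : ℂ) * toddPow l m + C (l + m) * (X * toddPow l m) - C (m : ℂ) * toddPow l (m + 1) := by
  unfold toddPow
  rw [Derivation.leibniz, derivative_expPS, derivative_pow]
  rcases m with _ | m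
  · simp only [smul_eq_mul]
    simp
    ring
  · simp only [smul_eq_mul, Nat.add_sub_cancel, map_add, map_natCast]
    push_cast
    linear_combination expPS l * ((m : PowerSeries ℂ) + 1) * (expQuot⁻¹) ^ m *
      X_mul_derivative_expQuot_inv

/-- In the coefficient of X^m of the differential equation, the term from X d/dX cancels the term `m
* toddPow l m`. Consequently [X^m] `toddPow l (m+1)` is the product of the (l+i)/i for 1 ≤ i ≤ m. -/
theorem toddPow_recurrence (l : ℂ) {m : ℕ} (hm : m ≠ 0) :
    (m : ℂ) * coeff m (toddPow l (m + 1)) = (l + m) * coeff (m - 1) (toddPow l m) := by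
  obtain ⟨k, rfl⟩ := Nat.exists_eq_succ_of_ne_zero hm
  have := congrArg (coeff (k + 1)) (X_mul_derivative_toddPow l (k + 1))
  rw [coeff_succ_X_mul, coeff_derivative, map_sub, map_add, coeff_C_mul, coeff_C_mul,
    coeff_C_mul, coeff_succ_X_mul] at this
  push_cast at this ⊢
  simp only [Nat.succ_eq_add_one]
  linear_combination this

theorem coeff_toddPow_one (l : ℂ) : coeff 0 (toddPow l 1) = 1 := by
  rw [coeff_zero_eq_constantCoeff_apply]
  simp [toddPow, constantCoeff_expQuot, constantCoeff_expPS]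

theorem coeff_toddPow_natCast (j m : ℕ) :
    coeff m (toddPow (j : ℂ) (m + 1)) = (Nat.multichoose (m + 1) j : ℂ) := by
  induction m with
  | zero => rw [zero_add, coeff_toddPow_one, Nat.multichoose_one, Nat.cast_one]
  | succ m ih =>
    have h := toddPow_recurrence (j : ℂ) m.succ_ne_zero
    rw [Nat.succ_eq_add_one, Nat.add_sub_cancel, ih] at h
    have h1 : ((m + 1 : ℕ) : ℂ) ≠ 0 := by exact_mod_cast m.succ_ne_zero
    apply mul_left_cancel₀ h1
    rw [h, Nat.multichoose_eq, Nat.multichoose_eq]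
    norm_cast
    have e1 : m + 1 + j - 1 = m + j := by omega
    have e2 : m + 1 + 1 + j - 1 = m + j + 1 := by omega
    rw [e1, e2]
    have h3 := Nat.add_one_mul_choose_eq (m + j) m
    have h4 : (m + j + 1).choose j = (m + j + 1).choose (m + 1) := by
      rw [← Nat.choose_symm_of_eq_add]; omega
    have h5 : (m + j).choose j = (m + j).choose m := by
      rw [← Nat.choose_symm_of_eq_add]; omega
    rw [h4, h5]
    linarith

/-- The recurrence has the factor `m - j`, zero at `m = j`, and the zero propagates to larger `m`.
-/
theorem coeff_toddPow_neg (j m : ℕ) (hj : j ≠ 0) (hjm : j ≤ m) :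
    coeff m (toddPow (-(j : ℂ)) (m + 1)) = 0 := by
  induction m, hjm using Nat.le_induction with
  | base =>
    have h := toddPow_recurrence (-(j : ℂ)) hj
    rw [neg_add_cancel, zero_mul] at h
    exact (mul_eq_zero.1 h).resolve_left (by exact_mod_cast hj)
  | succ m hm ih =>
    have h := toddPow_recurrence (-(j : ℂ)) m.succ_ne_zero
    rw [Nat.succ_eq_add_one, Nat.add_sub_cancel, ih, mul_zero] at h
    exact (mul_eq_zero.1 h).resolve_left (by exact_mod_cast m.succ_ne_zero)

end FormalResidues

/-! ### Laurent series with coefficients in a subalgebra -/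

section LaurentIn

variable {X : Type*} {𝒜 : Subalgebra ℂ (X → ℂ)}

/-- The Laurent series of `e^{ct}`. -/
def expLS (c : ℂ) : LaurentSeries ℂ := HahnSeries.ofPowerSeries ℤ ℂ (expPS c)

theorem expLS_add (c d : ℂ) : expLS (c + d) = expLS c * expLS d := by
  rw [expLS, expPS_add, map_mul, expLS, expLS]

/-- The family of Laurent series has poles of bounded order, and coefficients in `𝒜`. -/
def IsLaurentIn (𝒜 : Subalgebra ℂ (X → ℂ)) (G : X → LaurentSeries ℂ) : Prop :=
  ∃ (r : ℕ) (P : X → PowerSeries ℂ), (∀ k, (fun x => PowerSeries.coeff k (P x)) ∈ 𝒜) ∧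
    ∀ x, G x = HahnSeries.single (-r : ℤ) 1 * HahnSeries.ofPowerSeries ℤ ℂ (P x)

theorem IsLaurentIn.ofPowerSeries {P : X → PowerSeries ℂ}
    (hP : ∀ k, (fun x => PowerSeries.coeff k (P x)) ∈ 𝒜) :
    IsLaurentIn 𝒜 fun x => HahnSeries.ofPowerSeries ℤ ℂ (P x) :=
  ⟨0, P, hP, fun x => by simp [← HahnSeries.C_apply]⟩

theorem IsLaurentIn.mul {G H : X → LaurentSeries ℂ} (hG : IsLaurentIn 𝒜 G)
    (hH : IsLaurentIn 𝒜 H) : IsLaurentIn 𝒜 fun x => G x * H x := by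
  obtain ⟨r, P, hP, hG⟩ := hG
  obtain ⟨s, Q, hQ, hH⟩ := hH
  refine ⟨r + s, fun x => P x * Q x, fun k => ?_, fun x => ?_⟩
  · have : (fun x => PowerSeries.coeff k (P x * Q x)) = ∑ ij ∈ Finset.HasAntidiagonal.antidiagonal k,
        (fun x => PowerSeries.coeff ij.1 (P x)) * fun x => PowerSeries.coeff ij.2 (Q x) := by
      ext x
      simp [PowerSeries.coeff_mul]
    rw [this]
    exact Subalgebra.sum_mem _ fun ij _ => mul_mem (hP _) (hQ _)
  · simp only [hG, hH]
    rw [map_mul, mul_mul_mul_comm, HahnSeries.single_mul_single, one_mul]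
    congr 3
    push_cast
    ring

theorem IsLaurentIn.C (c : ℂ) : IsLaurentIn 𝒜 fun _ => HahnSeries.C c := by
  have := IsLaurentIn.ofPowerSeries (𝒜 := 𝒜) (P := fun _ => PowerSeries.C c) fun k => by
    exact Subalgebra.algebraMap_mem 𝒜 (PowerSeries.coeff k (PowerSeries.C c))
  simpa only [HahnSeries.ofPowerSeries_C] using this

theorem IsLaurentIn.one : IsLaurentIn 𝒜 fun _ => 1 := by
  simpa using IsLaurentIn.C (𝒜 := 𝒜) 1

theorem IsLaurentIn.multiset_prod {ι : Type*} (s : Multiset ι) {G : ι → X → LaurentSeries ℂ}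
    (h : ∀ i ∈ s, IsLaurentIn 𝒜 (G i)) : IsLaurentIn 𝒜 fun x => (s.map fun i => G i x).prod := by
  induction s using Multiset.induction_on with
  | empty => simpa using IsLaurentIn.one
  | cons a s ih =>
    simp only [Multiset.map_cons, Multiset.prod_cons]
    exact (h a (Multiset.mem_cons_self _ _)).mul
      (ih fun i hi => h i (Multiset.mem_cons_of_mem hi))

theorem IsLaurentIn.expLS {u : X → ℂ} (hu : u ∈ 𝒜) : IsLaurentIn 𝒜 fun x => expLS (u x) := by
  refine IsLaurentIn.ofPowerSeries fun k => ?_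
  have : (fun x => PowerSeries.coeff k (expPS (u x))) = ((k.factorial : ℂ)⁻¹) • u ^ k := by
    ext x
    simp [coeff_expPS, div_eq_inv_mul]
  rw [this]
  exact Subalgebra.smul_mem _ (pow_mem hu k) _

theorem IsLaurentIn.coeff_mem {G : X → LaurentSeries ℂ} (hG : IsLaurentIn 𝒜 G) (m : ℤ) :
    (fun x => (G x).coeff m) ∈ 𝒜 := by
  obtain ⟨r, P, hP, hG⟩ := hG
  have : ∀ x, (G x).coeff m = if m + r < 0 then 0 else PowerSeries.coeff (m + r).natAbs (P x) := by
    intro x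
    rw [hG, HahnSeries.coeff_single_mul, one_mul, sub_neg_eq_add, PowerSeries.coeff_coe]
  simp only [this]
  split_ifs
  · exact zero_mem _
  · exact hP _

/-- The Laurent series of `(1 - c e^{-ut})⁻¹`. -/
def geomLS (c u : ℂ) : LaurentSeries ℂ := (1 - HahnSeries.C c * expLS (-u))⁻¹

theorem one_sub_expLS_eq (u : ℂ) : 1 - expLS (-u) = HahnSeries.single (1 : ℤ) u *
    HahnSeries.ofPowerSeries ℤ ℂ (PowerSeries.rescale u expQuot) := by
  have h := congrArg (HahnSeries.ofPowerSeries ℤ ℂ) (congrArg (PowerSeries.rescale u) X_mul_expQuot)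
  rw [map_mul, map_mul, PowerSeries.rescale_X, map_sub, map_one, map_sub, map_one, rescale_expPS,
    mul_neg_one, map_mul, HahnSeries.ofPowerSeries_C, HahnSeries.ofPowerSeries_X] at h
  rw [expLS, ← h, HahnSeries.C_apply, HahnSeries.single_mul_single, zero_add, mul_one]

theorem geomLS_one {u : ℂ} (hu : u ≠ 0) : geomLS 1 u = HahnSeries.single (-1 : ℤ) u⁻¹ *
    HahnSeries.ofPowerSeries ℤ ℂ (PowerSeries.rescale u expQuot⁻¹) := by
  rw [geomLS, map_one, one_mul, one_sub_expLS_eq]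
  refine inv_eq_of_mul_eq_one_right ?_
  rw [mul_mul_mul_comm, HahnSeries.single_mul_single, ← map_mul, ← map_mul, expQuot_mul_inv, map_one,
    map_one, mul_inv_cancel₀ hu]
  simp

theorem rescale_C (a c : ℂ) : PowerSeries.rescale a (PowerSeries.C c) = PowerSeries.C c := by
  ext k
  rw [PowerSeries.coeff_rescale, PowerSeries.coeff_C]
  split_ifs with h
  · simp [h]
  · simp

/-- For `c ≠ 1` the constant term `1 - c` is invertible and there is no pole. One series `Q`,
rescaled, works for all `u`, so its coefficients are polynomial in `u`. -/
theorem exists_geomLS_eq {c : ℂ} (hc : c ≠ 1) : ∃ Q : PowerSeries ℂ, ∀ u : ℂ,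
    (1 - HahnSeries.C c * expLS (-u)) *
      HahnSeries.ofPowerSeries ℤ ℂ (PowerSeries.rescale u Q) = 1 := by
  refine ⟨(1 - PowerSeries.C c * expPS (-1))⁻¹, fun u => ?_⟩
  have h := PowerSeries.mul_inv_cancel (1 - PowerSeries.C c * expPS (-1)) (by
    rw [map_sub, map_mul, constantCoeff_expPS]
    simpa [sub_eq_zero] using hc.symm)
  have h := congrArg (HahnSeries.ofPowerSeries ℤ ℂ) (congrArg (PowerSeries.rescale u) h)
  rw [map_mul, map_mul, map_sub, map_mul, rescale_expPS, mul_neg_one, map_one, map_one, map_sub,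
    map_one, map_mul, rescale_C, HahnSeries.ofPowerSeries_C] at h
  exact h

theorem one_sub_mul_expLS_ne_zero {c u : ℂ} (h : c = 1 → u ≠ 0) :
    1 - HahnSeries.C c * expLS (-u) ≠ 0 := by
  by_cases hc : c = 1
  · intro h0
    subst hc
    have h1 := geomLS_one (h rfl)
    rw [geomLS, h0, inv_zero] at h1
    have h2 := one_sub_expLS_eq u
    rw [map_one, one_mul] at h0
    rw [h0] at h2
    have h3 := congrArg (fun F => HahnSeries.coeff F 1) h2
    rw [HahnSeries.coeff_single_mul, sub_self] at h3
    have h4 := LaurentSeries.coeff_coe_powerSeries (PowerSeries.rescale u expQuot) 0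
    rw [PowerSeries.coeff_rescale, PowerSeries.coeff_zero_eq_constantCoeff_apply,
      constantCoeff_expQuot] at h4
    rw [Nat.cast_zero] at h4
    rw [h4] at h3
    exact h rfl (by simpa using h3.symm)
  · obtain ⟨Q, hQ⟩ := exists_geomLS_eq hc
    exact left_ne_zero_of_mul_eq_one (hQ u)

/-- Only a factor with `c = 1` requires the inverse of `u`. This restricts the negative exponents in
a residue to the forms that are polar at the given character. -/
theorem IsLaurentIn.geomLS {c : ℂ} {u : X → ℂ} (hu : u ∈ 𝒜)
    (h : c = 1 → (∀ x, u x ≠ 0) ∧ (fun x => (u x)⁻¹) ∈ 𝒜) :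
    IsLaurentIn 𝒜 fun x => geomLS c (u x) := by
  have hres : ∀ Q : PowerSeries ℂ, IsLaurentIn 𝒜 fun x =>
      HahnSeries.ofPowerSeries ℤ ℂ (PowerSeries.rescale (u x) Q) := by
    intro Q
    refine IsLaurentIn.ofPowerSeries fun k => ?_
    have : (fun x => PowerSeries.coeff k (PowerSeries.rescale (u x) Q)) =
        PowerSeries.coeff k Q • u ^ k := by
      ext x
      simp [PowerSeries.coeff_rescale, mul_comm]
    rw [this]
    exact Subalgebra.smul_mem _ (pow_mem hu k) _
  by_cases hc : c = 1
  · subst hc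
    obtain ⟨h0, hinv⟩ := h rfl
    have h1 : IsLaurentIn 𝒜 fun x => HahnSeries.single (-1 : ℤ) (u x)⁻¹ := by
      refine ⟨1, fun x => PowerSeries.C (u x)⁻¹, fun k => ?_, fun x => ?_⟩
      · simp only [PowerSeries.coeff_C]
        split_ifs
        · exact hinv
        · exact zero_mem _
      · rw [HahnSeries.ofPowerSeries_C, HahnSeries.C_apply, HahnSeries.single_mul_single]
        simp
    have h2 := h1.mul (hres expQuot⁻¹)
    convert h2 using 2 with x
    exact geomLS_one (h0 x)
  · obtain ⟨Q, hQ⟩ := exists_geomLS_eq hc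
    convert hres Q using 2 with x
    exact inv_eq_of_mul_eq_one_right (hQ (u x))

theorem expLS_mul_geomLS_pow {l : ℝ} {u : ℂ} (hu : u ≠ 0) (m : ℕ) :
    expLS (l * u) * geomLS 1 u ^ m = HahnSeries.single (-m : ℤ) (u⁻¹ ^ m) *
      HahnSeries.ofPowerSeries ℤ ℂ (PowerSeries.rescale u (toddPow l m)) := by
  rw [geomLS_one hu, mul_pow, HahnSeries.single_pow, toddPow, map_mul (PowerSeries.rescale u),
    rescale_expPS, map_pow (PowerSeries.rescale u), map_mul (HahnSeries.ofPowerSeries ℤ ℂ),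
    map_pow (HahnSeries.ofPowerSeries ℤ ℂ), expLS, mul_comm (l : ℂ) u, nsmul_eq_mul, mul_neg_one,
    mul_left_comm]

/-- Each factor is u^(-m) times a series in ut with fixed coefficients, so a coefficient of the
product is a combination of Laurent monomials in the `u k`. -/
theorem coeff_prod_expLS_mul_geomLS_pow {κ : Type*} [Fintype κ] [DecidableEq κ] (l : κ → ℝ)
    {u : κ → ℂ} (hu : ∀ k, u k ≠ 0) (m : κ → ℕ) {d : ℤ} {D : ℕ} (hd : (D : ℤ) = d + ∑ k, (m k : ℤ)) :
    (∏ k, (expLS (l k * u k) * geomLS 1 (u k) ^ m k)).coeff d =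
      ∑ i ∈ Finset.finsuppAntidiag Finset.univ D,
        (∏ k, PowerSeries.coeff (i k) (toddPow (l k) (m k))) * ∏ k, u k ^ ((i k : ℤ) - m k) := by
  have h1 : ∏ k, (expLS (l k * u k) * geomLS 1 (u k) ^ m k) =
      HahnSeries.single (-∑ k, (m k : ℤ)) (∏ k, (u k)⁻¹ ^ m k) * HahnSeries.ofPowerSeries ℤ ℂ
        (∏ k, PowerSeries.rescale (u k) (toddPow (l k) (m k))) := by
    rw [Finset.prod_congr rfl fun k _ => expLS_mul_geomLS_pow (hu k) (m k), Finset.prod_mul_distrib,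
      map_prod (HahnSeries.ofPowerSeries ℤ ℂ)]
    congr 1
    have : ∀ s : Finset κ, ∏ k ∈ s, HahnSeries.single (-(m k : ℤ)) ((u k)⁻¹ ^ m k) =
        HahnSeries.single (-∑ k ∈ s, (m k : ℤ)) (∏ k ∈ s, (u k)⁻¹ ^ m k) := by
      intro s
      induction s using Finset.induction_on with
      | empty => simp
      | insert a s ha ih =>
        rw [Finset.prod_insert ha, ih, HahnSeries.single_mul_single, Finset.sum_insert ha,
          Finset.prod_insert ha, neg_add]
    exact this Finset.univ
  rw [h1, HahnSeries.coeff_single_mul, sub_neg_eq_add, ← hd, LaurentSeries.coeff_coe_powerSeries,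
    PowerSeries.coeff_prod, Finset.mul_sum]
  refine Finset.sum_congr rfl fun i _ => ?_
  simp only [PowerSeries.coeff_rescale]
  rw [← Finset.prod_mul_distrib, ← Finset.prod_mul_distrib]
  refine Finset.prod_congr rfl fun k _ => ?_
  rw [zpow_sub₀ (hu k), zpow_natCast, zpow_natCast, inv_pow]
  field_simp

end LaurentIn

/-! ### The dual lattice and its characters -/

section Lattice

variable {V : Type*} [NormedAddCommGroup V] [NormedSpace ℝ V] [FiniteDimensional ℝ V]
  {Γ : Submodule ℤ V}

theorem intCast_smul_form (k : ℤ) (l : StrongDual ℝ V) : (k : ℝ) • l = k • l :=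
  Int.cast_smul_eq_zsmul ℝ k l

/-- Dual bases of a lattice and of the dual lattice. -/
structure IsDualPair (Γ : Submodule ℤ V) (e : Module.Basis (Fin (Module.finrank ℝ V)) ℝ (StrongDual ℝ V))
    (γ : Module.Basis (Fin (Module.finrank ℝ V)) ℝ V) : Prop where
  apply_eq : ∀ i j, e i (γ j) = if i = j then 1 else 0
  mem_dualLattice : ∀ l, l ∈ dualLattice Γ ↔ ∀ j, ∃ k : ℤ, l (γ j) = k
  mem_lattice : ∀ x, x ∈ Γ ↔ ∀ j, ∃ k : ℤ, e j x = k

theorem exists_isDualPair (Γ : Submodule ℤ V) [DiscreteTopology Γ] [IsZLattice ℝ Γ] :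
    ∃ e γ, IsDualPair Γ e γ := by
  have : Module.Free ℤ Γ := ZLattice.module_free ℝ Γ
  have : Module.Finite ℤ Γ := ZLattice.module_finite ℝ Γ
  let b := Module.finBasisOfFinrankEq ℤ Γ (ZLattice.rank ℝ Γ)
  let γ := b.ofZLatticeBasis ℝ Γ
  have hspan : Submodule.span ℤ (Set.range γ) = Γ := b.ofZLatticeBasis_span ℝ
  let e := γ.dualBasis.map (LinearMap.toContinuousLinearMap (𝕜 := ℝ) (E := V) (F' := ℝ))
  have he : ∀ i j, e i (γ j) = if i = j then 1 else 0 := by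
    intro i j
    have h1 : e i (γ j) = γ.dualBasis i (γ j) := by
      simp [e]
    rw [h1, Module.Basis.dualBasis_apply_self]
    simp [eq_comm]
  refine ⟨e, γ, he, fun l => ⟨fun h j => h _ ?_, fun h x hx => ?_⟩, fun x => ⟨fun hx => ?_, fun h => ?_⟩⟩
  · rw [← hspan]
    exact Submodule.subset_span ⟨j, rfl⟩
  · rw [← hspan] at hx
    induction hx using Submodule.span_induction with
    | mem x hx => obtain ⟨j, rfl⟩ := hx; exact h j
    | zero => exact ⟨0, by simp⟩
    | add x y _ _ hx hy =>
      obtain ⟨a, ha⟩ := hx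
      obtain ⟨b, hb⟩ := hy
      exact ⟨a + b, by simp [ha, hb]⟩
    | smul c x _ hx =>
      obtain ⟨a, ha⟩ := hx
      exact ⟨c * a, by simp [ha]⟩
  · rw [← hspan] at hx
    induction hx using Submodule.span_induction with
    | mem x hx =>
      obtain ⟨i, rfl⟩ := hx
      exact fun j => ⟨if j = i then 1 else 0, by rw [he]; split_ifs <;> simp⟩
    | zero => exact fun j => ⟨0, by simp⟩
    | add x y _ _ hx hy =>
      intro j
      obtain ⟨a, ha⟩ := hx j
      obtain ⟨b, hb⟩ := hy j
      exact ⟨a + b, by simp [ha, hb]⟩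
    | smul c x _ hx =>
      intro j
      obtain ⟨a, ha⟩ := hx j
      exact ⟨c * a, by simp [ha]⟩
  · choose k hk using h
    rw [eq_sum_apply_smul he x, ← hspan]
    refine Submodule.sum_mem _ fun j _ => ?_
    rw [hk, Int.cast_smul_eq_zsmul ℝ]
    exact Submodule.smul_mem _ _ (Submodule.subset_span ⟨j, rfl⟩)

theorem IsDualPair.closure_range {e : Module.Basis (Fin (Module.finrank ℝ V)) ℝ (StrongDual ℝ V)} {γ : Module.Basis (Fin (Module.finrank ℝ V)) ℝ V}
    (h : IsDualPair Γ e γ) : AddSubgroup.closure (Set.range e) = dualLattice Γ := by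
  refine le_antisymm ((AddSubgroup.closure_le _).2 ?_) fun l hl => ?_
  · rintro _ ⟨i, rfl⟩
    rw [SetLike.mem_coe, h.mem_dualLattice]
    exact fun j => ⟨if i = j then 1 else 0, by rw [h.apply_eq]; split_ifs <;> simp⟩
  · choose k hk using (h.mem_dualLattice l).1 hl
    rw [form_eq_sum_apply_smul h.apply_eq l]
    refine AddSubgroup.sum_mem _ fun j _ => ?_
    rw [hk, intCast_smul_form]
    exact AddSubgroup.zsmul_mem _ (AddSubgroup.subset_closure (Set.mem_range_self j)) _

/-- `volDual` uses a basis of `Γ*` obtained by choice. For that basis to be half of a dual pair, `Γ`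
must be recovered as the set of vectors on which it is integral; this is biduality, taken from
another dual pair. -/
theorem exists_isDualPair_of_closure_range [DiscreteTopology Γ] [IsZLattice ℝ Γ]
    {e : Module.Basis (Fin (Module.finrank ℝ V)) ℝ (StrongDual ℝ V)}
    (he : AddSubgroup.closure (Set.range e) = dualLattice Γ) : ∃ γ, IsDualPair Γ e γ := by
  obtain ⟨γ, hγ⟩ := exists_dual_basis e
  obtain ⟨e₀, γ₀, h₀⟩ := exists_isDualPair Γ
  have hmem : ∀ i, e i ∈ dualLattice Γ := fun i => he ▸ AddSubgroup.subset_closure ⟨i, rfl⟩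
  refine ⟨γ, hγ, fun l => ⟨fun hl => ?_, fun hl => ?_⟩, fun x => ⟨fun hx i => hmem i x hx, fun hx => ?_⟩⟩
  · rw [← he] at hl
    induction hl using AddSubgroup.closure_induction with
    | mem l hl =>
      obtain ⟨i, rfl⟩ := hl
      exact fun j => ⟨if i = j then 1 else 0, by rw [hγ]; split_ifs <;> simp⟩
    | zero => exact fun j => ⟨0, by simp⟩
    | add x y _ _ hx hy =>
      intro j
      obtain ⟨a, ha⟩ := hx j
      obtain ⟨b, hb⟩ := hy j
      exact ⟨a + b, by simp [ha, hb]⟩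
    | neg x _ hx =>
      intro j
      obtain ⟨a, ha⟩ := hx j
      exact ⟨-a, by simp [ha]⟩
  · choose k hk using hl
    rw [form_eq_sum_apply_smul hγ l]
    refine AddSubgroup.sum_mem _ fun j _ => ?_
    rw [hk, intCast_smul_form]
    exact AddSubgroup.zsmul_mem _ (hmem j) _
  · have hint : ∀ l ∈ dualLattice Γ, ∃ k : ℤ, l x = k := by
      intro l hl
      rw [← he] at hl
      induction hl using AddSubgroup.closure_induction with
      | mem l hl => obtain ⟨i, rfl⟩ := hl; exact hx i
      | zero => exact ⟨0, by simp⟩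
      | add x y _ _ hx hy =>
        obtain ⟨a, ha⟩ := hx
        obtain ⟨b, hb⟩ := hy
        exact ⟨a + b, by simp [ha, hb]⟩
      | neg x _ hx =>
        obtain ⟨a, ha⟩ := hx
        exact ⟨-a, by simp [ha]⟩
    exact (h₀.mem_lattice x).2 fun j => hint _ (h₀.closure_range ▸ AddSubgroup.subset_closure ⟨j, rfl⟩)

/-- There are dual bases of the lattice and the dual lattice for which the volume on the dual space is
the Haar measure of the basis. -/
theorem exists_isDualPair_volDual (Γ : Submodule ℤ V) [DiscreteTopology Γ] [IsZLattice ℝ Γ] :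
    ∃ e γ, IsDualPair Γ e γ ∧ ∀ σ : Fin (Module.finrank ℝ V) → StrongDual ℝ V,
      ((volDual Γ) (parallelepiped σ)).toReal = |e.det σ| := by
  have hex : ∃ e : Module.Basis (Fin (Module.finrank ℝ V)) ℝ (StrongDual ℝ V),
      AddSubgroup.closure (Set.range e) = dualLattice Γ := by
    obtain ⟨e, γ, h⟩ := exists_isDualPair Γ
    exact ⟨e, h.closure_range⟩
  obtain ⟨γ, hγ⟩ := exists_isDualPair_of_closure_range hex.choose_spec
  refine ⟨hex.choose, γ, hγ, fun σ => ?_⟩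
  rw [volDual, dif_pos hex, MeasureTheory.Measure.addHaar_parallelepiped, ENNReal.toReal_ofReal (abs_nonneg _)]

variable {e : Module.Basis (Fin (Module.finrank ℝ V)) ℝ (StrongDual ℝ V)} {γ : Module.Basis (Fin (Module.finrank ℝ V)) ℝ V}

theorem IsDualPair.basis_mem (h : IsDualPair Γ e γ) (i : Fin (Module.finrank ℝ V)) : e i ∈ dualLattice Γ :=
  h.closure_range ▸ AddSubgroup.subset_closure ⟨i, rfl⟩

theorem linearIndependent_int_of_real {ι : Type*} {σ : ι → dualLattice Γ}
    (hσ : LinearIndependent ℝ fun k => (σ k : StrongDual ℝ V)) : LinearIndependent ℤ σ := by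
  have h1 : LinearIndependent ℤ fun k => (σ k : StrongDual ℝ V) :=
    hσ.restrict_scalars (fun a b hab => by simpa using hab)
  exact LinearIndependent.of_comp ((dualLattice Γ).subtype.toIntLinearMap) h1

/-- The integral basis of the dual lattice. -/
def IsDualPair.intBasis (h : IsDualPair Γ e γ) : Module.Basis (Fin (Module.finrank ℝ V)) ℤ (dualLattice Γ) :=
  Module.Basis.mk (v := fun i => (⟨e i, h.basis_mem i⟩ : dualLattice Γ))
    (linearIndependent_int_of_real e.linearIndependent) (by
      rintro ⟨l, hl⟩ -
      choose k hk using (h.mem_dualLattice l).1 hl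
      have : (⟨l, hl⟩ : dualLattice Γ) = ∑ j, k j • ⟨e j, h.basis_mem j⟩ := by
        apply Subtype.ext
        rw [AddSubgroup.val_finsetSum]
        refine (form_eq_sum_apply_smul h.apply_eq l).trans ?_
        refine Finset.sum_congr rfl fun j _ => ?_
        rw [hk, intCast_smul_form]
        rfl
      rw [this]
      exact Submodule.sum_mem _ fun j _ => Submodule.smul_mem _ _ (Submodule.subset_span ⟨j, rfl⟩))

theorem IsDualPair.intBasis_apply (h : IsDualPair Γ e γ) (i : Fin (Module.finrank ℝ V)) :
    (h.intBasis i : StrongDual ℝ V) = e i := by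
  simp [IsDualPair.intBasis]

theorem IsDualPair.repr_eq (h : IsDualPair Γ e γ) (l : dualLattice Γ) (i : Fin (Module.finrank ℝ V)) :
    e.repr (l : StrongDual ℝ V) i = h.intBasis.repr l i := by
  have h1 : (l : StrongDual ℝ V) = ∑ j, (h.intBasis.repr l j : ℝ) • e j := by
    conv_lhs => rw [← h.intBasis.sum_repr l, AddSubgroup.val_finsetSum]
    refine Finset.sum_congr rfl fun j _ => ?_
    rw [AddSubgroupClass.coe_zsmul, h.intBasis_apply, intCast_smul_form]
  rw [h1, e.repr_sum_self]

theorem IsDualPair.det_eq (h : IsDualPair Γ e γ) (σ : Fin (Module.finrank ℝ V) → dualLattice Γ) :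
    e.det (fun k => (σ k : StrongDual ℝ V)) = h.intBasis.det σ := by
  rw [Module.Basis.det_apply, Module.Basis.det_apply, Int.cast_det]
  congr 1
  ext i j
  simp [Module.Basis.toMatrix_apply, h.repr_eq]

theorem linearIndependent_real_of_int (h : IsDualPair Γ e γ) {ι : Type*} {σ : ι → dualLattice Γ}
    (hσ : LinearIndependent ℤ σ) : LinearIndependent ℝ fun k => (σ k : StrongDual ℝ V) := by
  have h1 : LinearIndependent ℤ (fun k => h.intBasis.equivFun (σ k)) :=
    hσ.map' h.intBasis.equivFun.toLinearMap (LinearEquiv.ker _)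
  have h2 : LinearIndependent ℝ (fun k => (fun i => (h.intBasis.equivFun (σ k) i : ℝ))) :=
    (linearIndependent_algebraMap_comp_iff (R := ℤ) (S := ℝ)).2 h1
  refine LinearIndependent.of_comp e.equivFun.toLinearMap ?_
  convert h2 using 1
  ext k i
  simp [h.repr_eq]

/-- The character of the dual lattice defined by a point. -/
def charOf (Γ : Submodule ℤ V) (p : VC V) : AddChar (dualLattice Γ) ℂ where
  toFun l := Complex.exp (-pair (l : StrongDual ℝ V) p)
  map_zero_eq_one' := by simp [pair_zero]
  map_add_eq_mul' a b := by
    rw [AddSubgroup.coe_add, pair_add, neg_add, Complex.exp_add]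

theorem charOf_apply (p : VC V) (l : dualLattice Γ) :
    charOf Γ p l = Complex.exp (-pair (l : StrongDual ℝ V) p) := rfl

theorem char_sum {ι : Type*} (χ : AddChar (dualLattice Γ) ℂ) (s : Finset ι) (f : ι → dualLattice Γ) :
    χ (∑ k ∈ s, f k) = ∏ k ∈ s, χ (f k) := by
  classical
  induction s using Finset.induction_on with
  | empty => simp
  | insert a s ha ih => rw [Finset.sum_insert ha, Finset.prod_insert ha, AddChar.map_add_eq_mul, ih]

theorem IsDualPair.char_ext (h : IsDualPair Γ e γ) {χ ψ : AddChar (dualLattice Γ) ℂ}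
    (hχ : ∀ i, χ (h.intBasis i) = ψ (h.intBasis i)) : χ = ψ := by
  ext l
  rw [← h.intBasis.sum_repr l, char_sum, char_sum]
  refine Finset.prod_congr rfl fun j _ => ?_
  rw [AddChar.map_zsmul_eq_zpow, AddChar.map_zsmul_eq_zpow, hχ]

theorem exists_pair_eq {σ : Fin (Module.finrank ℝ V) → StrongDual ℝ V} (hσ : LinearIndependent ℝ σ) (ζ : Fin (Module.finrank ℝ V) → ℂ) :
    ∃ p : VC V, ∀ k, pair (σ k) p = ζ k := by
  obtain ⟨u, hu⟩ := exists_dual_basis (tupleBasis σ hσ)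
  refine ⟨∑ j, ζ j ⊗ₜ[ℝ] u j, fun k => ?_⟩
  have := pair_sum_tmul hu ζ k
  rwa [coe_tupleBasis] at this

theorem exists_charOf_eq {σ : Fin (Module.finrank ℝ V) → dualLattice Γ}
    (hσ : LinearIndependent ℝ fun k => (σ k : StrongDual ℝ V)) {x : Fin (Module.finrank ℝ V) → ℂ} (hx : ∀ k, x k ≠ 0) :
    ∃ p : VC V, ∀ k, charOf Γ p (σ k) = x k := by
  obtain ⟨p, hp⟩ := exists_pair_eq hσ fun k => -Complex.log (x k)
  exact ⟨p, fun k => by rw [charOf_apply, hp, neg_neg, Complex.exp_log (hx k)]⟩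

theorem char_ne_zero (χ : AddChar (dualLattice Γ) ℂ) (l : dualLattice Γ) : χ l ≠ 0 := by
  intro h
  have := AddChar.map_add_eq_mul χ l (-l)
  rw [h, zero_mul, add_neg_cancel, AddChar.map_zero_eq_one] at this
  exact one_ne_zero this

theorem IsDualPair.charOf_surjective (h : IsDualPair Γ e γ) : Function.Surjective (charOf Γ) := by
  intro χ
  have hli : LinearIndependent ℝ fun k => ((h.intBasis k : dualLattice Γ) : StrongDual ℝ V) := by
    simpa only [h.intBasis_apply] using e.linearIndependent
  obtain ⟨p, hp⟩ := exists_charOf_eq hli (x := fun k => χ (h.intBasis k)) fun k => char_ne_zero _ _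
  exact ⟨p, h.char_ext hp⟩

/-- Equality on the basis of `Γ*` means that the coordinates differ by elements of `2πiℤ`, that is,
that the points differ by `2πiΓ`. Poles can thus be counted as characters. -/
theorem IsDualPair.charOf_eq_iff (h : IsDualPair Γ e γ) {p q : VC V} :
    charOf Γ p = charOf Γ q ↔ EquivMod Γ p q := by
  constructor
  · intro heq
    have h1 : ∀ j, ∃ k : ℤ, pair (e j) p = pair (e j) q + k * (2 * Real.pi * Complex.I) := by
      intro j
      have := DFunLike.congr_fun heq (h.intBasis j)
      rw [charOf_apply, charOf_apply, h.intBasis_apply, Complex.exp_neg, Complex.exp_neg,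
        inv_inj] at this
      exact Complex.exp_eq_exp_iff_exists_int.1 this
    choose k hk using h1
    refine ⟨∑ j, (k j : ℝ) • γ j, (h.mem_lattice _).2 fun j => ⟨k j, ?_⟩, eq_of_pair_eq e fun j => ?_⟩
    · simp [h.apply_eq]
    · rw [map_sub, hk, pair_tmul]
      simp [h.apply_eq]
      ring
  · rintro ⟨x, hx, hpq⟩
    ext l
    obtain ⟨k, hk⟩ := l.2 x hx
    rw [charOf_apply, charOf_apply, Complex.exp_neg, Complex.exp_neg, inv_inj,
      Complex.exp_eq_exp_iff_exists_int]
    refine ⟨k, ?_⟩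
    rw [← sub_eq_iff_eq_add', ← map_sub, hpq, pair_tmul, hk]
    push_cast
    ring

/-- The characters with given values on a tuple of elements of the dual lattice. -/
def charsWith (σ : Fin (Module.finrank ℝ V) → dualLattice Γ) (x : Fin (Module.finrank ℝ V) → ℂ) : Set (AddChar (dualLattice Γ) ℂ) :=
  {χ | ∀ k, χ (σ k) = x k}

theorem IsDualPair.card_quotient (h : IsDualPair Γ e γ) {σ : Fin (Module.finrank ℝ V) → dualLattice Γ}
    (hσ : LinearIndependent ℝ fun k => (σ k : StrongDual ℝ V)) :
    (Nat.card (dualLattice Γ ⧸ Submodule.span ℤ (Set.range σ)) : ℝ) =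
      |e.det fun k => (σ k : StrongDual ℝ V)| := by
  have : Module.Free ℤ (dualLattice Γ) := Module.Free.of_basis h.intBasis
  have : Module.Finite ℤ (dualLattice Γ) := Module.Finite.of_basis h.intBasis
  have h1 := Submodule.natAbs_det_basis_change h.intBasis (Submodule.span ℤ (Set.range σ))
    (Module.Basis.span (linearIndependent_int_of_real hσ))
  have h2 : ((↑) ∘ ⇑(Module.Basis.span (linearIndependent_int_of_real hσ)) : Fin (Module.finrank ℝ V) → dualLattice Γ) = σ := by
    ext1 k
    exact congrArg Subtype.val (Module.Basis.span_apply (linearIndependent_int_of_real hσ) k)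
  rw [h2] at h1
  rw [h.det_eq, ← Int.cast_abs, ← Int.natCast_natAbs, Int.cast_natCast, h1]

theorem IsDualPair.det_ne_zero {σ : Fin (Module.finrank ℝ V) → StrongDual ℝ V} (hσ : LinearIndependent ℝ σ) :
    e.det σ ≠ 0 := by
  have := e.isUnit_det (tupleBasis σ hσ)
  rw [coe_tupleBasis] at this
  exact this.ne_zero

/-- These characters are the multiples of one of them by the characters of the finite quotient of
`Γ*` by the span of `σ`, whose order is |det|. Orthogonality gives both sums. -/
theorem IsDualPair.finsum_charsWith (h : IsDualPair Γ e γ) {σ : Fin (Module.finrank ℝ V) → dualLattice Γ}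
    (hσ : LinearIndependent ℝ fun k => (σ k : StrongDual ℝ V)) {x : Fin (Module.finrank ℝ V) → ℂ} (hx : ∀ k, x k ≠ 0) :
    (charsWith σ x).Finite ∧
      (∀ l ∉ Submodule.span ℤ (Set.range σ), ∑ᶠ χ ∈ charsWith σ x, χ l = 0) ∧
      ∀ j : Fin (Module.finrank ℝ V) → ℤ, ∑ᶠ χ ∈ charsWith σ x, χ (∑ k, j k • σ k) =
        (|e.det fun k => (σ k : StrongDual ℝ V)| : ℝ) * ∏ k, x k ^ j k := by
  classical
  set N := Submodule.span ℤ (Set.range σ) with hN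
  obtain ⟨p, hp⟩ := exists_charOf_eq hσ hx
  set χ₀ := charOf Γ p
  have hcard := h.card_quotient hσ
  have hfin : Finite (dualLattice Γ ⧸ N) := by
    refine Nat.finite_of_card_ne_zero fun h0 => ?_
    rw [h0, Nat.cast_zero, eq_comm, abs_eq_zero] at hcard
    exact IsDualPair.det_ne_zero hσ hcard
  have : Fintype (dualLattice Γ ⧸ N) := Fintype.ofFinite _
  let T : AddChar (dualLattice Γ ⧸ N) ℂ → AddChar (dualLattice Γ) ℂ := fun ψ =>
    χ₀ * ψ.compAddMonoidHom N.mkQ.toAddMonoidHom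
  have hTapply : ∀ ψ l, T ψ l = χ₀ l * ψ (Submodule.Quotient.mk l) := fun ψ l => rfl
  have hTinj : Function.Injective T := by
    intro ψ ψ' hψ
    ext q
    obtain ⟨l, rfl⟩ := Submodule.Quotient.mk_surjective N q
    have := DFunLike.congr_fun hψ l
    rw [hTapply, hTapply] at this
    exact mul_left_cancel₀ (char_ne_zero χ₀ l) this
  have hrange : charsWith σ x = Set.range T := by
    ext χ
    constructor
    · intro hχ
      have hker : ∀ l ∈ N, χ l = χ₀ l := by
        intro l hl
        induction hl using Submodule.span_induction with
        | mem l hl => obtain ⟨k, rfl⟩ := hl; rw [hχ k, hp k]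
        | zero => rw [AddChar.map_zero_eq_one, AddChar.map_zero_eq_one]
        | add a b _ _ ha hb => rw [AddChar.map_add_eq_mul, AddChar.map_add_eq_mul, ha, hb]
        | smul c a _ ha => rw [AddChar.map_zsmul_eq_zpow, AddChar.map_zsmul_eq_zpow, ha]
      -- Two characters with the same values on `σ` agree on the sublattice, so their ratio descends
      -- to the quotient.
      have hdiv : ∀ a b, (Submodule.Quotient.mk a : dualLattice Γ ⧸ N) = Submodule.Quotient.mk b →
          χ a / χ₀ a = χ b / χ₀ b := by
        intro a b hab
        have h1 := hker _ ((Submodule.Quotient.eq N).1 hab)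
        have h2 : a = (a - b) + b := by abel
        rw [h2, AddChar.map_add_eq_mul, AddChar.map_add_eq_mul, h1,
          mul_div_mul_left _ _ (char_ne_zero χ₀ _)]
      have hout : ∀ q : dualLattice Γ ⧸ N, Submodule.Quotient.mk (Quotient.out q) = q :=
        fun q => Quotient.out_eq' q
      let ψ : AddChar (dualLattice Γ ⧸ N) ℂ :=
        { toFun := fun q => χ (Quotient.out q) / χ₀ (Quotient.out q)
          map_zero_eq_one' := by
            rw [hdiv _ 0 (by rw [hout, Submodule.Quotient.mk_zero]), AddChar.map_zero_eq_one,
              AddChar.map_zero_eq_one, div_one]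
          map_add_eq_mul' := fun a b => by
            rw [hdiv _ (Quotient.out a + Quotient.out b)
              (by rw [hout, Submodule.Quotient.mk_add, hout, hout]), AddChar.map_add_eq_mul,
              AddChar.map_add_eq_mul, mul_div_mul_comm] }
      refine ⟨ψ, ?_⟩
      ext l
      rw [hTapply]
      have : ψ (Submodule.Quotient.mk l) = χ l / χ₀ l := hdiv _ _ (hout _)
      rw [this, mul_div_cancel₀ _ (char_ne_zero χ₀ l)]
    · rintro ⟨ψ, rfl⟩ k
      have : (Submodule.Quotient.mk (σ k) : dualLattice Γ ⧸ N) = 0 :=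
        (Submodule.Quotient.mk_eq_zero N).2 (Submodule.subset_span ⟨k, rfl⟩)
      rw [hTapply, hp, this, AddChar.map_zero_eq_one, mul_one]
  have hsum : ∀ l, ∑ᶠ χ ∈ charsWith σ x, χ l =
      χ₀ l * if (Submodule.Quotient.mk l : dualLattice Γ ⧸ N) = 0 then
        (Fintype.card (dualLattice Γ ⧸ N) : ℂ) else 0 := by
    intro l
    rw [hrange, finsum_mem_range hTinj, finsum_eq_sum_of_fintype,
      ← AddChar.sum_apply_eq_ite, Finset.mul_sum]
    exact Finset.sum_congr rfl fun ψ _ => hTapply ψ l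
  refine ⟨hrange ▸ Set.finite_range T, fun l hl => ?_, fun j => ?_⟩
  · rw [hsum, if_neg (fun h => hl ((Submodule.Quotient.mk_eq_zero N).1 h)), mul_zero]
  · rw [hsum, if_pos ((Submodule.Quotient.mk_eq_zero N).2 (Submodule.sum_mem _ fun k _ =>
      Submodule.smul_mem _ _ (Submodule.subset_span ⟨k, rfl⟩))), ← hcard, Nat.card_eq_fintype_card,
      mul_comm, char_sum, Complex.ofReal_natCast]
    congr 1
    refine Finset.prod_congr rfl fun k _ => ?_
    rw [AddChar.map_zsmul_eq_zpow, hp]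

end Lattice

/-! ### The residue sum -/

section ResidueSum

variable {V : Type*} [NormedAddCommGroup V] [NormedSpace ℝ V] [FiniteDimensional ℝ V]
  {Γ : Submodule ℤ V} {N : ℕ} {β : Fin N → StrongDual ℝ V} {a : StrongDual ℝ V}
  {e : Module.Basis (Fin (Module.finrank ℝ V)) ℝ (StrongDual ℝ V)}
  {γ : Module.Basis (Fin (Module.finrank ℝ V)) ℝ V}

/-- The vector `a` lies in no proper subspace spanned by elements of the dual lattice. -/
def IsGeneric (Γ : Submodule ℤ V) (a : StrongDual ℝ V) : Prop :=
  ∀ s : Finset (StrongDual ℝ V), (∀ b ∈ s, b ∈ dualLattice Γ) → s.card < Module.finrank ℝ V →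
    a ∉ Submodule.span ℝ (s : Set (StrongDual ℝ V))

theorem IsGeneric.repr_ne_zero (ha : IsGeneric Γ a)
    {σ : Fin (Module.finrank ℝ V) → StrongDual ℝ V} (hσ : LinearIndependent ℝ σ)
    (hΓ : ∀ k, σ k ∈ dualLattice Γ) (k : Fin (Module.finrank ℝ V)) :
    (tupleBasis σ hσ).repr a k ≠ 0 := by
  classical
  intro h0
  refine ha ((Finset.univ.erase k).image σ) (fun b hb => ?_) ?_ ?_
  · obtain ⟨j, _, rfl⟩ := Finset.mem_image.1 hb
    exact hΓ j
  · refine lt_of_le_of_lt Finset.card_image_le ?_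
    rw [Finset.card_erase_of_mem (Finset.mem_univ k), Finset.card_univ, Fintype.card_fin]
    have := k.pos
    omega
  · rw [← (tupleBasis σ hσ).sum_repr a, coe_tupleBasis]
    refine Submodule.sum_mem _ fun j _ => ?_
    by_cases hj : j = k
    · rw [hj, h0, zero_smul]
      exact zero_mem _
    · refine Submodule.smul_mem _ _ (Submodule.subset_span ?_)
      rw [Finset.coe_image]
      exact ⟨j, by simp [hj], rfl⟩

/-- A tuple of independent positive elements of the dual lattice. -/
def IsGeneric.genTuple (ha : IsGeneric Γ a)
    {σ : Fin (Module.finrank ℝ V) → StrongDual ℝ V} (hσ : LinearIndependent ℝ σ)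
    (hΓ : ∀ k, σ k ∈ dualLattice Γ) (hpos : ∀ k, PosForm β (σ k)) : GenTuple β a where
  tuple := σ
  linInd := hσ
  pos := hpos
  repr_ne := ha.repr_ne_zero hσ hΓ

/-- The Laurent expansion of the generating function of a system of weights at the pole given by the
character `χ`. -/
def genSeries (χ : AddChar (dualLattice Γ) ℂ) (Φ : Multiset (Weight (dualLattice Γ)))
    (l : dualLattice Γ) (z : VC V) : LaurentSeries ℂ :=
  HahnSeries.C (χ l) * expLS (pair (l : StrongDual ℝ V) z) *
    (Φ.map fun b => geomLS (mult b * χ (-b.1)) (pair (b.1 : StrongDual ℝ V) z)).prod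

/-- The factor of `b` is inverse to 1 - u_b χ(-b) e^(-⟨b,z⟩t), and replacing `l` by `l - b.1`
multiplies the numerator by χ(-b) e^(-⟨b,z⟩t). The factor is polar exactly when χ(b) = u_b. -/
theorem genSeries_cons (χ : AddChar (dualLattice Γ) ℂ) (Φ : Multiset (Weight (dualLattice Γ)))
    (b : Weight (dualLattice Γ)) (l : dualLattice Γ) {z : VC V}
    (hz : pair (b.1 : StrongDual ℝ V) z ≠ 0) :
    genSeries χ Φ l z = genSeries χ (b ::ₘ Φ) l z -
      HahnSeries.C (mult b) * genSeries χ (b ::ₘ Φ) (l - b.1) z := by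
  have h1 : geomLS (mult b * χ (-b.1)) (pair (b.1 : StrongDual ℝ V) z) *
      (1 - HahnSeries.C (mult b * χ (-b.1)) * expLS (-pair (b.1 : StrongDual ℝ V) z)) = 1 :=
    inv_mul_cancel₀ (one_sub_mul_expLS_ne_zero fun _ => hz)
  have h2 : expLS (pair ((l - b.1 : dualLattice Γ) : StrongDual ℝ V) z) =
      expLS (pair (l : StrongDual ℝ V) z) * expLS (-pair (b.1 : StrongDual ℝ V) z) := by
    rw [← expLS_add, AddSubgroup.coe_sub, pair_sub, sub_eq_add_neg]
  unfold genSeries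
  rw [Multiset.map_cons, Multiset.prod_cons, h2, sub_eq_add_neg l, AddChar.map_add_eq_mul, map_mul]
  rw [map_mul] at h1
  linear_combination (-HahnSeries.C (χ l) * expLS (pair (l : StrongDual ℝ V) z) *
    (Φ.map fun b => geomLS (mult b * χ (-b.1)) (pair (b.1 : StrongDual ℝ V) z)).prod) * h1

/-- The residue at the pole given by the character `χ`. -/
def residueAt (J : (tube β → ℂ) →ₗ[ℂ] ℂ) (χ : AddChar (dualLattice Γ) ℂ)
    (Φ : Multiset (Weight (dualLattice Γ))) (l : dualLattice Γ) : ℂ :=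
  J fun z => (genSeries χ Φ l (z : VC V)).coeff (-(Module.finrank ℝ V : ℤ))

theorem residueAt_cons (J : (tube β → ℂ) →ₗ[ℂ] ℂ) (χ : AddChar (dualLattice Γ) ℂ)
    (Φ : Multiset (Weight (dualLattice Γ))) {b : Weight (dualLattice Γ)}
    (hb : PosForm β (b.1 : StrongDual ℝ V)) (l : dualLattice Γ) :
    residueAt J χ Φ l = residueAt J χ (b ::ₘ Φ) l - mult b * residueAt J χ (b ::ₘ Φ) (l - b.1) := by
  unfold residueAt
  rw [← smul_eq_mul, ← map_smul, ← map_sub]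
  congr 1
  ext z
  rw [genSeries_cons χ Φ b l (hb.pair_ne_zero z.2), HahnSeries.coeff_sub, HahnSeries.C_apply,
    HahnSeries.coeff_single_zero_mul]
  rfl

/-- The functional `J` takes the values of the residue on Laurent monomials. -/
def IsResidue (e : Module.Basis (Fin (Module.finrank ℝ V)) ℝ (StrongDual ℝ V))
    (a : StrongDual ℝ V) (J : (tube β → ℂ) →ₗ[ℂ] ℂ) : Prop :=
  ∀ (σ : GenTuple β a) (m : Fin (Module.finrank ℝ V) → ℤ),
    J (fun z => laurentMono σ.tuple m z) = jkValue e a σ.tuple m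

/-- By partial fractions the coefficient is a combination of Laurent monomials in positive rational
forms, with negative exponents only on forms polar at `χ`. The functional sees only monomials with
all exponents -1 whose cone contains `a`, which would exhibit the excluded tuple. -/
theorem residueAt_eq_zero {J : (tube β → ℂ) →ₗ[ℂ] ℂ} (hJ : IsResidue e a J) (ha : IsGeneric Γ a)
    (hβ : ∀ i, β i ∈ dualLattice Γ) (hspan : Submodule.span ℝ (Set.range β) = ⊤)
    {χ : AddChar (dualLattice Γ) ℂ} {Φ : Multiset (Weight (dualLattice Γ))}
    (hΦ : ∀ b ∈ Φ, PosForm β (b.1 : StrongDual ℝ V))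
    (h : ¬ ∃ σ : Fin (Module.finrank ℝ V) → Weight (dualLattice Γ), (∀ k, σ k ∈ Φ) ∧
      LinearIndependent ℝ (fun k => ((σ k).1 : StrongDual ℝ V)) ∧
      (∀ k, χ (σ k).1 = mult (σ k)) ∧ a ∈ coneOf fun k => ((σ k).1 : StrongDual ℝ V))
    (l : dualLattice Γ) : residueAt J χ Φ l = 0 := by
  set B : Set (StrongDual ℝ V) := {δ | δ ∈ dualLattice Γ ∧ PosForm β δ} with hB
  set A : Set (StrongDual ℝ V) := {δ | ∃ b ∈ Φ, χ b.1 = mult b ∧ (b.1 : StrongDual ℝ V) = δ} with hA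
  have hAB : A ⊆ B := by
    rintro _ ⟨b, hb, _, rfl⟩
    exact ⟨b.1.2, hΦ b hb⟩
  have hX : ∀ δ ∈ A, ∀ z ∈ tube β, pair δ z ≠ 0 := fun δ hδ z hz => (hAB hδ).2.pair_ne_zero hz
  have hBspan : Submodule.span ℝ B = ⊤ := by
    rw [eq_top_iff, ← hspan]
    refine Submodule.span_mono ?_
    rintro _ ⟨i, rfl⟩
    exact ⟨hβ i, posForm_apply β i⟩
  have hL : IsLaurentIn (monoMultiplier (tube β) B A) fun z => genSeries χ Φ l (z : VC V) := by
    refine ((IsLaurentIn.C _).mul (IsLaurentIn.expLS (pair_mem_monoMultiplier hX _))).mul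
      (IsLaurentIn.multiset_prod Φ fun b hb => ?_)
    refine IsLaurentIn.geomLS (pair_mem_monoMultiplier hX _) fun hc => ?_
    have hχ : χ b.1 = mult b := by
      have h1 : χ b.1 * χ (-b.1) = 1 := by
        rw [← AddChar.map_add_eq_mul, add_neg_cancel, AddChar.map_zero_eq_one]
      exact mul_right_cancel₀ (char_ne_zero χ _) (h1.trans hc.symm)
    have hbA : (b.1 : StrongDual ℝ V) ∈ A := ⟨b, hb, hχ, rfl⟩
    exact ⟨fun z => hX _ hbA z z.2, inv_mem_monoMultiplier hX hAB hbA⟩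
  have hmem := mem_monoSpan_of_mem_monoMultiplier hBspan
    (hL.coeff_mem (-(Module.finrank ℝ V : ℤ)))
  suffices hJ0 : ∀ F ∈ monoSpan (tube β) B A, J F = 0 from hJ0 _ hmem
  intro F hF
  induction hF using Submodule.span_induction with
  | zero => exact map_zero J
  | add x y _ _ hx hy => rw [map_add, hx, hy, add_zero]
  | smul c x _ hx => rw [map_smul, hx, smul_zero]
  | mem f hf =>
    obtain ⟨σ, hσ, hσB, m, hm, rfl⟩ := hf
    have h1 := hJ (ha.genTuple hσ (fun k => (hσB k).1) fun k => (hσB k).2) m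
    rw [show (ha.genTuple hσ (fun k => (hσB k).1) fun k => (hσB k).2).tuple = σ from rfl] at h1
    rw [h1, jkValue, if_neg]
    rintro ⟨hm1, hcone⟩
    have hσA : ∀ k, σ k ∈ A := fun k => hm k (by rw [hm1]; norm_num)
    choose b hbΦ hbχ hbσ using hσA
    have hbσ' : (fun k => ((b k).1 : StrongDual ℝ V)) = σ := funext hbσ
    exact h ⟨b, hbΦ, by rwa [hbσ'], hbχ, by rwa [hbσ']⟩

theorem finite_poles (h : IsDualPair Γ e γ) (Φ : Multiset (Weight (dualLattice Γ))) :
    {χ : AddChar (dualLattice Γ) ℂ | ∃ σ : Fin (Module.finrank ℝ V) → Weight (dualLattice Γ),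
      (∀ k, σ k ∈ Φ) ∧ LinearIndependent ℝ (fun k => ((σ k).1 : StrongDual ℝ V)) ∧
      ∀ k, χ (σ k).1 = mult (σ k)}.Finite := by
  classical
  have hfin : {σ : Fin (Module.finrank ℝ V) → Weight (dualLattice Γ) | (∀ k, σ k ∈ Φ) ∧
      LinearIndependent ℝ (fun k => ((σ k).1 : StrongDual ℝ V))}.Finite := by
    refine (Set.Finite.pi' (t := fun _ : Fin (Module.finrank ℝ V) => {b | b ∈ Φ}) fun _ => ?_).subset
      fun σ hσ k => hσ.1 k
    convert Φ.toFinset.finite_toSet using 1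
    ext b
    simp
  refine (hfin.biUnion (t := fun σ => charsWith (fun k => (σ k).1) fun k => mult (σ k))
    fun σ hσ => (h.finsum_charsWith hσ.2 fun k => mult_ne_zero _).1).subset ?_
  rintro χ ⟨σ, h1, h2, h3⟩
  exact Set.mem_biUnion (show σ ∈ _ from ⟨h1, h2⟩) h3

/-- The sum of the residues at all poles. -/
def residueSum (J : (tube β → ℂ) →ₗ[ℂ] ℂ) (Φ : Multiset (Weight (dualLattice Γ)))
    (l : dualLattice Γ) : ℂ := ∑ᶠ χ, residueAt J χ Φ l

theorem finite_support_residueAt (h : IsDualPair Γ e γ) {J : (tube β → ℂ) →ₗ[ℂ] ℂ}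
    (hJ : IsResidue e a J) (ha : IsGeneric Γ a)
    (hβ : ∀ i, β i ∈ dualLattice Γ) (hspan : Submodule.span ℝ (Set.range β) = ⊤)
    {Φ : Multiset (Weight (dualLattice Γ))}
    (hΦ : ∀ b ∈ Φ, PosForm β (b.1 : StrongDual ℝ V)) (l : dualLattice Γ) :
    (Function.support fun χ => residueAt J χ Φ l).Finite := by
  refine (finite_poles h Φ).subset fun χ hχ => ?_
  by_contra hcon
  refine hχ (residueAt_eq_zero hJ ha hβ hspan hΦ ?_ l)
  rintro ⟨σ, h1, h2, h3, _⟩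
  exact hcon ⟨σ, h1, h2, h3⟩

theorem isDifferenceSystem_residueSum (h : IsDualPair Γ e γ) {J : (tube β → ℂ) →ₗ[ℂ] ℂ}
    (hJ : IsResidue e a J) (ha : IsGeneric Γ a)
    (hβ : ∀ i, β i ∈ dualLattice Γ) (hspan : Submodule.span ℝ (Set.range β) = ⊤) :
    IsDifferenceSystem (fun l : dualLattice Γ => PosForm β (l : StrongDual ℝ V)) (residueSum J) := by
  intro Φ b hb hΦ l
  have hΦ' : ∀ c ∈ b ::ₘ Φ, PosForm β (c.1 : StrongDual ℝ V) := Multiset.forall_mem_cons.2 ⟨hb, hΦ⟩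
  have h1 := finite_support_residueAt h hJ ha hβ hspan hΦ' l
  have h2 := finite_support_residueAt h hJ ha hβ hspan hΦ' (l - b.1)
  unfold residueSum
  rw [finsum_congr fun χ => residueAt_cons J χ Φ hb l, finsum_sub_distrib h1, mul_finsum]
  exact h2.subset fun χ hχ => right_ne_zero_of_mul hχ

/-! ### Independent weights -/

theorem exists_of_mem_box {Λ W ι : Type*} [AddCommGroup Λ] [AddCommGroup W] [Module ℝ W]
    [DecidableEq ι] {ρ : Λ →+ W} {s : Finset ι} {b : ι → Weight Λ} {m : ι → ℕ} {d : W}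
    (hd : d ∈ box ρ (∑ k ∈ s, m k • {b k})) :
    ∃ t : ι → ℝ, (∀ k, 0 ≤ t k ∧ t k ≤ m k) ∧ d = ∑ k ∈ s, t k • ρ (b k).1 := by
  have hadd : ∀ Φ Ψ : Multiset (Weight Λ), box ρ (Φ + Ψ) = box ρ Φ + box ρ Ψ := by
    intro Φ Ψ
    simp [box]
  have hone : ∀ (b : Weight Λ) (m : ℕ) (d : W), d ∈ box ρ (m • {b}) →
      ∃ t : ℝ, (0 ≤ t ∧ t ≤ m) ∧ d = t • ρ b.1 := by
    intro b m
    induction m with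
    | zero =>
      intro d hd
      rw [zero_smul, box_zero] at hd
      exact ⟨0, by simp, by simpa using hd⟩
    | succ m ih =>
      intro d hd
      rw [succ_nsmul', Multiset.singleton_add] at hd
      obtain ⟨t, h0, h1, d', hd', rfl⟩ := mem_box_cons.1 hd
      obtain ⟨t', ⟨h0', h1'⟩, rfl⟩ := ih d' hd'
      exact ⟨t + t', ⟨by linarith, by push_cast; linarith⟩, by rw [add_smul]⟩
  induction s using Finset.induction_on generalizing d with
  | empty =>
    rw [Finset.sum_empty, box_zero] at hd
    exact ⟨0, fun k => by simp, by simpa using hd⟩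
  | insert i s hi ih =>
    rw [Finset.sum_insert hi, hadd] at hd
    obtain ⟨d₁, hd₁, d₂, hd₂, rfl⟩ := hd
    obtain ⟨t₁, ht₁, rfl⟩ := hone _ _ _ hd₁
    obtain ⟨t, ht, rfl⟩ := ih hd₂
    refine ⟨Function.update t i t₁, fun k => ?_, ?_⟩
    · by_cases hk : k = i
      · subst hk; rw [Function.update_self]; exact ht₁
      · rw [Function.update_of_ne hk]; exact ht k
    · rw [Finset.sum_insert hi, Function.update_self]
      congr 1
      exact Finset.sum_congr rfl fun k hk => by
        rw [Function.update_of_ne (ne_of_mem_of_not_mem hk hi)]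

theorem mem_sum_nsmul_singleton {ι M : Type*} {s : Finset ι} {b : ι → M} {m : ι → ℕ} {c : M}
    (hc : c ∈ ∑ k ∈ s, m k • ({b k} : Multiset M)) : ∃ k ∈ s, c = b k := by
  rw [Multiset.mem_sum] at hc
  obtain ⟨k, hk, hc⟩ := hc
  exact ⟨k, hk, Multiset.mem_singleton.1 (Multiset.mem_of_mem_nsmul hc)⟩

theorem genSeries_sum_nsmul {σ : Fin (Module.finrank ℝ V) → Weight (dualLattice Γ)}
    (hσ : LinearIndependent ℝ fun k => ((σ k).1 : StrongDual ℝ V))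
    {χ : AddChar (dualLattice Γ) ℂ} (hχ : ∀ k, χ (σ k).1 = mult (σ k))
    (m : Fin (Module.finrank ℝ V) → ℕ) (l : dualLattice Γ) (z : VC V) :
    genSeries χ (∑ k, m k • {σ k}) l z = HahnSeries.C (χ l) *
      ∏ k, (expLS (((tupleBasis _ hσ).repr (l : StrongDual ℝ V) k : ℝ) *
        pair ((σ k).1 : StrongDual ℝ V) z) * geomLS 1 (pair ((σ k).1 : StrongDual ℝ V) z) ^ m k) := by
  have h1 : expLS (pair (l : StrongDual ℝ V) z) =
      ∏ k, expLS (((tupleBasis _ hσ).repr (l : StrongDual ℝ V) k : ℝ) *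
        pair ((σ k).1 : StrongDual ℝ V) z) := by
    have h2 : ∀ (s : Finset (Fin (Module.finrank ℝ V))) (f : Fin (Module.finrank ℝ V) → ℂ),
        expLS (∑ k ∈ s, f k) = ∏ k ∈ s, expLS (f k) := by
      intro s f
      induction s using Finset.induction_on with
      | empty => simp [expLS, expPS_zero]
      | insert i s hi ih => rw [Finset.sum_insert hi, Finset.prod_insert hi, expLS_add, ih]
    rw [← h2]
    congr 1
    conv_lhs => rw [← (tupleBasis _ hσ).sum_repr (l : StrongDual ℝ V), coe_tupleBasis, pair_sum]
    exact Finset.sum_congr rfl fun k _ => pair_smul _ _ _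
  have h3 : ∀ k, mult (σ k) * χ (-(σ k).1) = 1 := by
    intro k
    rw [← hχ, ← AddChar.map_add_eq_mul, add_neg_cancel, AddChar.map_zero_eq_one]
  rw [genSeries, h1, mul_assoc, Finset.prod_mul_distrib]
  congr 2
  have h4 : ∀ (f : Weight (dualLattice Γ) → LaurentSeries ℂ) (s : Finset (Fin (Module.finrank ℝ V))),
      ((∑ k ∈ s, m k • ({σ k} : Multiset (Weight (dualLattice Γ)))).map f).prod =
        ∏ k ∈ s, f (σ k) ^ m k := by
    intro f s
    induction s using Finset.induction_on with
    | empty => simp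
    | insert i s hi ih =>
      rw [Finset.sum_insert hi, Finset.prod_insert hi, Multiset.map_add, Multiset.prod_add, ih,
        Multiset.map_nsmul, Multiset.prod_nsmul, Multiset.map_singleton, Multiset.prod_singleton]
  rw [h4]
  exact Finset.prod_congr rfl fun k _ => by rw [h3]

/-- Among the Laurent monomials in the expansion only the one with all exponents -1 has a nonzero
residue, which selects the coefficient of order `m k - 1` in each coordinate. -/
theorem residueAt_sum_nsmul {J : (tube β → ℂ) →ₗ[ℂ] ℂ} (hJ : IsResidue e a J) (ha : IsGeneric Γ a)
    {σ : Fin (Module.finrank ℝ V) → Weight (dualLattice Γ)}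
    (hσ : LinearIndependent ℝ fun k => ((σ k).1 : StrongDual ℝ V))
    (hpos : ∀ k, PosForm β ((σ k).1 : StrongDual ℝ V))
    (hcone : a ∈ coneOf fun k => ((σ k).1 : StrongDual ℝ V))
    {χ : AddChar (dualLattice Γ) ℂ} (hχ : ∀ k, χ (σ k).1 = mult (σ k))
    {m : Fin (Module.finrank ℝ V) → ℕ} (hm : ∀ k, m k ≠ 0) (l : dualLattice Γ) :
    residueAt J χ (∑ k, m k • {σ k}) l = χ l *
      ((|e.det fun k => ((σ k).1 : StrongDual ℝ V)|⁻¹ : ℝ) *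
        ∏ k, PowerSeries.coeff (m k - 1)
          (toddPow ((tupleBasis _ hσ).repr (l : StrongDual ℝ V) k : ℝ) (m k))) := by
  classical
  set τ : Fin (Module.finrank ℝ V) → StrongDual ℝ V := fun k => ((σ k).1 : StrongDual ℝ V) with hτ
  set r := (tupleBasis τ hσ).repr (l : StrongDual ℝ V) with hr
  have hDm : ∑ k : Fin (Module.finrank ℝ V), (m k - 1) + Module.finrank ℝ V = ∑ k, m k := by
    have : ∑ k : Fin (Module.finrank ℝ V), ((m k - 1) + 1) = ∑ k, m k :=
      Finset.sum_congr rfl fun k _ => Nat.succ_pred_eq_of_ne_zero (hm k)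
    rw [← this, Finset.sum_add_distrib]
    simp
  set D := ∑ k : Fin (Module.finrank ℝ V), (m k - 1) with hD
  have hDeq : (D : ℤ) = -(Module.finrank ℝ V : ℤ) + ∑ k, (m k : ℤ) := by
    have : ∑ k, (m k : ℤ) = ((∑ k, m k : ℕ) : ℤ) := by push_cast; rfl
    rw [this, ← hDm]
    push_cast
    ring
  have key : (fun z : tube β => (genSeries χ (∑ k, m k • {σ k}) l (z : VC V)).coeff
      (-(Module.finrank ℝ V : ℤ))) = χ l • ∑ i ∈ Finset.finsuppAntidiag Finset.univ D,
        (∏ k, PowerSeries.coeff (i k) (toddPow (r k : ℝ) (m k))) •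
          fun z : tube β => laurentMono τ (fun k => (i k : ℤ) - m k) z := by
    ext z
    rw [genSeries_sum_nsmul hσ hχ, HahnSeries.C_apply, HahnSeries.coeff_single_zero_mul,
      coeff_prod_expLS_mul_geomLS_pow _ (fun k => (hpos k).pair_ne_zero z.2) m hDeq]
    simp only [Pi.smul_apply, Finset.sum_apply, smul_eq_mul, laurentMono]
    rfl
  have hτ' : ∀ i : Fin (Module.finrank ℝ V) → ℤ, J (fun z => laurentMono τ i z) = jkValue e a τ i :=
    fun i => hJ (ha.genTuple hσ (fun k => (σ k).1.2) hpos) i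
  rw [residueAt, key, map_smul, map_sum, smul_eq_mul]
  congr 1
  simp only [map_smul, hτ', smul_eq_mul]
  let i₀ : Fin (Module.finrank ℝ V) →₀ ℕ := Finsupp.equivFunOnFinite.symm fun k => m k - 1
  have hi₀ : ∀ k, i₀ k = m k - 1 := fun k => rfl
  rw [Finset.sum_eq_single i₀]
  · rw [jkValue, if_pos, mul_comm]
    · rfl
    · refine ⟨fun k => ?_, hcone⟩
      rw [hi₀]
      have := hm k
      omega
  · intro i _ hi
    rw [jkValue, if_neg, mul_zero]
    rintro ⟨h1, _⟩
    refine hi (Finsupp.ext fun k => ?_)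
    rw [hi₀]
    have := h1 k
    omega
  · intro hnot
    refine absurd ?_ hnot
    rw [Finset.mem_finsuppAntidiag]
    exact ⟨rfl, Finset.subset_univ _⟩

end ResidueSum

/-! ### The partition function as a residue sum -/

section Main

variable {V : Type*} [NormedAddCommGroup V] [NormedSpace ℝ V] [FiniteDimensional ℝ V]
  {Γ : Submodule ℤ V} {N : ℕ} {β : Fin N → StrongDual ℝ V} {a : StrongDual ℝ V}
  {e : Module.Basis (Fin (Module.finrank ℝ V)) ℝ (StrongDual ℝ V)}
  {γ : Module.Basis (Fin (Module.finrank ℝ V)) ℝ V}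

theorem pos_of_mem_sum_nsmul {ι : Type*} {s : Finset ι} {b : ι → Weight (dualLattice Γ)}
    (hb : ∀ k ∈ s, PosForm β ((b k).1 : StrongDual ℝ V)) (m : ι → ℕ) :
    ∀ c ∈ ∑ k ∈ s, m k • ({b k} : Multiset (Weight (dualLattice Γ))),
      PosForm β (c.1 : StrongDual ℝ V) := by
  intro c hc
  obtain ⟨k, hk, rfl⟩ := mem_sum_nsmul_singleton hc
  exact hb k hk

theorem coneOf_comp_perm {W κ : Type*} [AddCommGroup W] [Module ℝ W] [Fintype κ] (v : κ → W)
    (E : Equiv.Perm κ) : coneOf (fun k => v (E k)) = coneOf v := by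
  ext x
  constructor
  · rintro ⟨c, hc, rfl⟩
    exact ⟨fun k => c (E.symm k), fun k => hc _, by
      rw [← Equiv.sum_comp E fun k => c (E.symm k) • v k]
      simp⟩
  · rintro ⟨c, hc, rfl⟩
    exact ⟨fun k => c (E k), fun k => hc _, (Equiv.sum_comp E fun k => c k • v k).symm⟩

theorem exists_perm_of_mem {σ τ : Fin (Module.finrank ℝ V) → Weight (dualLattice Γ)}
    {m : Fin (Module.finrank ℝ V) → ℕ} (hτ : ∀ k, τ k ∈ ∑ k, m k • ({σ k} : Multiset _))
    (hli : LinearIndependent ℝ fun k => ((τ k).1 : StrongDual ℝ V)) :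
    ∃ E : Equiv.Perm (Fin (Module.finrank ℝ V)), ∀ k, τ k = σ (E k) := by
  have h1 : ∀ k, ∃ j, τ k = σ j := fun k => by
    obtain ⟨j, _, hj⟩ := mem_sum_nsmul_singleton (hτ k)
    exact ⟨j, hj⟩
  choose f hf using h1
  have hinj : Function.Injective f := by
    intro i j hij
    refine hli.injective ?_
    simp only [hf, hij]
  exact ⟨Equiv.ofBijective f (Finite.injective_iff_bijective.1 hinj), hf⟩

/-- Both sides factor over the coordinates of `l` in the basis `σ`. The box condition is used only
to exclude coordinates at most `-m k` when `a` is in the cone, and to put `a` in the cone when the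
partition function is nonzero. -/
theorem partitionFun_eq_residueSum_of_basis (h : IsDualPair Γ e γ) {J : (tube β → ℂ) →ₗ[ℂ] ℂ}
    (hJ : IsResidue e a J) (ha : IsGeneric Γ a)
    (hβ : ∀ i, β i ∈ dualLattice Γ) (hspan : Submodule.span ℝ (Set.range β) = ⊤)
    {ht : dualLattice Γ →+ ℝ} (hht : ∀ l : dualLattice Γ, PosForm β (l : StrongDual ℝ V) → 0 < ht l)
    {σ : Fin (Module.finrank ℝ V) → Weight (dualLattice Γ)}
    (hσ : LinearIndependent ℝ fun k => ((σ k).1 : StrongDual ℝ V))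
    (hpos : ∀ k, PosForm β ((σ k).1 : StrongDual ℝ V))
    {m : Fin (Module.finrank ℝ V) → ℕ} (hm : ∀ k, m k ≠ 0) {l : dualLattice Γ}
    {t : Fin (Module.finrank ℝ V) → ℝ} (ht0 : ∀ k, 0 ≤ t k ∧ t k ≤ m k)
    (hl : a - (l : StrongDual ℝ V) = ∑ k, t k • ((σ k).1 : StrongDual ℝ V)) :
    partitionFun ht (∑ k, m k • {σ k}) l = residueSum J (∑ k, m k • {σ k}) l := by
  classical
  have hΦ := pos_of_mem_sum_nsmul (s := Finset.univ) (fun k _ => hpos k) m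
  set τ : Fin (Module.finrank ℝ V) → StrongDual ℝ V := fun k => ((σ k).1 : StrongDual ℝ V) with hτ
  have hrt : ∀ k, (tupleBasis τ hσ).repr a k = (tupleBasis τ hσ).repr (l : StrongDual ℝ V) k + t k := by
    intro k
    have h1 : (tupleBasis τ hσ).repr (a - (l : StrongDual ℝ V)) k = t k := by
      rw [hl]
      have : ∑ k, t k • ((σ k).1 : StrongDual ℝ V) = ∑ k, t k • tupleBasis τ hσ k := by
        rw [coe_tupleBasis]
      rw [this, Module.Basis.repr_sum_self]
    rw [map_sub, Finsupp.sub_apply] at h1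
    linarith
  have hrepr : ∀ j : Fin (Module.finrank ℝ V) → ℤ, l = ∑ k, j k • (σ k).1 →
      ∀ k, (tupleBasis τ hσ).repr (l : StrongDual ℝ V) k = j k := by
    intro j hj k
    have : (l : StrongDual ℝ V) = ∑ k, (j k : ℝ) • tupleBasis τ hσ k := by
      rw [hj, AddSubgroup.val_finsetSum, coe_tupleBasis]
      exact Finset.sum_congr rfl fun k _ => by
        rw [AddSubgroupClass.coe_zsmul, intCast_smul_form]
    rw [this, Module.Basis.repr_sum_self]
  have hpf : partitionFun ht (∑ k, m k • {σ k}) l ≠ 0 →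
      ∃ j : Fin (Module.finrank ℝ V) → ℕ, l = ∑ k, j k • (σ k).1 := fun h0 =>
    exists_nsmul_of_mem_closure (mem_closure_of_partitionFun_ne_zero hht _ hΦ _ h0)
  -- Every independent `n`-tuple taken from the system is a permutation of `σ`, so `charsWith`
  -- contains all the poles.
  have hother : ∀ χ ∉ charsWith (fun k => (σ k).1) fun k => mult (σ k),
      residueAt J χ (∑ k, m k • {σ k}) l = 0 := by
    intro χ hχ
    refine residueAt_eq_zero hJ ha hβ hspan hΦ ?_ l
    rintro ⟨σ', h1, h2, h3, _⟩
    obtain ⟨E, hE⟩ := exists_perm_of_mem h1 h2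
    refine hχ fun k => ?_
    have := h3 (E.symm k)
    rwa [hE, Equiv.apply_symm_apply] at this
  by_cases hcone : a ∈ coneOf τ
  · have hcone' := (mem_coneOf_iff hσ a).1 hcone
    have hsum : residueSum J (∑ k, m k • {σ k}) l =
        (∑ᶠ χ ∈ charsWith (fun k => (σ k).1) fun k => mult (σ k), χ l) *
        ((|e.det τ|⁻¹ : ℝ) * ∏ k, PowerSeries.coeff (m k - 1)
          (toddPow ((tupleBasis τ hσ).repr (l : StrongDual ℝ V) k : ℝ) (m k))) := by
      rw [residueSum, finsum_mem_def, finsum_mul]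
      refine finsum_congr fun χ => ?_
      by_cases hχ : χ ∈ charsWith (fun k => (σ k).1) fun k => mult (σ k)
      · rw [Set.indicator_of_mem hχ]
        exact residueAt_sum_nsmul hJ ha hσ hpos hcone hχ hm l
      · rw [Set.indicator_of_notMem hχ, zero_mul, hother χ hχ]
    obtain ⟨_, hs0, hs1⟩ := h.finsum_charsWith hσ fun k => mult_ne_zero (σ k)
    rw [hsum]
    by_cases hmem : l ∈ Submodule.span ℤ (Set.range fun k => (σ k).1)
    · obtain ⟨j, hj⟩ := (Submodule.mem_span_range_iff_exists_fun ℤ).1 hmem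
      have hr := hrepr j hj.symm
      have hdet : |e.det τ| ≠ 0 := abs_ne_zero.2 (IsDualPair.det_ne_zero hσ)
      have hs : ∑ᶠ χ ∈ charsWith (fun k => (σ k).1) fun k => mult (σ k), χ l =
          (|e.det τ| : ℝ) * ∏ k, mult (σ k) ^ j k := by
        rw [← hs1 j, hj]
      have hcancel : ∀ A B : ℂ, ((|e.det τ| : ℝ) : ℂ) * A * (((|e.det τ|⁻¹ : ℝ) : ℂ) * B) = A * B := by
        intro A B
        have : ((|e.det τ| : ℝ) : ℂ) ≠ 0 := by exact_mod_cast hdet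
        rw [Complex.ofReal_inv]
        field_simp
      rw [hs, hcancel, ← Finset.prod_mul_distrib]
      by_cases hjpos : ∀ k, 0 ≤ j k
      · have hli := (linearIndependent_int_of_real hσ).linearIndepOn (s := Set.univ)
        have hj' : l = ∑ k, (j k).toNat • (σ k).1 := by
          rw [← hj]
          refine Finset.sum_congr rfl fun k _ => ?_
          rw [← natCast_zsmul, Int.toNat_of_nonneg (hjpos k)]
        have := partitionFun_sum_nsmul hht (s := Finset.univ) (fun k _ => hpos k) (by simpa using hli) _
          m (fun k => (j k).toNat) rfl
        rw [← hj'] at this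
        rw [this]
        refine Finset.prod_congr rfl fun k _ => ?_
        obtain ⟨q, hq⟩ := Nat.exists_eq_succ_of_ne_zero (hm k)
        obtain ⟨i, hi⟩ := Int.eq_ofNat_of_zero_le (hjpos k)
        have h1 := coeff_toddPow_natCast i q
        rw [hr k, hq, hi, Nat.succ_eq_add_one, Nat.add_sub_cancel, Int.toNat_natCast, zpow_natCast,
          ← h1]
        norm_cast
      · push Not at hjpos
        obtain ⟨k, hk⟩ := hjpos
        have hzero : partitionFun ht (∑ k, m k • {σ k}) l = 0 := by
          by_contra h0
          obtain ⟨j', hj'⟩ := hpf h0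
          have h1 := hrepr (fun k => (j' k : ℤ)) (by simpa using hj') k
          rw [hr k] at h1
          have h2 : j k = j' k := by exact_mod_cast h1
          omega
        rw [hzero, Finset.prod_eq_zero (Finset.mem_univ k)]
        obtain ⟨q, hq⟩ := Nat.exists_eq_succ_of_ne_zero (hm k)
        obtain ⟨i, hi⟩ := Int.eq_ofNat_of_zero_le (neg_nonneg.2 hk.le)
        -- Strict positivity, from genericity, gives the strict bound -l_k < m_k; at equality the
        -- coefficient of `toddPow` need not vanish.
        have hapos : 0 < (tupleBasis τ hσ).repr a k :=
          lt_of_le_of_ne (hcone' k) (ha.repr_ne_zero hσ (fun k => (σ k).1.2) k).symm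
        have hlt : -(j k : ℝ) < m k := by
          have := hrt k
          rw [hr k] at this
          linarith [(ht0 k).2]
        have hlt' : -(j k) < m k := by exact_mod_cast hlt
        have h1 := coeff_toddPow_neg i q (by rintro rfl; simp at hi; omega) (by omega)
        have h2 : ((j k : ℝ) : ℂ) = -(i : ℂ) := by
          rw [← neg_eq_iff_eq_neg]
          exact_mod_cast hi
        rw [hr k, hq, Nat.succ_eq_add_one, Nat.add_sub_cancel, h2, h1, mul_zero]
    -- Outside the sublattice the character sum vanishes, and so does the partition function, whose
    -- support is generated by the weights.
    · rw [hs0 l hmem, zero_mul]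
      by_contra h0
      obtain ⟨j, hj⟩ := hpf h0
      refine hmem ?_
      rw [hj]
      exact Submodule.sum_mem _ fun k _ =>
        Submodule.smul_of_tower_mem _ _ (Submodule.subset_span ⟨k, rfl⟩)
  · have hI : residueSum J (∑ k, m k • {σ k}) l = 0 := by
      rw [residueSum]
      refine finsum_eq_zero_of_forall_eq_zero fun χ => ?_
      refine residueAt_eq_zero hJ ha hβ hspan hΦ ?_ l
      rintro ⟨σ', h1, h2, _, h4⟩
      obtain ⟨E, hE⟩ := exists_perm_of_mem h1 h2
      simp only [hE] at h4
      exact hcone (coneOf_comp_perm τ E ▸ h4)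
    rw [hI]
    by_contra h0
    obtain ⟨j, hj⟩ := hpf h0
    refine hcone ((mem_coneOf_iff hσ a).2 fun k => ?_)
    rw [hrt, hrepr (fun k => (j k : ℤ)) (by simpa using hj) k]
    exact add_nonneg (by simp) (ht0 k).1

/-- There are too few weights for an `n`-dimensional pole, so all residues vanish. If the partition
function did not, both `l` and `a - l` would lie in the span of the weights, contrary to genericity.
-/
theorem partitionFun_eq_residueSum_of_card_lt {J : (tube β → ℂ) →ₗ[ℂ] ℂ}
    (hJ : IsResidue e a J) (ha : IsGeneric Γ a)
    (hβ : ∀ i, β i ∈ dualLattice Γ) (hspan : Submodule.span ℝ (Set.range β) = ⊤)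
    {ht : dualLattice Γ →+ ℝ} (hht : ∀ l : dualLattice Γ, PosForm β (l : StrongDual ℝ V) → 0 < ht l)
    {ι : Type*} [DecidableEq ι] {s : Finset ι} {b : ι → Weight (dualLattice Γ)}
    (hpos : ∀ k ∈ s, PosForm β ((b k).1 : StrongDual ℝ V)) (hcard : s.card < Module.finrank ℝ V)
    {m : ι → ℕ} {l : dualLattice Γ} {t : ι → ℝ}
    (hl : a - (l : StrongDual ℝ V) = ∑ k ∈ s, t k • ((b k).1 : StrongDual ℝ V)) :
    partitionFun ht (∑ k ∈ s, m k • {b k}) l = residueSum J (∑ k ∈ s, m k • {b k}) l := by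
  classical
  have hΦ := pos_of_mem_sum_nsmul hpos m
  have hI : residueSum J (∑ k ∈ s, m k • {b k}) l = 0 := by
    rw [residueSum]
    refine finsum_eq_zero_of_forall_eq_zero fun χ => ?_
    refine residueAt_eq_zero hJ ha hβ hspan hΦ ?_ l
    rintro ⟨σ', h1, h2, _⟩
    have h3 : ∀ k, ∃ j : s, σ' k = b j := fun k => by
      obtain ⟨j, hj, hjk⟩ := mem_sum_nsmul_singleton (h1 k)
      exact ⟨⟨j, hj⟩, hjk⟩
    choose f hf using h3
    have hinj : Function.Injective f := by
      intro i j hij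
      refine h2.injective ?_
      simp only [hf, hij]
    have := Fintype.card_le_of_injective f hinj
    rw [Fintype.card_fin, Fintype.card_coe] at this
    omega
  rw [hI]
  by_contra h0
  obtain ⟨j, hj⟩ := exists_nsmul_of_mem_closure (mem_closure_of_partitionFun_ne_zero hht _ hΦ _ h0)
  refine ha (s.image fun k => ((b k).1 : StrongDual ℝ V)) (fun c hc => ?_)
    (lt_of_le_of_lt Finset.card_image_le hcard) ?_
  · obtain ⟨k, _, rfl⟩ := Finset.mem_image.1 hc
    exact (b k).1.2
  · have hmem : ∀ k ∈ s, ((b k).1 : StrongDual ℝ V) ∈ Submodule.span ℝ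
        (((s.image fun k => ((b k).1 : StrongDual ℝ V)) : Finset _) : Set (StrongDual ℝ V)) :=
      fun k hk => Submodule.subset_span (Finset.mem_coe.2 (Finset.mem_image_of_mem _ hk))
    have h1 : a = (a - (l : StrongDual ℝ V)) + (l : StrongDual ℝ V) := by abel
    rw [h1]
    refine add_mem ?_ ?_
    · rw [hl]
      exact Submodule.sum_mem _ fun k hk => Submodule.smul_mem _ _ (hmem k hk)
    · rw [hj, AddSubgroup.val_finsetSum]
      exact Submodule.sum_mem _ fun k hk => by
        rw [AddSubgroupClass.coe_nsmul]
        exact Submodule.smul_of_tower_mem _ _ (hmem k hk)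

theorem partitionFun_eq_residueSum (h : IsDualPair Γ e γ) {J : (tube β → ℂ) →ₗ[ℂ] ℂ}
    (hJ : IsResidue e a J) (ha : IsGeneric Γ a)
    (hβ : ∀ i, β i ∈ dualLattice Γ) (hspan : Submodule.span ℝ (Set.range β) = ⊤)
    {ht : dualLattice Γ →+ ℝ} (hht : ∀ l : dualLattice Γ, PosForm β (l : StrongDual ℝ V) → 0 < ht l)
    {b : Fin N → Weight (dualLattice Γ)} (hb : ∀ i, ((b i).1 : StrongDual ℝ V) = β i)
    {l : dualLattice Γ} (hl : a - (l : StrongDual ℝ V) ∈ parallelepiped β) :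
    partitionFun ht (Finset.univ.val.map b) l = residueSum J (Finset.univ.val.map b) l := by
  classical
  set Pos : dualLattice Γ → Prop := fun l => PosForm β (l : StrongDual ℝ V) with hPos
  set X : Multiset (Weight (dualLattice Γ)) → dualLattice Γ → ℂ :=
    fun Φ l => partitionFun ht Φ l - residueSum J Φ l with hXdef
  have hX : IsDifferenceSystem Pos X := by
    intro Φ c hc hΦ l
    simp only [hXdef]
    rw [isDifferenceSystem_partitionFun hht Φ c hc hΦ,
      isDifferenceSystem_residueSum h hJ ha hβ hspan Φ c hc hΦ]
    ring
  have key := VanishesOn.of_independent (ρ := (dualLattice Γ).subtype) (a := a) (ι := Fin N) hX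
    (fun c d hc hd => by
      simp only [hPos, AddSubgroup.coe_add]
      exact PosForm.add hc hd)
    (fun m c hm hc => by
      simp only [hPos, AddSubgroupClass.coe_nsmul]
      exact PosForm.nsmul hc hm) ht hht ?_ _ Finset.univ b (fun _ => 1) rfl
      (fun i _ => by simp only [hPos, hb]; exact posForm_apply β i)
  · have hΦ : ∑ j, (1 : ℕ) • ({b j} : Multiset (Weight (dualLattice Γ))) = Finset.univ.val.map b := by
      simp only [one_smul]
      have h1 := Multiset.sum_map_singleton (Finset.univ.val.map b)
      rwa [Multiset.map_map] at h1
    rw [hΦ] at key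
    refine sub_eq_zero.1 (key l ?_)
    rw [parallelepiped_eq_sum_segment] at hl
    have h1 : (fun c : Weight (dualLattice Γ) => segment ℝ 0 ((dualLattice Γ).subtype c.1)) ∘ b =
        fun i => segment ℝ 0 (β i) := by
      ext1 i
      simp only [Function.comp_apply, AddSubgroup.coe_subtype, hb]
    rw [box, Multiset.map_map, h1]
    exact hl
  -- Independence over `ℤ` in `Γ*` is independence over `ℝ`, so there are at most `n` weights, and
  -- the two explicit cases cover everything.
  · intro s c m hc hm hli l hl
    obtain ⟨t, ht0, hts⟩ := exists_of_mem_box hl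
    refine sub_eq_zero.2 ?_
    simp only [AddSubgroup.coe_subtype] at hts
    have hR : LinearIndependent ℝ fun k : s => ((c k).1 : StrongDual ℝ V) :=
      linearIndependent_real_of_int h (σ := fun k : s => (c k).1) hli
    have hcard : s.card ≤ Module.finrank ℝ V := by
      have := hR.fintype_card_le_finrank
      rwa [Fintype.card_coe, finrank_strongDual] at this
    rcases hcard.lt_or_eq with hlt | heq
    · exact partitionFun_eq_residueSum_of_card_lt hJ ha hβ hspan hht hc hlt hts
    · let E : Fin (Module.finrank ℝ V) ≃ s := (Finset.equivFinOfCardEq heq).symm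
      have hsum : ∀ {M : Type _} [AddCommMonoid M] (f : Fin N → M),
          ∑ k ∈ s, f k = ∑ k, f (E k) := by
        intro M _ f
        rw [← Finset.sum_coe_sort, ← Equiv.sum_comp E]
      rw [hsum] at hts ⊢
      exact partitionFun_eq_residueSum_of_basis h hJ ha hβ hspan hht (σ := fun k => c (E k))
        (hR.comp E E.injective) (fun k => hc _ (E k).2) (fun k => hm _ (E k).2)
        (fun k => ht0 _) hts

end Main

/-! ### Laurent expansions of meromorphic functions -/

section Laurent

open Filter

/-- The Taylor series at `0`. -/
def taylorPS (f : ℂ → ℂ) : PowerSeries ℂ :=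
  PowerSeries.mk fun k => iteratedDeriv k f 0 / k.factorial

theorem taylorPS_congr {f g : ℂ → ℂ} (h : f =ᶠ[𝓝 0] g) : taylorPS f = taylorPS g := by
  ext k
  rw [taylorPS, taylorPS, PowerSeries.coeff_mk, PowerSeries.coeff_mk, h.iteratedDeriv_eq]

theorem taylorPS_mul {f g : ℂ → ℂ} (hf : AnalyticAt ℂ f 0) (hg : AnalyticAt ℂ g 0) :
    taylorPS (fun t => f t * g t) = taylorPS f * taylorPS g := by
  ext k
  rw [PowerSeries.coeff_mul, Finset.Nat.sum_antidiagonal_eq_sum_range_succ_mk]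
  simp only [taylorPS, PowerSeries.coeff_mk]
  rw [iteratedDeriv_fun_mul hf.contDiffAt hg.contDiffAt, Finset.sum_div]
  refine Finset.sum_congr rfl fun i hi => ?_
  have hik : i ≤ k := Nat.lt_succ_iff.1 (Finset.mem_range.1 hi)
  rw [Nat.cast_choose ℂ hik]
  have h1 : (k.factorial : ℂ) ≠ 0 := by exact_mod_cast k.factorial_ne_zero
  have h2 : (i.factorial : ℂ) ≠ 0 := by exact_mod_cast i.factorial_ne_zero
  have h3 : ((k - i).factorial : ℂ) ≠ 0 := by exact_mod_cast (k - i).factorial_ne_zero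
  field_simp

theorem taylorPS_sub {f g : ℂ → ℂ} (hf : AnalyticAt ℂ f 0) (hg : AnalyticAt ℂ g 0) :
    taylorPS (fun t => f t - g t) = taylorPS f - taylorPS g := by
  ext k
  simp only [taylorPS, PowerSeries.coeff_mk, map_sub]
  rw [iteratedDeriv_fun_sub hf.contDiffAt hg.contDiffAt, sub_div]

theorem taylorPS_const (c : ℂ) : taylorPS (fun _ => c) = PowerSeries.C c := by
  ext k
  rw [taylorPS, PowerSeries.coeff_mk, PowerSeries.coeff_C, iteratedDeriv_const]
  split_ifs with h <;> simp [h]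

theorem taylorPS_cexp (c : ℂ) : taylorPS (fun t => Complex.exp (c * t)) = expPS c := by
  ext k
  rw [taylorPS, PowerSeries.coeff_mk, coeff_expPS, iteratedDeriv_cexp_const_mul]
  simp

theorem taylorPS_pow (n : ℕ) : taylorPS (fun t => t ^ n) = PowerSeries.X ^ n := by
  induction n with
  | zero => simpa using taylorPS_const 1
  | succ n ih =>
    have h1 : taylorPS (fun t => t) = PowerSeries.X := by
      ext k
      rw [taylorPS, PowerSeries.coeff_mk, PowerSeries.coeff_X, iteratedDeriv_fun_id_zero]
      split_ifs with h <;> simp [h]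
    simp only [pow_succ]
    rw [taylorPS_mul (f := fun t => t ^ n) (g := fun t => t) (by fun_prop) analyticAt_id, ih, h1]

theorem taylorPS_pow_mul (n : ℕ) {f : ℂ → ℂ} (hf : AnalyticAt ℂ f 0) :
    taylorPS (fun t => t ^ n * f t) = PowerSeries.X ^ n * taylorPS f := by
  rw [taylorPS_mul (f := fun t => t ^ n) (by fun_prop) hf, taylorPS_pow]

/-- The function `g` has the Laurent expansion `G` at `0`. -/
def HasLaurent (g : ℂ → ℂ) (G : LaurentSeries ℂ) : Prop :=
  ∃ (k : ℕ) (h : ℂ → ℂ), AnalyticAt ℂ h 0 ∧ (∀ᶠ t in 𝓝[≠] 0, t ^ k * g t = h t) ∧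
    G = HahnSeries.single (-k : ℤ) 1 * HahnSeries.ofPowerSeries ℤ ℂ (taylorPS h)

theorem single_mul_ofPowerSeries_X_pow (k : ℕ) : HahnSeries.single (-k : ℤ) (1 : ℂ) *
    HahnSeries.ofPowerSeries ℤ ℂ (PowerSeries.X ^ k) = 1 := by
  rw [HahnSeries.ofPowerSeries_X_pow, HahnSeries.single_mul_single]
  simp

/-- `laurentCoeff` uses an exponent obtained by choice; two admissible exponents give analytic
functions that differ by powers of `t`. -/
theorem HasLaurent.laurentCoeff_eq {g : ℂ → ℂ} {G : LaurentSeries ℂ} (hg : HasLaurent g G) (m : ℤ) :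
    laurentCoeff g m = G.coeff m := by
  obtain ⟨k, h, hh, hgh, hG⟩ := hg
  have hex : ∃ k : ℕ, AnalyticAt ℂ (fun t => t ^ k * g t) 0 := by
    -- The extra factor `t` makes the value at 0 vanish, so the actual value `g 0` is irrelevant.
    refine ⟨k + 1, AnalyticAt.congr (analyticAt_id.mul hh) ?_⟩
    rw [eventually_nhdsWithin_iff] at hgh
    filter_upwards [hgh] with t ht
    by_cases h0 : t = 0
    · simp [h0]
    · simp only [Pi.mul_apply, id_eq]
      rw [← ht h0]
      ring
  rw [laurentCoeff, dif_pos hex]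
  have hk := hex.choose_spec
  set k' := hex.choose
  set h' : ℂ → ℂ := fun t => t ^ k' * g t with hh'
  have heq : ∀ᶠ t in 𝓝 (0 : ℂ), t ^ k * h' t = t ^ k' * h t := by
    refine (AnalyticAt.frequently_eq_iff_eventually_eq ((analyticAt_id.pow k).mul hk)
      ((analyticAt_id.pow k').mul hh)).1 (Eventually.frequently ?_)
    filter_upwards [hgh] with t ht
    simp only [Pi.mul_apply, Pi.pow_apply, id_eq]
    rw [← ht, hh']
    ring
  have hT := taylorPS_congr heq
  rw [taylorPS_pow_mul k hk, taylorPS_pow_mul k' hh] at hT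
  have hG' : G = HahnSeries.single (-k' : ℤ) 1 * HahnSeries.ofPowerSeries ℤ ℂ (taylorPS h') := by
    have h1 := congrArg (HahnSeries.ofPowerSeries ℤ ℂ) hT
    rw [map_mul, map_mul] at h1
    rw [hG]
    linear_combination (-HahnSeries.single (-k : ℤ) (1 : ℂ) * HahnSeries.single (-k' : ℤ) (1 : ℂ)) * h1 +
      HahnSeries.single (-k' : ℤ) (1 : ℂ) * HahnSeries.ofPowerSeries ℤ ℂ (taylorPS h') *
        single_mul_ofPowerSeries_X_pow k -
      HahnSeries.single (-k : ℤ) (1 : ℂ) * HahnSeries.ofPowerSeries ℤ ℂ (taylorPS h) *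
        single_mul_ofPowerSeries_X_pow k'
  rw [hG', HahnSeries.coeff_single_mul, one_mul, sub_neg_eq_add, PowerSeries.coeff_coe]
  by_cases h0 : 0 ≤ m + k'
  · rw [if_pos h0, if_neg (not_lt.2 h0), taylorPS, PowerSeries.coeff_mk]
    have : (m + (k' : ℤ)).toNat = (m + (k' : ℤ)).natAbs := by omega
    rw [this]
  · rw [if_neg h0, if_pos (not_le.1 h0)]

theorem HasLaurent.of_analyticAt {h : ℂ → ℂ} (hh : AnalyticAt ℂ h 0) :
    HasLaurent h (HahnSeries.ofPowerSeries ℤ ℂ (taylorPS h)) :=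
  ⟨0, h, hh, Eventually.of_forall fun t => by simp, by simp⟩

theorem HasLaurent.mul {f g : ℂ → ℂ} {F G : LaurentSeries ℂ} (hf : HasLaurent f F)
    (hg : HasLaurent g G) : HasLaurent (fun t => f t * g t) (F * G) := by
  obtain ⟨k, h, hh, hfh, hF⟩ := hf
  obtain ⟨k', h', hh', hgh, hG⟩ := hg
  refine ⟨k + k', fun t => h t * h' t, hh.mul hh', ?_, ?_⟩
  · filter_upwards [hfh, hgh] with t ht ht'
    rw [← ht, ← ht']
    ring
  · rw [taylorPS_mul hh hh', hF, hG, map_mul, mul_mul_mul_comm, HahnSeries.single_mul_single, one_mul]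
    congr 3
    push_cast
    ring

theorem HasLaurent.prod {ι : Type*} (s : Finset ι) {f : ι → ℂ → ℂ} {F : ι → LaurentSeries ℂ}
    (h : ∀ i ∈ s, HasLaurent (f i) (F i)) : HasLaurent (fun t => ∏ i ∈ s, f i t) (∏ i ∈ s, F i) := by
  classical
  induction s using Finset.induction_on with
  | empty =>
    have := HasLaurent.of_analyticAt (h := fun _ => 1) analyticAt_const
    rw [taylorPS_const, map_one, map_one] at this
    simpa using this
  | insert i s hi ih =>
    simp only [Finset.prod_insert hi]
    exact (h i (Finset.mem_insert_self _ _)).mul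
      (ih fun j hj => h j (Finset.mem_insert_of_mem hj))

/-- Write `h` as t^n times an analytic function nonvanishing at 0, whose inverse is analytic. -/
theorem HasLaurent.inv {h : ℂ → ℂ} (hh : AnalyticAt ℂ h 0)
    (h0 : HahnSeries.ofPowerSeries ℤ ℂ (taylorPS h) ≠ 0) :
    HasLaurent (fun t => (h t)⁻¹) (HahnSeries.ofPowerSeries ℤ ℂ (taylorPS h))⁻¹ := by
  have hne : ¬ ∀ᶠ z in 𝓝 (0 : ℂ), h z = 0 := by
    intro hz
    apply h0
    have : taylorPS h = 0 := by
      rw [taylorPS_congr (g := fun _ => 0) hz, taylorPS_const, map_zero]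
    rw [this, map_zero]
  obtain ⟨n, u, hu, hu0, hhu⟩ := hh.exists_eventuallyEq_pow_smul_nonzero_iff.2 hne
  simp only [sub_zero, smul_eq_mul] at hhu
  refine ⟨n, fun t => (u t)⁻¹, hu.inv hu0, ?_, ?_⟩
  · filter_upwards [eventually_nhdsWithin_of_eventually_nhds hhu, self_mem_nhdsWithin] with t ht ht0
    rw [ht, mul_inv, ← mul_assoc, mul_inv_cancel₀ (pow_ne_zero _ ht0), one_mul]
  · refine inv_eq_of_mul_eq_one_right ?_
    have h1 : taylorPS h = PowerSeries.X ^ n * taylorPS u := by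
      rw [taylorPS_congr hhu, taylorPS_pow_mul n hu]
    have hinv : AnalyticAt ℂ (fun t => (u t)⁻¹) 0 := hu.inv hu0
    have h2 : taylorPS u * taylorPS (fun t => (u t)⁻¹) = 1 := by
      rw [← taylorPS_mul hu hinv, taylorPS_congr (g := fun _ => 1), taylorPS_const, map_one]
      filter_upwards [hu.continuousAt.eventually_ne hu0] with t ht
      exact mul_inv_cancel₀ ht
    have h3 := congrArg (HahnSeries.ofPowerSeries ℤ ℂ) h2
    rw [map_mul, map_one] at h3
    rw [h1, map_mul]
    linear_combination (HahnSeries.ofPowerSeries ℤ ℂ (taylorPS u)) *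
      (HahnSeries.ofPowerSeries ℤ ℂ (taylorPS fun t => (u t)⁻¹)) * single_mul_ofPowerSeries_X_pow n + h3

theorem hasLaurent_cexp (c : ℂ) : HasLaurent (fun t => Complex.exp (c * t)) (expLS c) := by
  have := HasLaurent.of_analyticAt (h := fun t => Complex.exp (c * t)) (by fun_prop)
  rwa [taylorPS_cexp] at this

theorem hasLaurent_geom {c u : ℂ} (h : c = 1 → u ≠ 0) :
    HasLaurent (fun t => (1 - c * Complex.exp (-u * t))⁻¹) (geomLS c u) := by
  have h1 : taylorPS (fun t => 1 - c * Complex.exp (-u * t)) = 1 - PowerSeries.C c * expPS (-u) := by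
    rw [taylorPS_sub analyticAt_const (by fun_prop), taylorPS_mul analyticAt_const (by fun_prop),
      taylorPS_const, taylorPS_const, taylorPS_cexp, map_one]
  have h2 : HahnSeries.ofPowerSeries ℤ ℂ (1 - PowerSeries.C c * expPS (-u)) =
      1 - HahnSeries.C c * expLS (-u) := by
    rw [map_sub, map_one, map_mul, HahnSeries.ofPowerSeries_C, expLS]
  have h3 := HasLaurent.inv (h := fun t => 1 - c * Complex.exp (-u * t)) (by fun_prop)
    (by rw [h1, h2]; exact one_sub_mul_expLS_ne_zero h)
  rwa [h1, h2] at h3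

variable {V : Type*} [NormedAddCommGroup V] [NormedSpace ℝ V] {N : ℕ}

theorem homComponent_eq (β : Fin N → StrongDual ℝ V) (l : StrongDual ℝ V) (c : Fin N → ℂ) (m : ℤ)
    (z : complement β) :
    homComponent β (fun z => Complex.exp (pair l z) /
      ∏ i, (1 - c i * Complex.exp (-pair (β i) z))) m z =
      (expLS (pair l (z : VC V)) * ∏ i, geomLS (c i) (pair (β i) (z : VC V))).coeff m := by
  refine HasLaurent.laurentCoeff_eq ?_ m
  have h1 := (hasLaurent_cexp (pair l (z : VC V))).mul (HasLaurent.prod Finset.univ fun i _ =>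
    hasLaurent_geom (c := c i) (u := pair (β i) (z : VC V)) fun _ => z.2 i)
  convert h1 using 2 with t
  simp only [Finset.prod_inv_distrib, div_eq_mul_inv, map_smul, smul_eq_mul, mul_comm t, neg_mul]

theorem homComponent_mem_ratFun (β : Fin N → StrongDual ℝ V) (l : StrongDual ℝ V) (c : Fin N → ℂ)
    (m : ℤ) :
    homComponent β (fun z => Complex.exp (pair l z) /
      ∏ i, (1 - c i * Complex.exp (-pair (β i) z))) m ∈ ratFun β := by
  have hlin : ∀ l : StrongDual ℝ V, (fun z : complement β => pair l (z : VC V)) ∈ ratFun β :=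
    fun l => Algebra.subset_adjoin (Or.inl ⟨pair l, rfl⟩)
  have h1 : IsLaurentIn (ratFun β) fun z : complement β =>
      expLS (pair l (z : VC V)) * (Finset.univ.val.map fun i => geomLS (c i) (pair (β i) (z : VC V))).prod :=
    (IsLaurentIn.expLS (hlin l)).mul (IsLaurentIn.multiset_prod _ fun i _ =>
      IsLaurentIn.geomLS (hlin _) fun _ => ⟨fun z => z.2 i, Algebra.subset_adjoin (Or.inr ⟨i, rfl⟩)⟩)
  convert h1.coeff_mem m using 1
  ext z
  exact homComponent_eq β l c m z

end Laurent

/-! ### The total residue and the Jeffrey–Kirwan residue -/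

section TotalResidue

open Filter

variable {V : Type*} [NormedAddCommGroup V] [NormedSpace ℝ V] [FiniteDimensional ℝ V]
  {Γ : Submodule ℤ V} {N : ℕ} {β : Fin N → StrongDual ℝ V} {a : StrongDual ℝ V}
  {e : Module.Basis (Fin (Module.finrank ℝ V)) ℝ (StrongDual ℝ V)}

/-- The restriction of functions from the complement of the hyperplanes to the tube. -/
def restrictTube (β : Fin N → StrongDual ℝ V) : (complement β → ℂ) →ₗ[ℂ] (tube β → ℂ) :=
  LinearMap.funLeft ℂ ℂ (Set.inclusion (tube_subset_complement β))

theorem restrictTube_apply (f : complement β → ℂ) (z : tube β) :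
    restrictTube β f z = f ⟨z, tube_subset_complement β z.2⟩ := rfl

theorem extend_val_apply {f : complement β → ℂ} {w : VC V} (hw : w ∈ complement β) :
    Function.extend Subtype.val f 0 w = f ⟨w, hw⟩ :=
  Subtype.val_injective.extend_apply f 0 (⟨w, hw⟩ : complement β)

theorem extend_val_of_notMem {f : complement β → ℂ} {w : VC V} (hw : w ∉ complement β) :
    Function.extend Subtype.val f 0 w = 0 :=
  Function.extend_apply' _ _ _ (by rintro ⟨z, rfl⟩; exact hw z.2)

theorem dirDeriv_eq {f : complement β → ℂ} {v : VC V} {D : complement β → ℂ}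
    (h : ∀ z : complement β, HasDerivAt (fun t : ℂ => Function.extend Subtype.val f 0
      ((z : VC V) + t • v)) (D z) 0) : dirDeriv β v f = D := by
  ext z
  exact (h z).deriv

theorem hasDerivAt_laurentMono {κ : Type*} [Fintype κ] [DecidableEq κ] {σ : κ → StrongDual ℝ V}
    (hσ : ∀ k, σ k ∈ Set.range β) (m : κ → ℤ) (v : VC V) (z : complement β) :
    HasDerivAt (fun t : ℂ => Function.extend Subtype.val
      (fun z : complement β => laurentMono σ m z) 0 ((z : VC V) + t • v))
      (∑ k, (m k * pair (σ k) v) * laurentMono σ (Function.update m k (m k - 1)) z) 0 := by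
  have hne : ∀ k, pair (σ k) (z : VC V) ≠ 0 := fun k => by
    obtain ⟨i, hi⟩ := hσ k
    rw [← hi]
    exact z.2 i
  -- The extension by 0 does not matter: the line through `z` stays in the complement for small `t`.
  have hev : (fun t : ℂ => Function.extend Subtype.val
      (fun z : complement β => laurentMono σ m z) 0 ((z : VC V) + t • v)) =ᶠ[𝓝 0]
      fun t => ∏ k, (pair (σ k) (z : VC V) + t * pair (σ k) v) ^ m k := by
    have : ∀ i, ∀ᶠ t in 𝓝 (0 : ℂ), pair (β i) (z : VC V) + t * pair (β i) v ≠ 0 := by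
      intro i
      have hc : ContinuousAt (fun t : ℂ => pair (β i) (z : VC V) + t * pair (β i) v) 0 := by fun_prop
      exact hc.eventually_ne (by simpa using z.2 i)
    filter_upwards [eventually_all.2 this] with t ht
    have hw : (z : VC V) + t • v ∈ complement β := fun i => by
      rw [map_add, map_smul, smul_eq_mul]
      exact ht i
    rw [extend_val_apply hw]
    exact Finset.prod_congr rfl fun k _ => by rw [map_add, map_smul, smul_eq_mul]
  refine HasDerivAt.congr_of_eventuallyEq ?_ hev
  have hk : ∀ k, HasDerivAt (fun t : ℂ => (pair (σ k) (z : VC V) + t * pair (σ k) v) ^ m k)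
      ((m k * pair (σ k) (z : VC V) ^ (m k - 1)) * pair (σ k) v) 0 := by
    intro k
    have h1 : HasDerivAt (fun t : ℂ => pair (σ k) (z : VC V) + t * pair (σ k) v) (pair (σ k) v) 0 := by
      simpa using ((hasDerivAt_id (0 : ℂ)).mul_const (pair (σ k) v)).const_add (pair (σ k) (z : VC V))
    have h2 := hasDerivAt_zpow (m k) (pair (σ k) (z : VC V) + 0 * pair (σ k) v)
      (Or.inl (by simpa using hne k))
    have h3 := HasDerivAt.comp (0 : ℂ) h2 h1
    simpa [Function.comp_def] using h3
  have hprod := HasDerivAt.fun_finsetProd (u := Finset.univ) fun k _ => hk k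
  have hsum : ∀ k, (m k * pair (σ k) v) * laurentMono σ (Function.update m k (m k - 1)) (z : VC V) =
      (∏ j ∈ Finset.univ.erase k, (pair (σ j) (z : VC V) + 0 * pair (σ j) v) ^ m j) •
        ((m k * pair (σ k) (z : VC V) ^ (m k - 1)) * pair (σ k) v) := fun k => by
    rw [laurentMono, ← Finset.mul_prod_erase _ _ (Finset.mem_univ k), Function.update_self]
    have : ∏ j ∈ Finset.univ.erase k, pair (σ j) (z : VC V) ^ Function.update m k (m k - 1) j =
        ∏ j ∈ Finset.univ.erase k, (pair (σ j) (z : VC V) + 0 * pair (σ j) v) ^ m j :=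
      Finset.prod_congr rfl fun j hj => by
        rw [Function.update_of_ne (Finset.ne_of_mem_erase hj), zero_mul, add_zero]
    rw [this, smul_eq_mul]
    ring
  rw [Finset.sum_congr rfl fun k _ => hsum k]
  exact hprod

/-- The restricted functional takes the values of the residue on Laurent monomials. -/
theorem IsResidue.apply_restrictTube {J : (tube β → ℂ) →ₗ[ℂ] ℂ} (hJ : IsResidue e a J)
    (ha : IsGeneric Γ a) (hβ : ∀ i, β i ∈ dualLattice Γ)
    {σ : Fin (Module.finrank ℝ V) → StrongDual ℝ V} (hσ : LinearIndependent ℝ σ)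
    (hr : ∀ k, σ k ∈ Set.range β) (m : Fin (Module.finrank ℝ V) → ℤ) :
    J (restrictTube β fun z => laurentMono σ m z) = jkValue e a σ m := by
  refine hJ (ha.genTuple hσ (fun k => ?_) fun k => ?_) m
  · obtain ⟨i, hi⟩ := hr k
    exact hi ▸ hβ i
  · obtain ⟨i, hi⟩ := hr k
    exact hi ▸ posForm_apply β i

/-- Differentiating a Laurent monomial lowers the exponent of `σ k` by one and produces the factor
`m k`. An exponent -1 could only arise from `m k = 0`, where the factor vanishes. -/
theorem IsResidue.apply_derivs {J : (tube β → ℂ) →ₗ[ℂ] ℂ} (hJ : IsResidue e a J)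
    (ha : IsGeneric Γ a) (hβ : ∀ i, β i ∈ dualLattice Γ)
    (hspan : Submodule.span ℝ (Set.range β) = ⊤) {g : complement β → ℂ} (hg : g ∈ derivs β) :
    J (restrictTube β g) = 0 := by
  have key : ∀ f ∈ monoSpan (complement β) (Set.range β) (Set.range β), ∀ v : VC V,
      ∃ D : complement β → ℂ, (∀ z : complement β, HasDerivAt (fun t : ℂ =>
        Function.extend Subtype.val f 0 ((z : VC V) + t • v)) (D z) 0) ∧ J (restrictTube β D) = 0 := by
    intro f hf v
    induction hf using Submodule.span_induction with
    | zero =>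
      refine ⟨0, fun z => ?_, by rw [map_zero, map_zero]⟩
      have : (fun t : ℂ => Function.extend Subtype.val (0 : complement β → ℂ) 0 ((z : VC V) + t • v)) =
          fun _ => 0 := by
        ext t
        by_cases hw : (z : VC V) + t • v ∈ complement β
        · rw [extend_val_apply hw]; rfl
        · rw [extend_val_of_notMem hw]
      rw [this]
      exact hasDerivAt_const _ _
    | add f g _ _ hf hg =>
      obtain ⟨D, hD, hDJ⟩ := hf
      obtain ⟨D', hD', hDJ'⟩ := hg
      refine ⟨D + D', fun z => ?_, by rw [map_add, map_add, hDJ, hDJ', add_zero]⟩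
      have : (fun t : ℂ => Function.extend Subtype.val (f + g) 0 ((z : VC V) + t • v)) =
          fun t => Function.extend Subtype.val f 0 ((z : VC V) + t • v) +
            Function.extend Subtype.val g 0 ((z : VC V) + t • v) := by
        ext t
        by_cases hw : (z : VC V) + t • v ∈ complement β
        · rw [extend_val_apply hw, extend_val_apply hw, extend_val_apply hw]; rfl
        · rw [extend_val_of_notMem hw, extend_val_of_notMem hw, extend_val_of_notMem hw, add_zero]
      rw [this]
      exact (hD z).add (hD' z)
    | smul c f _ hf =>
      obtain ⟨D, hD, hDJ⟩ := hf
      refine ⟨c • D, fun z => ?_, by rw [map_smul, map_smul, hDJ, smul_zero]⟩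
      have : (fun t : ℂ => Function.extend Subtype.val (c • f) 0 ((z : VC V) + t • v)) =
          fun t => c * Function.extend Subtype.val f 0 ((z : VC V) + t • v) := by
        ext t
        by_cases hw : (z : VC V) + t • v ∈ complement β
        · rw [extend_val_apply hw, extend_val_apply hw]; rfl
        · rw [extend_val_of_notMem hw, extend_val_of_notMem hw, mul_zero]
      rw [this]
      exact (hD z).const_mul c
    | mem f hf =>
      obtain ⟨σ, hσ, hB, m, _, rfl⟩ := hf
      refine ⟨_, fun z => hasDerivAt_laurentMono hB m v z, ?_⟩
      have h1 : (fun z : complement β => ∑ k, (m k * pair (σ k) v) *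
          laurentMono σ (Function.update m k (m k - 1)) (z : VC V)) =
          ∑ k, (m k * pair (σ k) v) • fun z : complement β =>
            laurentMono σ (Function.update m k (m k - 1)) (z : VC V) := by
        ext z
        simp [Finset.sum_apply]
      rw [h1, map_sum, map_sum]
      refine Finset.sum_eq_zero fun k _ => ?_
      rw [map_smul, map_smul, hJ.apply_restrictTube ha hβ hσ hB, jkValue]
      split_ifs with h2
      · have h3 := h2.1 k
        rw [Function.update_self] at h3
        have h4 : m k = 0 := by omega
        rw [h4]
        simp
      · exact smul_zero _
  induction hg using Submodule.span_induction with
  | zero => rw [map_zero, map_zero]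
  | add x y _ _ hx hy => rw [map_add, map_add, hx, hy, add_zero]
  | smul c x _ hx => rw [map_smul, map_smul, hx, smul_zero]
  | mem g hg =>
    obtain ⟨v, f, hf, rfl⟩ := hg
    obtain ⟨D, hD, hDJ⟩ := key f (mem_monoSpan_of_mem_monoMultiplier hspan
      (ratFun_le_monoMultiplier β hf)) v
    rw [dirDeriv_eq hD, hDJ]

theorem laurentMono_mem_ratFun {κ : Type*} [Fintype κ] {σ : κ → StrongDual ℝ V}
    (hσ : ∀ k, σ k ∈ Set.range β) (m : κ → ℤ) :
    (fun z : complement β => laurentMono σ m z) ∈ ratFun β := by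
  have h1 : (fun z : complement β => laurentMono σ m z) =
      ∏ k, fun z : complement β => pair (σ k) (z : VC V) ^ m k := by
    ext z
    simp [laurentMono, Finset.prod_apply]
  rw [h1]
  refine Subalgebra.prod_mem _ fun k _ => ?_
  obtain ⟨i, hi⟩ := hσ k
  rcases m k with j | j
  · have : (fun z : complement β => pair (σ k) (z : VC V) ^ (Int.ofNat j)) =
        (fun z : complement β => pair (σ k) (z : VC V)) ^ j := by
      ext z
      simp
    rw [this]
    have hmem : (fun z : complement β => pair (σ k) (z : VC V)) ∈ ratFun β :=
      Algebra.subset_adjoin (Or.inl ⟨_, rfl⟩)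
    exact pow_mem hmem j
  · have : (fun z : complement β => pair (σ k) (z : VC V) ^ (Int.negSucc j)) =
        (fun z : complement β => (pair (β i) (z : VC V))⁻¹) ^ (j + 1) := by
      ext z
      simp [hi, zpow_negSucc]
    rw [this]
    have hmem : (fun z : complement β => (pair (β i) (z : VC V))⁻¹) ∈ ratFun β :=
      Algebra.subset_adjoin (Or.inr ⟨i, rfl⟩)
    exact pow_mem hmem _

/-- The decomposition of rational functions into derivatives and simple elements. -/
theorem exists_sub_mem_derivs (hspan : Submodule.span ℝ (Set.range β) = ⊤) {f : complement β → ℂ}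
    (hf : f ∈ ratFun β) : ∃ s : simpleElts β, f - (s : complement β → ℂ) ∈ derivs β := by
  have hmem := mem_monoSpan_of_mem_monoMultiplier hspan (ratFun_le_monoMultiplier β hf)
  clear hf
  induction hmem using Submodule.span_induction with
  | zero => exact ⟨0, by simp⟩
  | add x y _ _ hx hy =>
    obtain ⟨s, hs⟩ := hx
    obtain ⟨t, ht⟩ := hy
    refine ⟨s + t, ?_⟩
    rw [Submodule.coe_add, add_sub_add_comm]
    exact add_mem hs ht
  | smul c x _ hx =>
    obtain ⟨s, hs⟩ := hx
    refine ⟨c • s, ?_⟩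
    rw [Submodule.coe_smul, ← smul_sub]
    exact Submodule.smul_mem _ _ hs
  | mem f hf =>
    obtain ⟨σ, hσ, hB, m, _, rfl⟩ := hf
    by_cases hm : ∀ k, m k = -1
    · choose i hi using hB
      have hi' : (fun k => β (i k)) = σ := funext hi
      refine ⟨⟨_, Submodule.subset_span ⟨i, by rw [IsBasisTuple, hi']; exact hσ, rfl⟩⟩, ?_⟩
      have h0 : ∀ g : complement β → ℂ, g = 0 → g ∈ derivs β := by
        rintro _ rfl
        exact zero_mem _
      refine h0 _ ?_
      ext z
      simp only [Pi.sub_apply, Pi.zero_apply, simpleFrac, laurentMono, hi, hm, zpow_neg_one]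
      rw [Finset.prod_inv_distrib, sub_self]
    · push Not at hm
      obtain ⟨k, hk⟩ := hm
      refine ⟨0, ?_⟩
      rw [Submodule.coe_zero, sub_zero]
      -- An exponent other than -1 can be integrated: the monomial is the derivative along the dual
      -- vector of the one with exponent `m k + 1`, divided by `m k + 1`.
      obtain ⟨u, hu⟩ := exists_dual_basis (tupleBasis σ hσ)
      rw [coe_tupleBasis] at hu
      have h1 := dirDeriv_eq fun z =>
        hasDerivAt_laurentMono hB (Function.update m k (m k + 1)) ((1 : ℂ) ⊗ₜ[ℝ] u k) z
      have h2 : (fun z : complement β => laurentMono σ m (z : VC V)) =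
          ((m k : ℂ) + 1)⁻¹ • dirDeriv β ((1 : ℂ) ⊗ₜ[ℝ] u k)
            (fun z : complement β => laurentMono σ (Function.update m k (m k + 1)) z) := by
        rw [h1]
        ext z
        have hk0 : (m k : ℂ) + 1 ≠ 0 := by
          intro h0
          apply hk
          have : ((m k + 1 : ℤ) : ℂ) = 0 := by push_cast; exact h0
          have := Int.cast_eq_zero.1 this
          omega
        rw [Pi.smul_apply, smul_eq_mul, Finset.sum_eq_single k]
        · rw [pair_tmul, hu, if_pos rfl, Function.update_self, Function.update_idem,
            add_sub_cancel_right, Function.update_eq_self]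
          push_cast
          field_simp
        · intro j _ hj
          rw [pair_tmul, hu, if_neg hj]
          simp
        · simp
      rw [h2]
      exact Submodule.smul_mem _ _ (Submodule.subset_span ⟨_, _, laurentMono_mem_ratFun hB _, rfl⟩)

/-- The Jeffrey–Kirwan residue of the total residue is computed by the residue functional. -/
theorem JK_Tres_eq {J : (tube β → ℂ) →ₗ[ℂ] ℂ} (hJ : IsResidue e a J)
    (ha : IsGeneric Γ a) (hβ : ∀ i, β i ∈ dualLattice Γ)
    (hspan : Submodule.span ℝ (Set.range β) = ⊤) {c : Set (StrongDual ℝ V)}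
    (hc : ∀ σ : Fin (Module.finrank ℝ V) → Fin N, IsBasisTuple β σ →
      (c ⊆ coneOf (fun k => β (σ k)) ↔ a ∈ coneOf (fun k => β (σ k))))
    (hvol : ∀ σ : Fin (Module.finrank ℝ V) → StrongDual ℝ V,
      ((volDual Γ) (parallelepiped σ)).toReal = |e.det σ|)
    {f : VC V → ℂ} (hf : homComponent β f (-(Module.finrank ℝ V : ℤ)) ∈ ratFun β) :
    JK Γ β c (Tres β f) = J (restrictTube β (homComponent β f (-(Module.finrank ℝ V : ℤ)))) := by
  -- The restriction of `J` shows that the Jeffrey–Kirwan functional exists; being determined on the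
  -- spanning `f_σ`, it equals this restriction.
  have hJK : IsJK Γ β c (J ∘ₗ restrictTube β ∘ₗ (simpleElts β).subtype) := by
    intro σ hσ
    have h1 : simpleFrac β σ = fun z : complement β => laurentMono (fun k => β (σ k)) (fun _ => -1) z := by
      ext z
      simp only [simpleFrac, laurentMono, zpow_neg_one]
      rw [Finset.prod_inv_distrib]
    change J (restrictTube β (simpleFrac β σ)) = _
    rw [h1,
      hJ.apply_restrictTube ha hβ hσ fun k => ⟨σ k, rfl⟩, jkValue, hvol]
    by_cases hcone : a ∈ coneOf (fun k => β (σ k))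
    · rw [if_pos ⟨fun _ => rfl, hcone⟩, if_pos ((hc σ hσ).2 hcone)]
      push_cast
      rfl
    · rw [if_neg (fun h => hcone h.2), if_neg (fun h => hcone ((hc σ hσ).1 h))]
  have hex : ∃ J : simpleElts β →ₗ[ℂ] ℂ, IsJK Γ β c J := ⟨_, hJK⟩
  have hval : ∀ s : simpleElts β, JK Γ β c s = J (restrictTube β (s : complement β → ℂ)) := by
    rintro ⟨s, hs⟩
    rw [JK, dif_pos hex]
    induction hs using Submodule.span_induction with
    | mem s hs =>
      obtain ⟨σ, hσ, rfl⟩ := hs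
      exact (hex.choose_spec σ hσ).trans (hJK σ hσ).symm
    | zero =>
      have : (⟨0, zero_mem _⟩ : simpleElts β) = 0 := rfl
      rw [this]
      simp
    | add x y hx hy ihx ihy =>
      have : (⟨x + y, add_mem hx hy⟩ : simpleElts β) = ⟨x, hx⟩ + ⟨y, hy⟩ := rfl
      rw [this, map_add, ihx, ihy, Submodule.coe_add, map_add, map_add]
    | smul r x hx ihx =>
      have : (⟨r • x, Submodule.smul_mem _ _ hx⟩ : simpleElts β) = r • ⟨x, hx⟩ := rfl
      rw [this, map_smul, ihx, Submodule.coe_smul, map_smul, map_smul]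
  have hs := exists_sub_mem_derivs hspan hf
  rw [hval, Tres, dif_pos hs]
  have h1 := hJ.apply_derivs ha hβ hspan hs.choose_spec
  rw [map_sub, map_sub, sub_eq_zero] at h1
  exact h1.symm

end TotalResidue

/-! ### Big chambers -/

section Chambers

variable {V : Type*} [NormedAddCommGroup V] [NormedSpace ℝ V] [FiniteDimensional ℝ V]
  {Γ : Submodule ℤ V} {N : ℕ} {β : Fin N → StrongDual ℝ V} {c : Set (StrongDual ℝ V)}

/-- A functional positive on the generators bounds the coefficients, so near any point the cone is
contained in a compact image of a box that is itself part of the cone. -/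
theorem isClosed_coneOf {κ W : Type*} [Fintype κ] [NormedAddCommGroup W] [NormedSpace ℝ W]
    {w : κ → W} (f : W →L[ℝ] ℝ) (hf : ∀ k, 0 < f (w k)) : IsClosed (coneOf w) := by
  refine isClosed_of_closure_subset fun a ha => ?_
  set K : Set W := (fun x : κ → ℝ => ∑ k, x k • w k) ''
    Set.Icc 0 (fun k => (f a + 1) / f (w k)) with hK
  have hKc : IsCompact K := isCompact_Icc.image (by fun_prop)
  have hKs : K ⊆ coneOf w := by
    rintro _ ⟨x, hx, rfl⟩
    exact ⟨x, fun k => hx.1 k, rfl⟩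
  have hU : IsOpen {b : W | f b < f a + 1} := isOpen_lt (by fun_prop) continuous_const
  have h1 : a ∈ closure ({b : W | f b < f a + 1} ∩ coneOf w) :=
    hU.inter_closure ⟨by simp, ha⟩
  refine hKs (hKc.isClosed.closure_subset_iff.2 ?_ h1)
  rintro b ⟨hb, x, hx, rfl⟩
  refine ⟨x, ⟨hx, fun k => ?_⟩, rfl⟩
  rw [le_div_iff₀ (hf k)]
  have h2 : x k * f (w k) ≤ ∑ j, x j * f (w j) :=
    Finset.single_le_sum (f := fun j => x j * f (w j))
      (fun j _ => mul_nonneg (hx j) (hf j).le) (Finset.mem_univ k)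
  have h3 : f (∑ j, x j • w j) < f a + 1 := hb
  rw [map_sum] at h3
  simp only [map_smul, smul_eq_mul] at h3
  exact h2.trans h3.le

theorem isOpen_regular (hpos : ∃ v : V, ∀ i, 0 < β i v) : IsOpen (regular β) := by
  obtain ⟨v, hv⟩ := hpos
  have : regular β = ⋂ ν : Finset (Fin N), {a | ν.card < Module.finrank ℝ V →
      a ∉ coneOf (fun i : ν => β i)} := by
    ext a
    simp [regular]
  rw [this]
  refine isOpen_iInter_of_finite fun ν => ?_
  by_cases hν : ν.card < Module.finrank ℝ V
  · simp only [hν, true_imp_iff]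
    exact (isClosed_coneOf (ContinuousLinearMap.apply ℝ ℝ v) fun i : ν => hv i).isOpen_compl
  · simp [hν]

theorem IsBigChamber.isOpen (hc : IsBigChamber β c) (hpos : ∃ v : V, ∀ i, 0 < β i v) :
    IsOpen c := by
  obtain ⟨a, _, rfl⟩ := hc
  exact (isOpen_regular hpos).connectedComponentIn

theorem IsBigChamber.nonempty (hc : IsBigChamber β c) : c.Nonempty := by
  obtain ⟨a, ha, rfl⟩ := hc
  exact ⟨a, mem_connectedComponentIn ha⟩

/-- A zero coordinate would put `a` in the cone of `n - 1` elements of the system. -/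
theorem repr_pos_of_mem_regular {a : StrongDual ℝ V} (ha : a ∈ regular β)
    {σ : Fin (Module.finrank ℝ V) → Fin N} (hσ : IsBasisTuple β σ)
    (hcone : a ∈ coneOf (fun k => β (σ k))) (k : Fin (Module.finrank ℝ V)) :
    0 < (tupleBasis (fun k => β (σ k)) hσ).repr a k := by
  have h1 := (mem_coneOf_iff hσ a).1 hcone
  refine lt_of_le_of_ne (h1 k) fun h0 => ?_
  refine ha ((Finset.univ.erase k).image σ) ?_ ?_
  · refine Finset.card_image_le.trans_lt ?_
    rw [Finset.card_erase_of_mem (Finset.mem_univ k), Finset.card_univ, Fintype.card_fin]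
    exact Nat.sub_lt (Fin.pos k) one_pos
  · have hinj : Function.Injective σ := fun i j hij =>
      hσ.injective (show β (σ i) = β (σ j) by rw [hij])
    obtain ⟨τ, hτ⟩ : ∃ τ : Fin N → Fin (Module.finrank ℝ V), ∀ j, τ (σ j) = j :=
      ⟨Function.extend σ id (fun _ => k), fun j => hinj.extend_apply _ _ j⟩
    refine ⟨fun i => (tupleBasis (fun k => β (σ k)) hσ).repr a (τ i), fun i => h1 _, ?_⟩
    have h2 := (tupleBasis (fun k => β (σ k)) hσ).sum_repr a
    rw [← Finset.add_sum_erase _ _ (Finset.mem_univ k), ← h0, zero_smul, zero_add] at h2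
    conv_lhs => rw [← h2]
    rw [Finset.sum_coe_sort ((Finset.univ.erase k).image σ) fun i =>
      (tupleBasis (fun k => β (σ k)) hσ).repr a (τ i) • β i,
      Finset.sum_image fun i _ j _ h => hinj h]
    exact Finset.sum_congr rfl fun j _ => by
      rw [hτ, ← congrFun (coe_tupleBasis (fun k => β (σ k)) hσ) j]

/-- A big chamber is contained in any simplicial cone that it meets. -/
theorem IsBigChamber.subset_coneOf_iff (hc : IsBigChamber β c) {a : StrongDual ℝ V} (ha : a ∈ c)
    {σ : Fin (Module.finrank ℝ V) → Fin N} (hσ : IsBasisTuple β σ) :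
    c ⊆ coneOf (fun k => β (σ k)) ↔ a ∈ coneOf (fun k => β (σ k)) := by
  refine ⟨fun h => h ha, fun h => ?_⟩
  obtain ⟨a₀, ha₀, rfl⟩ := hc
  set b := tupleBasis (fun k => β (σ k)) hσ
  have hcont : ∀ k, Continuous fun x : StrongDual ℝ V => b.repr x k := fun k =>
    (b.coord k).continuous_of_finiteDimensional
  have hsub := connectedComponentIn_subset (regular β) a₀
  have hU : IsOpen (⋂ k, {x | 0 < b.repr x k}) :=
    isOpen_iInter_of_finite fun k => isOpen_lt continuous_const (hcont k)
  have hW : IsOpen (⋃ k, {x | b.repr x k < 0}) :=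
    isOpen_iUnion fun k => isOpen_lt (hcont k) continuous_const
  -- On regular vectors a point with no negative coordinate has all coordinates positive. The
  -- chamber is therefore covered by two disjoint open sets and, being connected, lies in one.
  have key := (isPreconnected_connectedComponentIn (x := a₀) (F := regular β)).subset_left_of_subset_union hU hW
    (Set.disjoint_left.2 fun x hx hx' => by
      obtain ⟨k, hk⟩ := Set.mem_iUnion.1 hx'
      exact lt_asymm (show 0 < b.repr x k from Set.mem_iInter.1 hx k) (show b.repr x k < 0 from hk))
    (fun x hx => by
      by_cases h : x ∈ coneOf (fun k => β (σ k))
      · exact Or.inl (Set.mem_iInter.2 (repr_pos_of_mem_regular (hsub hx) hσ h))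
      · rw [mem_coneOf_iff hσ] at h
        push Not at h
        exact Or.inr (Set.mem_iUnion.2 h))
    ⟨a, ha, Set.mem_iInter.2 (repr_pos_of_mem_regular (hsub ha) hσ h)⟩
  exact fun x hx => (mem_coneOf_iff hσ x).2 fun k => (Set.mem_iInter.1 (key hx) k).le

theorem countable_dualLattice {e : Module.Basis (Fin (Module.finrank ℝ V)) ℝ (StrongDual ℝ V)}
    {γ : Module.Basis (Fin (Module.finrank ℝ V)) ℝ V} (h : IsDualPair Γ e γ) :
    (dualLattice Γ : Set (StrongDual ℝ V)).Countable := by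
  have : Countable (dualLattice Γ) := h.intBasis.equivFun.toEquiv.countable_iff.2 inferInstance
  exact Set.to_countable _

/-- The proper subspaces spanned by finite subsets of the countable `Γ*` are countably many null
sets; they cannot cover a nonempty open set. -/
theorem exists_isGeneric_mem {e : Module.Basis (Fin (Module.finrank ℝ V)) ℝ (StrongDual ℝ V)}
    {γ : Module.Basis (Fin (Module.finrank ℝ V)) ℝ V} (h : IsDualPair Γ e γ)
    {U : Set (StrongDual ℝ V)} (hU : IsOpen U) (hne : U.Nonempty) : ∃ a ∈ U, IsGeneric Γ a := by
  set B : Set (Set (StrongDual ℝ V)) :=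
    {t | (t.Finite ∧ t ⊆ (dualLattice Γ : Set (StrongDual ℝ V))) ∧ Submodule.span ℝ t ≠ ⊤}
  have hB : B.Countable :=
    (Set.countable_ofPred_finite_subset (countable_dualLattice h)).mono fun t ht => ht.1
  have h0 : e.addHaar (⋃ t ∈ B, (Submodule.span ℝ t : Set (StrongDual ℝ V))) = 0 :=
    (MeasureTheory.measure_biUnion_null_iff hB).2 fun t ht =>
      MeasureTheory.Measure.addHaar_submodule _ _ ht.2
  obtain ⟨a, haU, ha⟩ : ∃ a ∈ U, a ∉ ⋃ t ∈ B, (Submodule.span ℝ t : Set (StrongDual ℝ V)) := by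
    by_contra! hcon
    exact (hU.measure_pos e.addHaar hne).ne' (MeasureTheory.measure_mono_null hcon h0)
  refine ⟨a, haU, fun s hs hcard hmem => ha ?_⟩
  refine Set.mem_biUnion (x := (s : Set (StrongDual ℝ V))) ⟨⟨s.finite_toSet, hs⟩, fun htop => ?_⟩ hmem
  have h1 := finrank_span_finset_le_card (R := ℝ) s
  rw [Set.finrank, htop, finrank_top, finrank_strongDual] at h1
  omega

theorem zero_mem_parallelepiped : (0 : StrongDual ℝ V) ∈ parallelepiped β :=
  (mem_parallelepiped_iff β 0).2 ⟨0, ⟨le_rfl, zero_le_one⟩, by simp⟩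

theorem interior_parallelepiped_nonempty (hspan : Submodule.span ℝ (Set.range β) = ⊤) :
    (interior (parallelepiped β)).Nonempty := by
  have h0 : (0 : StrongDual ℝ V) ∈ parallelepiped β := zero_mem_parallelepiped
  rw [(convex_parallelepiped β).interior_nonempty_iff_affineSpan_eq_top,
    AffineSubspace.affineSpan_eq_top_iff_vectorSpan_eq_top_of_nonempty ℝ _ _ ⟨0, h0⟩, eq_top_iff,
    ← hspan, Submodule.span_le]
  rintro _ ⟨i, rfl⟩
  have hi : β i ∈ parallelepiped β := by
    refine (mem_parallelepiped_iff β _).2 ⟨Pi.single i 1, ⟨?_, ?_⟩, ?_⟩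
    · exact Pi.single_nonneg.2 zero_le_one
    · intro j
      rcases eq_or_ne j i with rfl | hj
      · simp
      · simp [hj]
    · simp [Pi.single_apply]
  simpa using vsub_mem_vectorSpan ℝ hi h0

/-- If `l` lies in `c - Box(Φ)`, then `l ∈ a - Box(Φ)` for some generic `a` in the chamber. -/
theorem IsBigChamber.exists_isGeneric (hc : IsBigChamber β c) (hpos : ∃ v : V, ∀ i, 0 < β i v)
    (hspan : Submodule.span ℝ (Set.range β) = ⊤)
    {e : Module.Basis (Fin (Module.finrank ℝ V)) ℝ (StrongDual ℝ V)}
    {γ : Module.Basis (Fin (Module.finrank ℝ V)) ℝ V} (h : IsDualPair Γ e γ)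
    {l : StrongDual ℝ V} (hl : l ∈ c - parallelepiped β) :
    ∃ a ∈ c, IsGeneric Γ a ∧ a - l ∈ parallelepiped β := by
  obtain ⟨a₀, ha₀, p, hp, rfl⟩ := hl
  -- The point `p` may be on the boundary of the zonotope. It is moved to an interior point while
  -- the sum stays in the open chamber, leaving an open set of candidates for `a`.
  have hcl : p ∈ closure (interior (parallelepiped β)) := by
    rw [(convex_parallelepiped β).closure_interior_eq_closure_of_nonempty_interior
      (interior_parallelepiped_nonempty hspan)]
    exact subset_closure hp
  have hO : IsOpen {q : StrongDual ℝ V | a₀ - p + q ∈ c} :=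
    (hc.isOpen hpos).preimage (by fun_prop)
  obtain ⟨q, hq, hqi⟩ := mem_closure_iff.1 hcl _ hO (by simpa using ha₀)
  have hU : IsOpen (c ∩ {a | a - (a₀ - p) ∈ interior (parallelepiped β)}) :=
    (hc.isOpen hpos).inter (isOpen_interior.preimage (by fun_prop))
  obtain ⟨a, ha, hgen⟩ := exists_isGeneric_mem h hU ⟨a₀ - p + q, hq, by simpa using hqi⟩
  exact ⟨a, ha.1, hgen, interior_subset ha.2⟩

end Chambers

/-! ### The function `ι` -/

section Iota

variable {V : Type*} [NormedAddCommGroup V] [NormedSpace ℝ V] [FiniteDimensional ℝ V]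
  {Γ : Submodule ℤ V} {N : ℕ} {β : Fin N → StrongDual ℝ V} {a : StrongDual ℝ V}
  {c : Set (StrongDual ℝ V)}
  {e : Module.Basis (Fin (Module.finrank ℝ V)) ℝ (StrongDual ℝ V)}
  {γ : Module.Basis (Fin (Module.finrank ℝ V)) ℝ V}

/-- One factor ⟨l,z⟩ is expanded in dual bases: the additive characters `l ↦ l (γ k)` leave `J`, and
⟨e k, z⟩ is absorbed in `g`. For this induction `g` must be arbitrary. -/
theorem apply_pair_pow_mem_expPoly (h : IsDualPair Γ e γ) (J : (tube β → ℂ) →ₗ[ℂ] ℂ) (i : ℕ) :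
    ∀ g : tube β → ℂ, (fun l : dualLattice Γ => J fun z =>
      pair (l : StrongDual ℝ V) (z : VC V) ^ i * g z) ∈ expPoly (dualLattice Γ) := by
  induction i with
  | zero =>
    intro g
    simp only [pow_zero, one_mul]
    exact Subalgebra.algebraMap_mem (expPoly (dualLattice Γ)) (J g)
  | succ i ih =>
    intro g
    let x (k : Fin (Module.finrank ℝ V)) : dualLattice Γ →+ ℂ :=
      { toFun := fun l => ((l : StrongDual ℝ V) (γ k) : ℂ)
        map_zero' := by simp
        map_add' := by intro l l'; simp }
    have h1 : (fun l : dualLattice Γ => J fun z : tube β =>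
        pair (l : StrongDual ℝ V) (z : VC V) ^ (i + 1) * g z) =
        ∑ k, (fun l => x k l) * fun l : dualLattice Γ => J fun z : tube β =>
          pair (l : StrongDual ℝ V) (z : VC V) ^ i * (pair (e k) (z : VC V) * g z) := by
      ext l
      rw [Finset.sum_apply]
      have h2 : (fun z : tube β => pair (l : StrongDual ℝ V) (z : VC V) ^ (i + 1) * g z) =
          ∑ k, x k l • fun z : tube β =>
            pair (l : StrongDual ℝ V) (z : VC V) ^ i * (pair (e k) (z : VC V) * g z) := by
        ext z
        have h3 : pair (l : StrongDual ℝ V) (z : VC V) = ∑ k, x k l * pair (e k) (z : VC V) := by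
          conv_lhs => rw [form_eq_sum_apply_smul h.apply_eq (l : StrongDual ℝ V), pair_sum]
          exact Finset.sum_congr rfl fun k _ => pair_smul _ _ _
        rw [Finset.sum_apply, pow_succ, mul_assoc, mul_left_comm]
        conv_lhs => rw [h3, Finset.sum_mul]
        refine Finset.sum_congr rfl fun k _ => ?_
        rw [Pi.smul_apply, smul_eq_mul, ← h3]
        ring
      rw [h2, map_sum]
      exact Finset.sum_congr rfl fun k _ => map_smul J _ _
    rw [h1]
    exact Subalgebra.sum_mem _ fun k _ => mul_mem
      (Algebra.subset_adjoin (Or.inl ⟨x k, rfl⟩)) (ih _)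

/-- The denominators do not depend on `l`, so the pole order `r` is uniform and only finitely many
powers ⟨l,z⟩^i enter the coefficient. -/
theorem residueAt_mem_expPoly (h : IsDualPair Γ e γ) (J : (tube β → ℂ) →ₗ[ℂ] ℂ)
    (χ : AddChar (dualLattice Γ) ℂ) {Φ : Multiset (Weight (dualLattice Γ))}
    (hΦ : ∀ b ∈ Φ, PosForm β (b.1 : StrongDual ℝ V)) :
    residueAt J χ Φ ∈ expPoly (dualLattice Γ) := by
  obtain ⟨r, P, -, hP⟩ := IsLaurentIn.multiset_prod (𝒜 := (⊤ : Subalgebra ℂ (tube β → ℂ))) Φ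
    (G := fun b z => geomLS (mult b * χ (-b.1)) (pair (b.1 : StrongDual ℝ V) (z : VC V)))
    fun b hb => IsLaurentIn.geomLS Algebra.mem_top
      fun _ => ⟨fun z => (hΦ b hb).pair_ne_zero z.2, Algebra.mem_top⟩
  have hχ : (fun l => χ l) ∈ expPoly (dualLattice Γ) := Algebra.subset_adjoin (Or.inr ⟨χ, rfl⟩)
  have h1 : ∀ (l : dualLattice Γ) (z : tube β),
      (genSeries χ Φ l (z : VC V)).coeff (-(Module.finrank ℝ V : ℤ)) =
      χ l * if (-(Module.finrank ℝ V : ℤ)) + r < 0 then 0 else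
        PowerSeries.coeff (-(Module.finrank ℝ V : ℤ) + r).natAbs
          (expPS (pair (l : StrongDual ℝ V) (z : VC V)) * P z) := by
    intro l z
    beta_reduce at hP
    rw [genSeries, hP, mul_assoc, mul_left_comm (expLS _), expLS, ← map_mul, HahnSeries.C_apply,
      HahnSeries.coeff_single_zero_mul, HahnSeries.coeff_single_mul, one_mul, sub_neg_eq_add,
      PowerSeries.coeff_coe]
  unfold residueAt
  simp only [h1]
  by_cases hr : (-(Module.finrank ℝ V : ℤ)) + r < 0
  · simp only [if_pos hr, mul_zero]
    have : (fun _ : dualLattice Γ => J fun _ => (0 : ℂ)) = 0 := by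
      ext l
      exact map_zero J
    rw [this]
    exact zero_mem _
  · simp only [if_neg hr, PowerSeries.coeff_mul, coeff_expPS]
    set d := (-(Module.finrank ℝ V : ℤ) + r).natAbs
    have h2 : (fun l : dualLattice Γ => J fun z : tube β => χ l *
        ∑ q ∈ Finset.HasAntidiagonal.antidiagonal d,
          pair (l : StrongDual ℝ V) (z : VC V) ^ q.1 / (q.1.factorial : ℂ) *
            PowerSeries.coeff q.2 (P z)) =
        (fun l => χ l) * ∑ q ∈ Finset.HasAntidiagonal.antidiagonal d,
          fun l : dualLattice Γ => J fun z : tube β => pair (l : StrongDual ℝ V) (z : VC V) ^ q.1 *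
            ((q.1.factorial : ℂ)⁻¹ * PowerSeries.coeff q.2 (P z)) := by
      ext l
      rw [Pi.mul_apply, Finset.sum_apply, ← map_sum, ← smul_eq_mul, ← map_smul]
      congr 1
      ext z
      rw [Pi.smul_apply, Finset.sum_apply, smul_eq_mul]
      congr 1
      exact Finset.sum_congr rfl fun q _ => by rw [div_eq_mul_inv, mul_assoc]
    rw [h2]
    exact mul_mem hχ (Subalgebra.sum_mem _ fun q _ => apply_pair_pow_mem_expPoly h J _ _)

/-- The weighted forms: the form `β i` with the weight `exp (y i)`. -/
def expWeight (hβ : ∀ i, β i ∈ dualLattice Γ) (y : Fin N → ℂ) (i : Fin N) :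
    Weight (dualLattice Γ) :=
  (⟨β i, hβ i⟩, Additive.ofMul (Units.mk0 (Complex.exp (y i)) (Complex.exp_ne_zero _)))

theorem mult_expWeight (hβ : ∀ i, β i ∈ dualLattice Γ) (y : Fin N → ℂ) (i : Fin N) :
    mult (expWeight hβ y i) = Complex.exp (y i) := rfl

theorem coe_fst_expWeight (hβ : ∀ i, β i ∈ dualLattice Γ) (y : Fin N → ℂ) (i : Fin N) :
    ((expWeight hβ y i).1 : StrongDual ℝ V) = β i := rfl

theorem charOf_expWeight_iff (hβ : ∀ i, β i ∈ dualLattice Γ) (y : Fin N → ℂ) (i : Fin N)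
    (p : VC V) : charOf Γ p (expWeight hβ y i).1 = mult (expWeight hβ y i) ↔
      Complex.exp (pair (β i) p) = Complex.exp (-y i) := by
  rw [charOf_apply, mult_expWeight, coe_fst_expWeight, Complex.exp_neg, Complex.exp_neg,
    inv_eq_iff_eq_inv]

theorem posForm_of_mem_expWeight (hβ : ∀ i, β i ∈ dualLattice Γ) (y : Fin N → ℂ) :
    ∀ b ∈ Finset.univ.val.map (expWeight hβ y), PosForm β (b.1 : StrongDual ℝ V) := by
  intro b hb
  obtain ⟨i, _, rfl⟩ := Multiset.mem_map.1 hb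
  exact posForm_apply β i

/-- A finite reduced set of poles exists. -/
theorem exists_isReducedPoleSet (h : IsDualPair Γ e γ) (hβ : ∀ i, β i ∈ dualLattice Γ)
    (y : Fin N → ℂ) : ∃ RG : Finset (VC V), IsReducedPoleSet Γ β y c RG := by
  have hfin : (charOf Γ '' poleSet β y c).Finite := by
    refine (finite_poles h (Finset.univ.val.map (expWeight hβ y))).subset ?_
    rintro _ ⟨p, ⟨σ, hσ, _, hp⟩, rfl⟩
    exact ⟨fun k => expWeight hβ y (σ k), fun k => Multiset.mem_map_of_mem _ (Finset.mem_univ_val (σ k)),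
      hσ, fun k => (charOf_expWeight_iff hβ y _ p).2 (hp k)⟩
  -- One point of the pole set is chosen over each of its finitely many characters.
  obtain ⟨s, hs, hbij⟩ := Set.exists_subset_bijOn (poleSet β y c) (charOf Γ)
  have hsf : s.Finite := Set.Finite.of_finite_image (hbij.image_eq ▸ hfin) hbij.injOn
  refine ⟨hsf.toFinset, fun p hp => hs (hsf.mem_toFinset.1 hp), fun p hp => ?_⟩
  obtain ⟨q, hq, hqp⟩ := hbij.surjOn ⟨p, hp, rfl⟩
  refine ⟨q, ⟨hsf.mem_toFinset.2 hq, h.charOf_eq_iff.1 hqp.symm⟩, ?_⟩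
  rintro q' ⟨hq', hq'p⟩
  exact hbij.injOn (hsf.mem_toFinset.1 hq') hq ((h.charOf_eq_iff.2 hq'p).symm.trans hqp.symm)

theorem iota_eq_sum_residueAt {J : (tube β → ℂ) →ₗ[ℂ] ℂ} (hJ : IsResidue e a J)
    (ha : IsGeneric Γ a) (hβ : ∀ i, β i ∈ dualLattice Γ)
    (hspan : Submodule.span ℝ (Set.range β) = ⊤)
    (hc : ∀ σ : Fin (Module.finrank ℝ V) → Fin N, IsBasisTuple β σ →
      (c ⊆ coneOf (fun k => β (σ k)) ↔ a ∈ coneOf (fun k => β (σ k))))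
    (hvol : ∀ σ : Fin (Module.finrank ℝ V) → StrongDual ℝ V,
      ((volDual Γ) (parallelepiped σ)).toReal = |e.det σ|)
    (y : Fin N → ℂ) (RG : Finset (VC V)) (l : dualLattice Γ) :
    iota Γ β y c RG l =
      ∑ p ∈ RG, residueAt J (charOf Γ p) (Finset.univ.val.map (expWeight hβ y)) l := by
  refine Finset.sum_congr rfl fun p _ => ?_
  rw [JK_Tres_eq hJ ha hβ hspan hc hvol (homComponent_mem_ratFun β _ _ _), residueAt,
    ← smul_eq_mul, ← map_smul]
  congr 1
  ext z
  rw [Pi.smul_apply, restrictTube_apply, homComponent_eq, genSeries, Multiset.map_map, mul_assoc,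
    HahnSeries.C_apply, HahnSeries.coeff_single_zero_mul, charOf_apply, smul_eq_mul]
  congr 3
  refine Finset.prod_congr rfl fun i _ => ?_
  rw [Function.comp_apply, mult_expWeight, charOf_apply, AddSubgroup.coe_neg, pair_neg, neg_neg,
    coe_fst_expWeight, mul_comm (Complex.exp (y i))]

/-- A reduced set represents each character of the pole set once. Any other character has residue 0,
since a nonzero residue provides a basis of polar forms whose cone contains `a`, hence contains the
chamber. -/
theorem iota_eq_residueSum (h : IsDualPair Γ e γ) {J : (tube β → ℂ) →ₗ[ℂ] ℂ}
    (hJ : IsResidue e a J) (ha : IsGeneric Γ a) (hβ : ∀ i, β i ∈ dualLattice Γ)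
    (hspan : Submodule.span ℝ (Set.range β) = ⊤)
    (hc : ∀ σ : Fin (Module.finrank ℝ V) → Fin N, IsBasisTuple β σ →
      (c ⊆ coneOf (fun k => β (σ k)) ↔ a ∈ coneOf (fun k => β (σ k))))
    (hvol : ∀ σ : Fin (Module.finrank ℝ V) → StrongDual ℝ V,
      ((volDual Γ) (parallelepiped σ)).toReal = |e.det σ|)
    (y : Fin N → ℂ) {RG : Finset (VC V)} (hRG : IsReducedPoleSet Γ β y c RG)
    (l : dualLattice Γ) :
    iota Γ β y c RG l = residueSum J (Finset.univ.val.map (expWeight hβ y)) l := by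
  classical
  have hinj : Set.InjOn (charOf Γ) RG := by
    intro p hp q hq hpq
    exact (hRG.2 p (hRG.1 p hp)).unique ⟨hp, h.charOf_eq_iff.1 rfl⟩ ⟨hq, h.charOf_eq_iff.1 hpq⟩
  rw [iota_eq_sum_residueAt hJ ha hβ hspan hc hvol, residueSum,
    finsum_eq_sum_of_support_subset (s := RG.image (charOf Γ)), Finset.sum_image hinj]
  intro χ hχ
  by_contra hχRG
  refine hχ (residueAt_eq_zero hJ ha hβ hspan (posForm_of_mem_expWeight hβ y) ?_ l)
  rintro ⟨σ, hσΦ, hli, hσχ, hcone⟩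
  have hi : ∀ k, ∃ i, expWeight hβ y i = σ k := fun k => by
    obtain ⟨i, _, hi⟩ := Multiset.mem_map.1 (hσΦ k)
    exact ⟨i, hi⟩
  choose i hi using hi
  obtain rfl : (fun k => expWeight hβ y (i k)) = σ := funext hi
  obtain ⟨p, rfl⟩ := h.charOf_surjective χ
  have hp : p ∈ poleSet β y c := ⟨i, hli, (hc i hli).2 hcone,
    fun k => (charOf_expWeight_iff hβ y _ p).1 (hσχ k)⟩
  obtain ⟨q, ⟨hq, hpq⟩, _⟩ := hRG.2 p hp
  rw [h.charOf_eq_iff.2 hpq] at hχRG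
  exact hχRG (Finset.mem_coe.2 (Finset.mem_image_of_mem _ hq))

theorem expSum_eq_partitionFun (hβ : ∀ i, β i ∈ dualLattice Γ) {ht : dualLattice Γ →+ ℝ}
    (hht : ∀ l : dualLattice Γ, PosForm β (l : StrongDual ℝ V) → 0 < ht l) (y : Fin N → ℂ)
    (l : dualLattice Γ) : (latticePoints β (l : StrongDual ℝ V)).Finite ∧
      expSum β y (l : StrongDual ℝ V) =
        partitionFun ht (Finset.univ.val.map (expWeight hβ y)) l := by
  classical
  obtain ⟨h1, h2⟩ := partitionFun_eq_finsum hht N (expWeight hβ y) (fun i => posForm_apply β i) l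
  set S : Set (Fin N → ℕ) := {ξ | ∑ i, ξ i • (expWeight hβ y i).1 = l} with hS
  set φ : (Fin N → ℕ) → Fin N → ℤ := fun ξ i => ξ i
  have hφ : Function.Injective φ := fun ξ ξ' hξ => funext fun i => Int.ofNat_inj.1 (congrFun hξ i)
  have hmem : ∀ ξ : Fin N → ℕ, ξ ∈ S ↔ ∑ i, (ξ i : ℝ) • β i = (l : StrongDual ℝ V) := by
    intro ξ
    rw [hS, Set.mem_ofPred_eq, Subtype.ext_iff, AddSubgroup.val_finsetSum]
    simp only [AddSubgroup.coe_nsmul, coe_fst_expWeight, Nat.cast_smul_eq_nsmul]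
  have himage : latticePoints β (l : StrongDual ℝ V) = φ '' S := by
    ext ξ
    constructor
    · rintro ⟨h0, hsum⟩
      have hξ : ∀ i, ((ξ i).toNat : ℤ) = ξ i := fun i =>
        Int.toNat_of_nonneg (Int.cast_nonneg_iff.1 (h0 i))
      refine ⟨fun i => (ξ i).toNat, (hmem _).2 ?_, ?_⟩
      · rw [← hsum]
        refine Finset.sum_congr rfl fun i _ => ?_
        change _ = (ξ i : ℝ) • β i
        rw [← Int.cast_natCast, hξ]
      · exact funext hξ
    · rintro ⟨ξ, hξ, rfl⟩
      exact ⟨fun i => by simp [φ], by simpa [φ] using (hmem ξ).1 hξ⟩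
  refine ⟨himage ▸ h1.image φ, ?_⟩
  rw [h2, expSum, himage, finsum_mem_image hφ.injOn, finsum_mem_def]
  refine finsum_congr fun ξ => ?_
  by_cases hξ : ξ ∈ S
  · rw [Set.indicator_of_mem hξ, if_pos (by exact hξ), Complex.exp_sum]
    refine Finset.prod_congr rfl fun i _ => ?_
    rw [mult_expWeight, ← Complex.exp_nat_mul, mul_comm]
    simp [φ]
  · rw [Set.indicator_of_notMem hξ, if_neg (by exact hξ)]

end Iota

end ExpSum

end

theorem mainTheorem4 {V : Type*} [NormedAddCommGroup V] [NormedSpace ℝ V] [FiniteDimensional ℝ V]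
    (Γ : Submodule ℤ V) [DiscreteTopology Γ] [IsZLattice ℝ Γ]
    {N : ℕ} (β : Fin N → StrongDual ℝ V)
    (hβ : ∀ i, β i ∈ ExpSum.dualLattice Γ)
    (hspan : Submodule.span ℝ (Set.range β) = ⊤)
    (hpos : ∃ v : V, ∀ i, 0 < β i v)
    (c : Set (StrongDual ℝ V)) (hc : ExpSum.IsBigChamber β c)
    (y : Fin N → ℂ) :
    (∃ RG : Finset (ExpSum.VC V), ExpSum.IsReducedPoleSet Γ β y c RG) ∧
    ∀ RG : Finset (ExpSum.VC V), ExpSum.IsReducedPoleSet Γ β y c RG →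
      ExpSum.iota Γ β y c RG ∈ ExpSum.expPoly (ExpSum.dualLattice Γ) ∧
      ∀ l : ExpSum.dualLattice Γ, (l : StrongDual ℝ V) ∈ c - parallelepiped β →
        (ExpSum.latticePoints β (l : StrongDual ℝ V)).Finite ∧
        ExpSum.expSum β y (l : StrongDual ℝ V) = ExpSum.iota Γ β y c RG l := by
  obtain ⟨e, γ, h, hvol⟩ := ExpSum.exists_isDualPair_volDual Γ
  refine ⟨ExpSum.exists_isReducedPoleSet h hβ y, fun RG hRG => ⟨?_, fun l hl => ?_⟩⟩
  -- For the shape of `iota` any generic point of the chamber will do.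
  · obtain ⟨a, hac, ha⟩ := ExpSum.exists_isGeneric_mem h (hc.isOpen hpos) hc.nonempty
    obtain ⟨J, hJ⟩ := ExpSum.exists_residue_functional e hpos a
    have hiota : ExpSum.iota Γ β y c RG = ∑ p ∈ RG, ExpSum.residueAt J (ExpSum.charOf Γ p)
        (Finset.univ.val.map (ExpSum.expWeight hβ y)) := by
      ext l
      rw [Finset.sum_apply]
      exact ExpSum.iota_eq_sum_residueAt hJ ha hβ hspan
        (fun σ hσ => hc.subset_coneOf_iff hac hσ) hvol y RG l
    rw [hiota]
    exact Subalgebra.sum_mem _ fun p _ => ExpSum.residueAt_mem_expPoly h J _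
      (ExpSum.posForm_of_mem_expWeight hβ y)
  -- Here `a` depends on `l`. This is harmless, since `iota` depends only on the chamber.
  · obtain ⟨a, hac, ha, hal⟩ := hc.exists_isGeneric hpos hspan h hl
    obtain ⟨J, hJ⟩ := ExpSum.exists_residue_functional e hpos a
    obtain ⟨v, hv⟩ := hpos
    let ht : ExpSum.dualLattice Γ →+ ℝ :=
      { toFun := fun l => (l : StrongDual ℝ V) v
        map_zero' := rfl
        map_add' := fun _ _ => rfl }
    have hht : ∀ l : ExpSum.dualLattice Γ, ExpSum.PosForm β (l : StrongDual ℝ V) → 0 < ht l :=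
      fun l hl => hl.apply_pos hv
    obtain ⟨hfin, hsum⟩ := ExpSum.expSum_eq_partitionFun hβ hht y l
    refine ⟨hfin, ?_⟩
    rw [hsum, ExpSum.iota_eq_residueSum h hJ ha hβ hspan
      (fun σ hσ => hc.subset_coneOf_iff hac hσ) hvol y hRG l]
    exact ExpSum.partitionFun_eq_residueSum h hJ ha hβ hspan hht
      (ExpSum.coe_fst_expWeight hβ y) hal
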